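/- Let $p,q\ge 0$ be integers, $T^q=\mathbb R^q/\mathbb Z^q$, and let $\varphi$ be an affine $\mathbb Z^p$-action on $T^q$, i.e. a homomorphism from $\mathbb Z^p$ to the group of transformations $x\mapsto Ax+a$ of $T^q$ with $A\in GL(q,\mathbb Z)$, $a\in T^q$. Write $\mathbf A(\ell)\in GL(q,\mathbb Z)$ for the linear part of $\varphi(\ell)$, and choose lifts $x\mapsto \mathbf A(\ell)x+\widetilde\alpha(\ell)$ of the $\varphi(\ell)$ to $\mathbb R^q$. Then $k(\ell,\ell')=\widetilde\alpha(\ell)-\widetilde\alpha(\ell+\ell')+\mathbf A(\ell)\widetilde\alpha(\ell')$ lies in $\mathbb Z^q$. A *principal affine action* of $\varphi$ is an affine $\mathbb Z^p$-action $\psi$ on $T^q$ such that, for some choice of lifts, some integer $s\ge 1$ and some map $\widetilde\beta:\mathbb Z^p\to\mathbb Z^q$ with $$s\,k(\ell,\ell')=\widetilde\beta(\ell)-\widetilde\beta(\ell+\ell')+\mathbf A(\ell)\widetilde\beta(\ell')\qquad(\ell,\ell'\in\mathbb Z^p),$$ each $\psi(\ell)$ is covered by $x\mapsto \mathbf A(\ell)x+\widetilde\alpha(\ell)-\frac1s\widetilde\beta(\ell)$.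 An affine action $\varphi$ is *free* if $\varphi(\ell)$ has no fixed point for every $\ell\ne 0$; it is *minimal* if every orbit is dense; it is *1-cohomologically rigid* if for every family of smooth functions $c(\ell,\cdot):T^q\to\mathbb R$ with $c(\ell+\ell',x)=c(\ell,\varphi(\ell')x)+c(\ell',x)$ there are a homomorphism $h:\mathbb Z^p\to\mathbb R$ and a smooth $u:T^q\to\mathbb R$ with $c(\ell,x)=h(\ell)+u(\varphi(\ell)x)-u(x)$ for all $\ell\in\mathbb Z^p$, $x\in T^q$. Proposition. Every affine $\mathbb Z^p$-action $\varphi$ on $T^q$ has a principal affine action, and every principal affine action $\psi$ of $\varphi$ is isotopic, through a continuous path of affine $\mathbb Z^p$-actions, to the linear part $\ell\mapsto(x\mapsto\mathbf A(\ell)x)$ of $\varphi$. Moreover: (i) if $\varphi$ is free, then $\psi$ is free; (ii) if $\varphi$ is minimal, then $\psi$ is minimal; (iii) if $\varphi$ is 1-cohomologically rigid, then $\psi$ is 1-cohomologically rigid. -/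

import Mathlib

open scoped ContDiff

namespace TorusAction

/-- The torus `T^q = ℝ^q / ℤ^q`. -/
abbrev Torus (q : ℕ) : Type := Fin q → UnitAddCircle

/-- The covering map `ℝ^q → T^q`. -/
def proj {q : ℕ} (x : Fin q → ℝ) : Torus q := fun i => (x i : UnitAddCircle)

/-- The action of an integer matrix on the torus. -/
def toral {q : ℕ} (A : Matrix (Fin q) (Fin q) ℤ) (x : Torus q) : Torus q :=
  fun i => ∑ j, A i j • x j

/-- The action of an integer matrix on `ℝ^q`. -/
def realMap {q : ℕ} (A : Matrix (Fin q) (Fin q) ℤ) (x : Fin q → ℝ) : Fin q → ℝ :=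
  fun i => ∑ j, (A i j : ℝ) * x j

/-- An integer vector regarded as a real vector. -/
def toReal {q : ℕ} (n : Fin q → ℤ) : Fin q → ℝ := fun i => (n i : ℝ)

theorem toral_add {q : ℕ} (A : Matrix (Fin q) (Fin q) ℤ) (x y : Torus q) :
    toral A (x + y) = toral A x + toral A y := by
  funext i; simp [toral, Finset.sum_add_distrib]

theorem toral_zero {q : ℕ} (A : Matrix (Fin q) (Fin q) ℤ) : toral A 0 = 0 := by
  funext i; simp [toral]

theorem toral_one {q : ℕ} (x : Torus q) : toral 1 x = x := by
  funext i; simp [toral, Matrix.one_apply, ite_smul]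

theorem toral_mul {q : ℕ} (A B : Matrix (Fin q) (Fin q) ℤ) (x : Torus q) :
    toral (A * B) x = toral A (toral B x) := by
  funext i
  simp only [toral, Matrix.mul_apply, Finset.sum_smul, Finset.smul_sum, mul_smul]
  exact Finset.sum_comm

/-- `Affine(T^q)`: the group of all transformations `x ↦ A x + a` with `A ∈ GL(q, ℤ)` and
`a ∈ T^q`. -/
def affineGroup (q : ℕ) : Subgroup (Equiv.Perm (Torus q)) where
  carrier := {f | ∃ (A : GL (Fin q) ℤ) (a : Torus q), ∀ x, f x = toral A.val x + a}
  one_mem' := ⟨1, 0, fun x => by simp [toral_one]⟩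
  mul_mem' := by
    rintro f g ⟨A, a, hf⟩ ⟨B, b, hg⟩
    refine ⟨A * B, toral A.val b + a, fun x => ?_⟩
    rw [Equiv.Perm.mul_apply, hg, hf, toral_add, Units.val_mul, toral_mul, add_assoc]
  inv_mem' := by
    rintro f ⟨A, a, hf⟩
    refine ⟨A⁻¹, -toral (A⁻¹).val a, fun x => ?_⟩
    obtain ⟨y, rfl⟩ := f.surjective x
    have hi : f⁻¹ (f y) = y := f.symm_apply_apply y
    rw [hi, hf, toral_add, ← toral_mul, Units.inv_mul, toral_one]
    abel

/-- An affine `ℤ^p`-action on `T^q`: a homomorphism from `ℤ^p` to `Affine(T^q)`. -/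
abbrev AffineAction (p q : ℕ) : Type := Multiplicative (Fin p → ℤ) →* affineGroup q

variable {p q : ℕ}

/-- The transformation `φ(ℓ)` of the torus. -/
def act (φ : AffineAction p q) (ℓ : Fin p → ℤ) (x : Torus q) : Torus q :=
  (φ (Multiplicative.ofAdd ℓ)).val x

theorem act_zero (φ : AffineAction p q) (x : Torus q) : act φ 0 x = x := by
  simp [act]

theorem act_add (φ : AffineAction p q) (ℓ ℓ' : Fin p → ℤ) (x : Torus q) :
    act φ (ℓ + ℓ') x = act φ ℓ (act φ ℓ' x) := by
  simp [act, ofAdd_add]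

theorem act_affine (φ : AffineAction p q) (ℓ : Fin p → ℤ) :
    ∃ A : GL (Fin q) ℤ, ∀ x, act φ ℓ x = toral A.val x + act φ ℓ 0 := by
  obtain ⟨A, a, h⟩ := (φ (Multiplicative.ofAdd ℓ)).property
  refine ⟨A, fun x => ?_⟩
  have h0 : act φ ℓ 0 = a := by
    have := h 0
    rw [toral_zero, zero_add] at this
    exact this
  rw [h0]; exact h x

theorem act_sub (φ : AffineAction p q) (ℓ ℓ' : Fin p → ℤ) (x : Torus q) :
    act φ ℓ (act φ ℓ' x - act φ ℓ' 0) - act φ ℓ 0 = act φ (ℓ + ℓ') x - act φ (ℓ + ℓ') 0 := by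
  obtain ⟨A, h⟩ := act_affine φ ℓ
  have h1 : toral A.val (act φ ℓ' x)
      = toral A.val (act φ ℓ' x - act φ ℓ' 0) + toral A.val (act φ ℓ' 0) := by
    rw [← toral_add, sub_add_cancel]
  rw [act_add, act_add, h (act φ ℓ' x - act φ ℓ' 0), h (act φ ℓ' x), h (act φ ℓ' 0), h1]
  abel

/-- The linear part of a single transformation, `x ↦ φ(ℓ)(x) - φ(ℓ)(0)`. -/
def linearPerm (φ : AffineAction p q) (ℓ : Fin p → ℤ) : Equiv.Perm (Torus q) where
  toFun x := act φ ℓ x - act φ ℓ 0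
  invFun x := act φ (-ℓ) x - act φ (-ℓ) 0
  left_inv x := by simp [act_sub, act_zero]
  right_inv x := by simp [act_sub, act_zero]

/-- The linear part of an affine action, as an action on the torus by automorphisms:
if `φ(ℓ)(x) = A(ℓ) x + α(ℓ)`, this is the action `ℓ ↦ (x ↦ A(ℓ) x)`. -/
def linearPart (φ : AffineAction p q) : AffineAction p q where
  toFun m := ⟨linearPerm φ m.toAdd, by
    obtain ⟨A, h⟩ := act_affine φ m.toAdd
    refine ⟨A, 0, fun x => ?_⟩
    change act φ m.toAdd x - act φ m.toAdd 0 = _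
    rw [h x, add_sub_cancel_right, add_zero]⟩
  map_one' := by
    apply Subtype.ext; apply Equiv.ext; intro x
    change act φ 0 x - act φ 0 0 = x
    simp [act_zero]
  map_mul' m n := by
    apply Subtype.ext; apply Equiv.ext; intro x
    change act φ (m.toAdd + n.toAdd) x - act φ (m.toAdd + n.toAdd) 0
      = act φ m.toAdd (act φ n.toAdd x - act φ n.toAdd 0) - act φ m.toAdd 0
    rw [act_sub]

/-- `ψ` is a principal affine action of `φ`. Here `A` is the linear part of `φ`, the maps
`x ↦ A(ℓ) x + α(ℓ)` are lifts of the `φ(ℓ)` to `ℝ^q`, `k` is the resulting integral 2-cocycle,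
`s k` is the coboundary of the integral 1-cochain `β`, and `ψ(ℓ)` is covered by
`x ↦ A(ℓ) x + α(ℓ) - (1/s) β(ℓ)`. -/
def IsPrincipal (φ ψ : AffineAction p q) : Prop :=
  ∃ (A : (Fin p → ℤ) → GL (Fin q) ℤ) (α : (Fin p → ℤ) → (Fin q → ℝ))
    (k : (Fin p → ℤ) → (Fin p → ℤ) → (Fin q → ℤ)) (s : ℕ) (β : (Fin p → ℤ) → (Fin q → ℤ)),
    (∀ ℓ x, act φ ℓ (proj x) = proj (realMap (A ℓ).val x + α ℓ)) ∧
    (∀ ℓ ℓ', toReal (k ℓ ℓ') = α ℓ - α (ℓ + ℓ') + realMap (A ℓ).val (α ℓ')) ∧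
    0 < s ∧
    (∀ ℓ ℓ', (s : ℤ) • k ℓ ℓ' = β ℓ - β (ℓ + ℓ') + (A ℓ).val.mulVec (β ℓ')) ∧
    (∀ ℓ x, act ψ ℓ (proj x) =
      proj (realMap (A ℓ).val x + (α ℓ - (1 / (s : ℝ)) • toReal (β ℓ))))

/-- Two affine actions are isotopic: they are joined by a continuous path of affine
`ℤ^p`-actions. -/
def Isotopic (φ ψ : AffineAction p q) : Prop :=
  ∃ Φ : unitInterval → AffineAction p q, Φ 0 = φ ∧ Φ 1 = ψ ∧
    ∀ ℓ, Continuous fun z : unitInterval × Torus q => act (Φ z.1) ℓ z.2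

/-- The action is free: `φ(ℓ)` has no fixed point for `ℓ ≠ 0`. -/
def IsFree (φ : AffineAction p q) : Prop :=
  ∀ ℓ, ℓ ≠ 0 → ∀ x, act φ ℓ x ≠ x

/-- The action is minimal: every orbit is dense. -/
def IsMinimal (φ : AffineAction p q) : Prop :=
  ∀ x, Dense (Set.range fun ℓ => act φ ℓ x)

/-- A real function on `T^q = ℝ^q / ℤ^q` is smooth when its lift to `ℝ^q` is. -/
def IsSmooth (f : Torus q → ℝ) : Prop :=
  ContDiff ℝ ∞ fun x : Fin q → ℝ => f (proj x)

/-- Smooth real 1-cocycles over the action `φ`. -/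
def IsSmoothCocycle (φ : AffineAction p q) (c : (Fin p → ℤ) → Torus q → ℝ) : Prop :=
  (∀ ℓ, IsSmooth (c ℓ)) ∧ ∀ ℓ ℓ' x, c (ℓ + ℓ') x = c ℓ (act φ ℓ' x) + c ℓ' x

/-- The action is 1-cohomologically rigid: every smooth real 1-cocycle is cohomologous, through a
smooth transfer function, to a constant cocycle (a homomorphism `ℤ^p → ℝ`). -/
def IsCohomologicallyRigid (φ : AffineAction p q) : Prop :=
  ∀ c, IsSmoothCocycle φ c →
    ∃ (h : (Fin p → ℤ) →+ ℝ) (u : Torus q → ℝ), IsSmooth u ∧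
      ∀ ℓ x, c ℓ x = h ℓ + (u (act φ ℓ x) - u x)

end TorusAction

/-! ### Affine data, existence of principal actions, and the isotopy -/

namespace TorusAction

section Basic

variable {p q : ℕ}

/-! Existence (`exists_principal`): a `ℚ`-linear retraction of `ℝ` onto `ℚ`, applied to the
coordinates of the lifts `α`, gives a rational 1-cochain with coboundary `k`. Its denominators are
bounded because `ℤ^p` is finitely generated and `k` is integral, so a multiple `s` of it is an
integral `β`. Then `γ = α - β/s` is an honest real cocycle (`IsPrincipal.exists_data`), and scaling
it to `0` is the isotopy to the linear part.

The translation parts of `φ` and `ψ` differ by `s`-torsion. The linear parts of a finite-index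
subgroup are trivial mod `s`, so they fix `s`-torsion, and the two actions agree on some `N • ℤ^p`
(`HasData.exists_agree`). Freeness passes over since `ℤ^p` is torsion free; minimality passes over
since, the torus being connected, a minimal action stays minimal on `N • ℤ^p`
(`IsMinimal.dense_nsmul`).

Rigidity is moved to Fourier coefficients. There each action is a monomial representation of `ℤ^p`
on rapidly decreasing functions on `ℤ^q`: a lattice action, the same for `φ` and `ψ`, with
unimodular phases `σ` for `φ` and `τ` for `ψ` satisfying `σ ^ s = τ ^ s`. It remains to solve the
cohomological equation for `τ`, knowing that it is solvable for `σ` (`Phase.Rigid.of_pow_eq`). The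
principle throughout: a function `D` invariant, or nearly so, for `τ` on an orbit produces one for
`σ` on a multiple of that orbit, because `σ ℓ (s • x) = σ ℓ x ^ s = τ ℓ x ^ s`; rigidity of `σ` then
restricts it.

On finite orbits one divides by `τ - 1` on a common period, so small divisors must be excluded
(`Phase.Rigid.diophantine`): too many near resonances of `τ` would give a function for `σ` of
modulus one at arbitrarily large points, with rapidly decreasing coboundary, and rigidity forbids
it.

On infinite orbits the solution is a one-sided sum along a direction `g`. It decays only if the
two-sided sum vanishes and one of the two half orbits stays polynomially far out. Vanishing
(`Phase.Rigid.tsum_term_eq_zero`): a nonzero sum has constant modulus on the orbit, so summability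
confines the orbit to finitely many lines in direction `g`; cutting the orbit in half then gives a
formal vector with finitely supported coboundary that no rapidly decreasing correction makes
invariant. The far-out half (`exists_half_orbit_bound`) comes from `exists_intermediate_bound`,
which controls the points between two small points of an orbit of one integral matrix through the
roots of the annihilator of the starting point and Kronecker's theorem. -/

theorem proj_add (x y : Fin q → ℝ) : proj (x + y) = proj x + proj y := by
  funext i; simp [proj]

theorem proj_sub (x y : Fin q → ℝ) : proj (x - y) = proj x - proj y := by
  funext i; simp [proj]

theorem proj_zero : proj (0 : Fin q → ℝ) = 0 := by
  funext i; simp [proj]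

theorem proj_nsmul (n : ℕ) (x : Fin q → ℝ) : proj ((n : ℝ) • x) = n • proj x := by
  funext i
  simp only [proj, Pi.smul_apply, smul_eq_mul]
  rw [← AddCircle.coe_nsmul, nsmul_eq_mul]

theorem proj_surjective : Function.Surjective (proj : (Fin q → ℝ) → Torus q) := by
  intro x
  choose y hy using fun i => QuotientAddGroup.mk_surjective (x i)
  exact ⟨y, funext hy⟩

theorem continuous_proj : Continuous (proj : (Fin q → ℝ) → Torus q) :=
  continuous_pi fun i => (AddCircle.continuous_mk' 1).comp (continuous_apply i)

theorem proj_toReal (n : Fin q → ℤ) : proj (toReal n) = 0 := by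
  funext i
  change ((n i : ℝ) : UnitAddCircle) = 0
  rw [AddCircle.coe_eq_zero_iff]
  exact ⟨n i, by simp⟩

theorem proj_eq_zero {x : Fin q → ℝ} (h : proj x = 0) : ∃ n : Fin q → ℤ, x = toReal n := by
  have h' : ∀ i, ∃ n : ℤ, x i = n := fun i => by
    have := congrFun h i
    change ((x i : ℝ) : UnitAddCircle) = 0 at this
    rw [AddCircle.coe_eq_zero_iff] at this
    obtain ⟨n, hn⟩ := this
    exact ⟨n, by rw [← hn]; simp⟩
  choose n hn using h'
  exact ⟨n, funext hn⟩

theorem proj_realMap (A : Matrix (Fin q) (Fin q) ℤ) (x : Fin q → ℝ) :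
    proj (realMap A x) = toral A (proj x) := by
  funext i
  change ((∑ j, (A i j : ℝ) * x j : ℝ) : UnitAddCircle) = ∑ j, A i j • (x j : UnitAddCircle)
  have : ((∑ j, (A i j : ℝ) * x j : ℝ) : UnitAddCircle) =
      ∑ j, (((A i j : ℝ) * x j : ℝ) : UnitAddCircle) :=
    map_sum (QuotientAddGroup.mk' (AddSubgroup.zmultiples (1 : ℝ))) _ _
  rw [this]
  simp [← zsmul_eq_mul]

theorem realMap_smul (A : Matrix (Fin q) (Fin q) ℤ) (t : ℝ) (x : Fin q → ℝ) :
    realMap A (t • x) = t • realMap A x := by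
  funext i; simp only [realMap, Pi.smul_apply, smul_eq_mul, Finset.mul_sum]
  exact Finset.sum_congr rfl fun j _ => by ring

theorem realMap_sub (A : Matrix (Fin q) (Fin q) ℤ) (x y : Fin q → ℝ) :
    realMap A (x - y) = realMap A x - realMap A y := by
  funext i; simp [realMap, mul_sub, Finset.sum_sub_distrib]

theorem realMap_toReal (A : Matrix (Fin q) (Fin q) ℤ) (n : Fin q → ℤ) :
    realMap A (toReal n) = toReal (A.mulVec n) := by
  funext i; simp [realMap, toReal, Matrix.mulVec, dotProduct]

theorem continuous_toral (A : Matrix (Fin q) (Fin q) ℤ) : Continuous (toral A) := by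
  unfold toral; fun_prop

theorem toral_sub (A : Matrix (Fin q) (Fin q) ℤ) (x y : Torus q) :
    toral A (x - y) = toral A x - toral A y := by
  funext i; simp [toral, smul_sub, Finset.sum_sub_distrib]

theorem toral_injective {A B : Matrix (Fin q) (Fin q) ℤ} (h : ∀ x, toral A x = toral B x) :
    A = B := by
  ext i j
  by_contra hne
  have hd : A i j - B i j ≠ 0 := sub_ne_zero.2 hne
  have hd' : ((A i j - B i j : ℤ) : ℝ) ≠ 0 := by exact_mod_cast hd
  -- With `d` the difference of the two entries, the coordinate `1 / (2 d)` makes the images differ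
  -- by `1 / 2`, which is not an integer.
  have hx := congrFun (h (Pi.single j (((1 / (2 * (A i j - B i j : ℤ)) : ℝ)) : UnitAddCircle))) i
  simp only [toral, Pi.single_apply, smul_ite, smul_zero, Finset.sum_ite_eq', Finset.mem_univ,
    if_true] at hx
  rw [← sub_eq_zero, ← sub_smul, ← AddCircle.coe_zsmul, AddCircle.coe_eq_zero_iff] at hx
  obtain ⟨n, hn⟩ := hx
  rw [zsmul_eq_mul, zsmul_eq_mul] at hn
  have h2 : ((A i j - B i j : ℤ) : ℝ) * (1 / (2 * (A i j - B i j : ℤ))) = 1 / 2 := by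
    field_simp
  rw [h2] at hn
  have h3 : ((2 * n : ℤ) : ℝ) = ((1 : ℤ) : ℝ) := by push_cast; linarith
  have h4 : 2 * n = 1 := by exact_mod_cast h3
  omega

/-- `φ(ℓ)` is the transformation `x ↦ A(ℓ) x + a(ℓ)`. -/
def HasData (φ : AffineAction p q) (A : (Fin p → ℤ) → GL (Fin q) ℤ)
    (a : (Fin p → ℤ) → Torus q) : Prop :=
  ∀ ℓ x, act φ ℓ x = toral (A ℓ).val x + a ℓ

namespace HasData

variable {φ : AffineAction p q} {A : (Fin p → ℤ) → GL (Fin q) ℤ} {a : (Fin p → ℤ) → Torus q}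

theorem act_zero_eq (h : HasData φ A a) (ℓ : Fin p → ℤ) : act φ ℓ 0 = a ℓ := by
  rw [h, toral_zero, zero_add]

theorem translation_add (h : HasData φ A a) (ℓ ℓ' : Fin p → ℤ) :
    a (ℓ + ℓ') = toral (A ℓ).val (a ℓ') + a ℓ := by
  rw [← h.act_zero_eq, act_add, h.act_zero_eq, h]

theorem linear_add (h : HasData φ A a) (ℓ ℓ' : Fin p → ℤ) : A (ℓ + ℓ') = A ℓ * A ℓ' := by
  apply Units.ext
  apply toral_injective
  intro x
  have := act_add φ ℓ ℓ' x
  rw [h, h ℓ', h ℓ, toral_add, h.translation_add, ← add_assoc, add_assoc, add_assoc] at this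
  rw [Units.val_mul, toral_mul]
  exact add_right_cancel this

theorem linear_zero (h : HasData φ A a) : A 0 = 1 := by
  have := h.linear_add 0 0
  rw [add_zero] at this
  exact (mul_eq_left.1 this.symm)

theorem translation_zero (h : HasData φ A a) : a 0 = 0 := by
  rw [← h.act_zero_eq, act_zero]

theorem continuous_act (h : HasData φ A a) (ℓ : Fin p → ℤ) : Continuous (act φ ℓ) := by
  have : act φ ℓ = fun x => toral (A ℓ).val x + a ℓ := funext (h ℓ)
  rw [this]
  exact (continuous_toral _).add continuous_const

end HasData

/-- The affine action with given linear parts and translation parts. -/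
def ofData (A : (Fin p → ℤ) → GL (Fin q) ℤ) (a : (Fin p → ℤ) → Torus q)
    (hA : ∀ ℓ ℓ', A (ℓ + ℓ') = A ℓ * A ℓ')
    (ha : ∀ ℓ ℓ', a (ℓ + ℓ') = toral (A ℓ).val (a ℓ') + a ℓ) : AffineAction p q :=
  have hA0 : A 0 = 1 := by
    have := hA 0 0
    rw [add_zero] at this
    exact (mul_eq_left.1 this.symm)
  have ha0 : a 0 = 0 := by
    have := ha 0 0
    rw [add_zero, hA0, Units.val_one, toral_one] at this
    exact (add_eq_left.1 this.symm)
  have hcomp : ∀ ℓ ℓ' x, toral (A ℓ).val (toral (A ℓ').val x + a ℓ') + a ℓ =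
      toral (A (ℓ + ℓ')).val x + a (ℓ + ℓ') := fun ℓ ℓ' x => by
    rw [hA, ha, toral_add, Units.val_mul, toral_mul, add_assoc]
  have hinv : ∀ ℓ x, toral (A (-ℓ)).val (toral (A ℓ).val x + a ℓ) + a (-ℓ) = x := fun ℓ x => by
    rw [hcomp, neg_add_cancel, hA0, ha0, Units.val_one, toral_one, add_zero]
  { toFun := fun m => ⟨{
      toFun := fun x => toral (A m.toAdd).val x + a m.toAdd
      invFun := fun x => toral (A (-m.toAdd)).val x + a (-m.toAdd)
      left_inv := fun x => hinv _ x
      right_inv := fun x => by simpa using hinv (-m.toAdd) x }, A m.toAdd, a m.toAdd, fun _ => rfl⟩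
    map_one' := by
      apply Subtype.ext; apply Equiv.ext; intro x
      change toral (A 0).val x + a 0 = x
      rw [hA0, ha0, Units.val_one, toral_one, add_zero]
    map_mul' := fun m n => by
      apply Subtype.ext; apply Equiv.ext; intro x
      exact (hcomp m.toAdd n.toAdd x).symm }

theorem hasData_ofData {A : (Fin p → ℤ) → GL (Fin q) ℤ} {a : (Fin p → ℤ) → Torus q}
    (hA : ∀ ℓ ℓ', A (ℓ + ℓ') = A ℓ * A ℓ')
    (ha : ∀ ℓ ℓ', a (ℓ + ℓ') = toral (A ℓ).val (a ℓ') + a ℓ) :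
    HasData (ofData A a hA ha) A a := fun _ _ => rfl

theorem action_ext {φ ψ : AffineAction p q} (h : ∀ ℓ x, act φ ℓ x = act ψ ℓ x) : φ = ψ := by
  apply MonoidHom.ext
  intro m
  apply Subtype.ext; apply Equiv.ext; intro x
  exact h m.toAdd x

theorem exists_hasData (φ : AffineAction p q) : ∃ A a, HasData φ A a := by
  choose A hA using act_affine φ
  exact ⟨A, fun ℓ => act φ ℓ 0, hA⟩

/-- Since `α` and `β / s` have the same coboundary `k`, their difference `γ` is a cocycle; and `s •
γ` differs from `s • α` by the integral vector `β`. Nothing else about principal actions is used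
later. -/
theorem IsPrincipal.exists_data {φ ψ : AffineAction p q} (h : IsPrincipal φ ψ) :
    ∃ (A : (Fin p → ℤ) → GL (Fin q) ℤ) (a : (Fin p → ℤ) → Torus q)
      (γ : (Fin p → ℤ) → Fin q → ℝ) (s : ℕ), 0 < s ∧ HasData φ A a ∧
      HasData ψ A (fun ℓ => proj (γ ℓ)) ∧
      (∀ ℓ ℓ', γ (ℓ + ℓ') = realMap (A ℓ).val (γ ℓ') + γ ℓ) ∧
      ∀ ℓ, s • a ℓ = s • proj (γ ℓ) := by
  obtain ⟨A, α, k, s, β, h1, h2, hs, h3, h4⟩ := h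
  have hs' : (s : ℝ) ≠ 0 := by exact_mod_cast hs.ne'
  refine ⟨A, fun ℓ => proj (α ℓ), fun ℓ => α ℓ - (1 / (s : ℝ)) • toReal (β ℓ), s, hs, ?_, ?_, ?_,
    ?_⟩
  · intro ℓ x
    obtain ⟨y, rfl⟩ := proj_surjective x
    rw [h1, proj_add, proj_realMap]
  · intro ℓ x
    obtain ⟨y, rfl⟩ := proj_surjective x
    rw [h4, proj_add, proj_realMap]
  · intro ℓ ℓ'
    have e3 : (s : ℝ) • toReal (k ℓ ℓ') =
        toReal (β ℓ) - toReal (β (ℓ + ℓ')) + realMap (A ℓ).val (toReal (β ℓ')) := by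
      rw [realMap_toReal]
      funext i
      have := congrFun (h3 ℓ ℓ') i
      simp only [Pi.smul_apply, smul_eq_mul, Pi.add_apply, Pi.sub_apply, toReal] at this ⊢
      exact_mod_cast this
    have e4 : toReal (k ℓ ℓ') = (1 / (s : ℝ)) • (toReal (β ℓ) - toReal (β (ℓ + ℓ')) +
        realMap (A ℓ).val (toReal (β ℓ'))) := by
      rw [← e3, smul_smul, one_div, inv_mul_cancel₀ hs', one_smul]
    rw [h2] at e4
    rw [realMap_sub, realMap_smul]
    rw [smul_add, smul_sub] at e4
    have e5 : α (ℓ + ℓ') = α ℓ + realMap (A ℓ).val (α ℓ') -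
        (α ℓ - α (ℓ + ℓ') + realMap (A ℓ).val (α ℓ')) := by abel
    beta_reduce
    rw [e5, e4]
    module
  · intro ℓ
    rw [← proj_nsmul, ← proj_nsmul, smul_sub, smul_smul, mul_one_div_cancel hs', one_smul,
      proj_sub, proj_toReal, sub_zero]

theorem linearPart_hasData {φ : AffineAction p q} {A : (Fin p → ℤ) → GL (Fin q) ℤ}
    {a : (Fin p → ℤ) → Torus q} (h : HasData φ A a) : HasData (linearPart φ) A 0 := by
  intro ℓ x
  change act φ ℓ x - act φ ℓ 0 = _
  rw [h.act_zero_eq, h, Pi.zero_apply, add_zero, add_sub_cancel_right]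

/-- The cocycle equation is linear over `ℝ` in `γ`, so every `(1 - t) • γ` satisfies it. Scaling
makes sense only because the cocycle lives in `ℝ^q` rather than on the torus. -/
theorem isotopic_of_lift {ψ χ : AffineAction p q} {A : (Fin p → ℤ) → GL (Fin q) ℤ}
    {γ : (Fin p → ℤ) → Fin q → ℝ} (h : HasData ψ A fun ℓ => proj (γ ℓ)) (hχ : HasData χ A 0)
    (hγ : ∀ ℓ ℓ', γ (ℓ + ℓ') = realMap (A ℓ).val (γ ℓ') + γ ℓ) : Isotopic ψ χ := by
  have ha : ∀ t : unitInterval, ∀ ℓ ℓ', proj ((1 - (t : ℝ)) • γ (ℓ + ℓ')) =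
      toral (A ℓ).val (proj ((1 - (t : ℝ)) • γ ℓ')) + proj ((1 - (t : ℝ)) • γ ℓ) := by
    intro t ℓ ℓ'
    rw [← proj_realMap, ← proj_add, realMap_smul, ← smul_add, ← hγ]
  refine ⟨fun t => ofData A (fun ℓ => proj ((1 - (t : ℝ)) • γ ℓ)) h.linear_add (ha t), ?_, ?_, ?_⟩
  · refine action_ext fun ℓ x => ?_
    rw [hasData_ofData, h]; simp
  · refine action_ext fun ℓ x => ?_
    rw [hasData_ofData, hχ]; simp [proj_zero]
  · intro ℓ
    change Continuous fun z : unitInterval × Torus q =>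
      toral (A ℓ).val z.2 + proj ((1 - (z.1 : ℝ)) • γ ℓ)
    refine ((continuous_toral _).comp continuous_snd).add (continuous_proj.comp ?_)
    fun_prop

theorem exists_principal (φ : AffineAction p q) : ∃ ψ, IsPrincipal φ ψ := by
  obtain ⟨A, a, h⟩ := exists_hasData φ
  choose α hα using fun ℓ => proj_surjective (a ℓ)
  have hk : ∀ ℓ ℓ', ∃ n : Fin q → ℤ,
      α ℓ - α (ℓ + ℓ') + realMap (A ℓ).val (α ℓ') = toReal n := by
    intro ℓ ℓ'
    apply proj_eq_zero
    rw [proj_add, proj_sub, proj_realMap, hα, hα, hα, h.translation_add]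
    abel
  choose k hk using hk
  -- `π` is `ℚ`-linear and fixes `ℚ`. It therefore commutes with integral matrices and keeps `k`, so
  -- `π ∘ α` is a rational cochain with the coboundary of `α`.
  obtain ⟨π, hπ⟩ := LinearMap.exists_leftInverse_of_injective (Algebra.linearMap ℚ ℝ)
    (LinearMap.ker_eq_bot.2 (algebraMap ℚ ℝ).injective)
  have hπq : ∀ r : ℚ, π (r : ℝ) = r := fun r => by
    have := LinearMap.congr_fun hπ r
    simpa using this
  set f : (Fin p → ℤ) → Fin q → ℚ := fun ℓ i => π (α ℓ i) with hf
  have hfk : ∀ ℓ ℓ' i, f (ℓ + ℓ') i = f ℓ i + (∑ j, ((A ℓ).val i j : ℚ) * f ℓ' j) - k ℓ ℓ' i := by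
    intro ℓ ℓ' i
    have h1 := congrArg π (congrFun (hk ℓ ℓ') i)
    have h2 : π (realMap (A ℓ).val (α ℓ') i) = ∑ j, ((A ℓ).val i j : ℚ) * f ℓ' j := by
      simp only [realMap, map_sum, hf]
      refine Finset.sum_congr rfl fun j _ => ?_
      rw [← zsmul_eq_mul, map_zsmul, zsmul_eq_mul]
    have h3 : π (toReal (k ℓ ℓ') i) = k ℓ ℓ' i := by
      have := hπq (k ℓ ℓ' i)
      simpa [toReal] using this
    simp only [Pi.add_apply, Pi.sub_apply, map_add, map_sub, h2, h3] at h1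
    simp only [hf] at h1 ⊢
    linarith
  have hf0 : ∀ i, ∃ n : ℤ, f 0 i = n := fun i => by
    have := hfk 0 0 i
    rw [h.linear_zero, add_zero] at this
    simp [Matrix.one_apply] at this
    exact ⟨k 0 0 i, by linarith⟩
  -- a common denominator of the values on the generators
  set s : ℕ := ∏ j : Fin p, ∏ i : Fin q, (f (Pi.single j 1) i).den with hs
  have hspos : 0 < s := Finset.prod_pos fun j _ => Finset.prod_pos fun i _ => Rat.den_pos _
  -- Integrality of `s f` propagates from generators: by `hfk`, `f` is additive up to an integral
  -- matrix and the integral error `k`.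
  let G : AddSubgroup (Fin p → ℤ) :=
    { carrier := {ℓ | ∀ i, ∃ n : ℤ, (s : ℚ) * f ℓ i = n}
      zero_mem' := fun i => by
        obtain ⟨n, hn⟩ := hf0 i
        exact ⟨s * n, by rw [hn]; push_cast; ring⟩
      add_mem' := by
        intro ℓ ℓ' h1 h2 i
        choose n1 hn1 using h1
        choose n2 hn2 using h2
        refine ⟨n1 i + ∑ j, (A ℓ).val i j * n2 j - s * k ℓ ℓ' i, ?_⟩
        push_cast
        rw [hfk, ← hn1]
        simp only [← hn2, mul_sub, mul_add, Finset.mul_sum]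
        congr 2
        exact Finset.sum_congr rfl fun j _ => by ring
      neg_mem' := by
        intro ℓ h1 i
        choose n1 hn1 using h1
        choose n0 hn0 using hf0
        refine ⟨s * n0 i - (∑ j, (A (-ℓ)).val i j * n1 j) + s * k (-ℓ) ℓ i, ?_⟩
        have e := hfk (-ℓ) ℓ i
        rw [neg_add_cancel, hn0] at e
        have e2 : ∑ j, ((A (-ℓ)).val i j : ℚ) * n1 j = s * ∑ j, ((A (-ℓ)).val i j : ℚ) * f ℓ j := by
          rw [Finset.mul_sum]
          exact Finset.sum_congr rfl fun j _ => by rw [← hn1]; ring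
        push_cast
        rw [e2, e]; ring }
  have hG : ∀ ℓ, ℓ ∈ G := by
    intro ℓ
    have : ℓ = ∑ j, ℓ j • (Pi.single j 1 : Fin p → ℤ) := by
      funext i
      simp [Finset.sum_apply, Pi.single_apply]
    rw [this]
    refine G.sum_mem fun j _ => G.zsmul_mem ?_ _
    intro i
    have hd : (f (Pi.single j 1) i).den ∣ s :=
      (Finset.dvd_prod_of_mem _ (Finset.mem_univ i)).trans
        (Finset.dvd_prod_of_mem (fun j : Fin p => ∏ i : Fin q, (f (Pi.single j 1) i).den)
          (Finset.mem_univ j))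
    obtain ⟨c, hc⟩ := hd
    refine ⟨c * (f (Pi.single j 1) i).num, ?_⟩
    rw [hc]
    push_cast
    rw [mul_comm _ (c : ℚ), mul_assoc, mul_comm _ (f _ i), Rat.mul_den_eq_num]
  choose β hβ using hG
  have hsR : (s : ℝ) ≠ 0 := by exact_mod_cast hspos.ne'
  have hβ' : ∀ ℓ, (1 / (s : ℝ)) • toReal (β ℓ) = fun i => ((f ℓ i : ℚ) : ℝ) := by
    intro ℓ
    funext i
    have : ((s : ℝ)) * (f ℓ i : ℚ) = β ℓ i := by exact_mod_cast hβ ℓ i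
    simp only [toReal, Pi.smul_apply, smul_eq_mul, ← this]
    field_simp
  have hβk : ∀ ℓ ℓ', (s : ℤ) • k ℓ ℓ' = β ℓ - β (ℓ + ℓ') + (A ℓ).val.mulVec (β ℓ') := by
    intro ℓ ℓ'
    funext i
    have e := hfk ℓ ℓ' i
    have e2 : ∑ j, ((A ℓ).val i j : ℚ) * β ℓ' j = s * ∑ j, ((A ℓ).val i j : ℚ) * f ℓ' j := by
      rw [Finset.mul_sum]
      exact Finset.sum_congr rfl fun j _ => by rw [← hβ]; ring
    have : ((s * k ℓ ℓ' i : ℤ) : ℚ) =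
        ((β ℓ i - β (ℓ + ℓ') i + ∑ j, (A ℓ).val i j * β ℓ' j : ℤ) : ℚ) := by
      push_cast
      rw [e2, ← hβ, ← hβ, e]; ring
    have := Int.cast_injective this
    simpa [Matrix.mulVec, dotProduct] using this
  set γ : (Fin p → ℤ) → Fin q → ℝ := fun ℓ => α ℓ - (1 / (s : ℝ)) • toReal (β ℓ) with hγ
  have hγc : ∀ ℓ ℓ', γ (ℓ + ℓ') = realMap (A ℓ).val (γ ℓ') + γ ℓ := by
    intro ℓ ℓ'
    funext i
    have e1 := congrFun (hk ℓ ℓ') i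
    have e2 := hfk ℓ ℓ' i
    have e2' : ((f (ℓ + ℓ') i : ℚ) : ℝ) =
        f ℓ i + (∑ j, ((A ℓ).val i j : ℝ) * (f ℓ' j : ℚ)) - k ℓ ℓ' i := by
      rw [e2]; push_cast; rfl
    simp only [hγ, hβ', realMap_sub]
    simp only [Pi.add_apply, Pi.sub_apply, realMap, toReal] at e1 ⊢
    rw [e2']
    linarith
  have ha : ∀ ℓ ℓ', proj (γ (ℓ + ℓ')) = toral (A ℓ).val (proj (γ ℓ')) + proj (γ ℓ) := by
    intro ℓ ℓ'
    rw [hγc, proj_add, proj_realMap]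
  refine ⟨ofData A (fun ℓ => proj (γ ℓ)) h.linear_add ha, A, α, k, s, β, ?_, ?_, hspos, hβk, ?_⟩
  · intro ℓ x
    rw [h, proj_add, proj_realMap, hα]
  · intro ℓ ℓ'
    rw [hk]
  · intro ℓ x
    rw [hasData_ofData, proj_add, proj_realMap]

end Basic

end TorusAction

/-! ### Agreement on a finite-index subgroup; freeness and minimality -/

namespace TorusAction

section Agree

variable {p q : ℕ} {φ ψ : AffineAction p q} {A : (Fin p → ℤ) → GL (Fin q) ℤ}
  {a b : (Fin p → ℤ) → Torus q} {s : ℕ}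

theorem HasData.linear_nsmul (h : HasData φ A a) (n : ℕ) (ℓ : Fin p → ℤ) :
    A (n • ℓ) = A ℓ ^ n := by
  induction n with
  | zero => rw [zero_smul, h.linear_zero, pow_zero]
  | succ n ih => rw [succ_nsmul, h.linear_add, ih, pow_succ]

/-- `M = 1 + s C` with `C` integral, and `s C` kills `s`-torsion. -/
theorem toral_eq_self_of_torsion {M : Matrix (Fin q) (Fin q) ℤ}
    (hM : M.map (Int.castRingHom (ZMod s)) = 1) {y : Torus q} (hy : s • y = 0) :
    toral M y = y := by
  have hd : ∀ i j, ∃ c : ℤ, M i j = (1 : Matrix (Fin q) (Fin q) ℤ) i j + s * c := by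
    intro i j
    have h1 := congrFun (congrFun hM i) j
    have h2 : ((M i j - (1 : Matrix (Fin q) (Fin q) ℤ) i j : ℤ) : ZMod s) = 0 := by
      simp only [Matrix.map_apply, eq_intCast] at h1
      push_cast
      rw [h1]
      by_cases hij : i = j <;> simp [hij, Matrix.one_apply]
    rw [ZMod.intCast_zmod_eq_zero_iff_dvd] at h2
    obtain ⟨c, hc⟩ := h2
    exact ⟨c, by rw [← hc]; ring⟩
  choose c hc using hd
  conv_rhs => rw [← toral_one y]
  funext i
  simp only [toral]
  refine Finset.sum_congr rfl fun j _ => ?_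
  have hyj : s • y j = 0 := congrFun hy j
  rw [hc, add_smul, mul_comm, mul_smul, natCast_zsmul, hyj, smul_zero, add_zero]

/-- Two actions with the same linear part whose translation parts differ by `s`-torsion agree on
a subgroup of finite index. -/
theorem HasData.exists_agree (hφ : HasData φ A a) (hψ : HasData ψ A b) (hs : 0 < s)
    (hab : ∀ ℓ, s • a ℓ = s • b ℓ) :
    ∃ N : ℕ, 0 < N ∧ ∀ ℓ x, act φ (N • ℓ) x = act ψ (N • ℓ) x := by
  have : NeZero s := ⟨hs.ne'⟩
  -- By Lagrange, `A (c • ℓ)` is trivial modulo `s`.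
  set c := Nat.card (GL (Fin q) (ZMod s)) with hc
  have hcpos : 0 < c := Nat.card_pos
  refine ⟨s * c, Nat.mul_pos hs hcpos, fun ℓ x => ?_⟩
  have hfix : ∀ k : ℕ, ∀ y : Torus q, s • y = 0 → toral (A (k • (c • ℓ))).val y = y := by
    intro k y hy
    refine toral_eq_self_of_torsion (s := s) ?_ hy
    have h1 : Matrix.GeneralLinearGroup.map (Int.castRingHom (ZMod s)) (A (k • (c • ℓ))) = 1 := by
      rw [hφ.linear_nsmul, hφ.linear_nsmul, map_pow, map_pow, hc, pow_card_eq_one', one_pow]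
    exact congrArg Units.val h1
  -- Along multiples of `c • ℓ` the torsion-valued difference is untwisted, hence additive; the
  -- extra factor `s` then kills it.
  have hk : ∀ k : ℕ, a (k • (c • ℓ)) - b (k • (c • ℓ)) = k • (a (c • ℓ) - b (c • ℓ)) := by
    intro k
    induction k with
    | zero => simp [hφ.translation_zero, hψ.translation_zero]
    | succ k ih =>
      rw [succ_nsmul, succ_nsmul, hφ.translation_add, hψ.translation_add, ← ih,
        add_sub_add_comm, ← toral_sub, hfix, add_comm]
      rw [smul_sub, hab, sub_self]
  have h0 : a ((s * c) • ℓ) = b ((s * c) • ℓ) := by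
    rw [← sub_eq_zero, mul_smul, hk, smul_sub, hab, sub_self]
  rw [hφ, hψ, h0]

theorem act_nsmul_fixed {x : Torus q} {ℓ : Fin p → ℤ} (h : act ψ ℓ x = x) (n : ℕ) :
    act ψ (n • ℓ) x = x := by
  induction n with
  | zero => rw [zero_smul, act_zero]
  | succ n ih => rw [succ_nsmul, act_add, h, ih]

/-- A point fixed by `ψ(ℓ)` is fixed by `ψ(N ℓ) = φ(N ℓ)`, and `N ℓ ≠ 0`. -/
theorem IsFree.of_agree {N : ℕ} (hN : 0 < N)
    (h : ∀ ℓ x, act φ (N • ℓ) x = act ψ (N • ℓ) x) (hφ : IsFree φ) : IsFree ψ := by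
  intro ℓ hℓ x hx
  refine hφ (N • ℓ) ?_ x ?_
  · intro h0
    exact hℓ ((smul_eq_zero.1 h0).resolve_left hN.ne')
  · rw [h, act_nsmul_fixed hx]

/-- A minimal action on the (connected) torus is minimal on subgroups of finite index. -/
theorem IsMinimal.dense_nsmul (hφ : IsMinimal φ) {N : ℕ} (hN : 0 < N) (x : Torus q) :
    Dense (Set.range fun ℓ => act φ (N • ℓ) x) := by
  obtain ⟨A, a, hd⟩ := exists_hasData φ
  set K : Torus q → Set (Torus q) := fun x => closure (Set.range fun ℓ => act φ (N • ℓ) x) with hK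
  have hinv : ∀ ℓ x, act φ (-ℓ) (act φ ℓ x) = x := fun ℓ x => by
    rw [← act_add, neg_add_cancel, act_zero]
  have hsub : ∀ x y, y ∈ K x → K y ⊆ K x := by
    intro x y hy
    refine closure_minimal ?_ isClosed_closure
    rintro _ ⟨ℓ, rfl⟩
    refine map_mem_closure (hd.continuous_act (N • ℓ)) hy ?_
    rintro _ ⟨ℓ', rfl⟩
    exact ⟨ℓ + ℓ', by simp only [smul_add, act_add]⟩
  -- the action by each element is a homeomorphism
  let H : (Fin p → ℤ) → Torus q ≃ₜ Torus q := fun ℓ =>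
    { toFun := act φ ℓ
      invFun := act φ (-ℓ)
      left_inv := hinv ℓ
      right_inv := fun y => by simpa using hinv (-ℓ) y
      continuous_toFun := hd.continuous_act ℓ
      continuous_invFun := hd.continuous_act (-ℓ) }
  -- Finitely many homeomorphic images of `K x`, indexed by residues modulo `N`, cover the torus, so
  -- by Baire one of them has interior.
  have hint : ∀ x, (interior (K x)).Nonempty := by
    intro x
    set F : Set (Fin p → ℤ) := Set.Icc 0 (fun _ => (N : ℤ)) with hF
    have hFfin : F.Finite := Set.finite_Icc _ _
    have hun : ⋃ r ∈ F, H r '' K x = Set.univ := by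
      have hcl : IsClosed (⋃ r ∈ F, H r '' K x) :=
        hFfin.isClosed_biUnion fun r _ => (H r).isClosedMap _ isClosed_closure
      refine Set.eq_univ_of_univ_subset ?_
      rw [← (hφ x).closure_eq]
      refine closure_minimal ?_ hcl
      rintro _ ⟨ℓ, rfl⟩
      simp only [Set.mem_iUnion]
      have hN' : (0 : ℤ) < N := by exact_mod_cast hN
      refine ⟨fun i => ℓ i % N, ⟨fun i => Int.emod_nonneg _ hN'.ne',
        fun i => (Int.emod_lt_of_pos _ hN').le⟩, ?_⟩
      refine ⟨act φ (N • fun i => ℓ i / N) x, subset_closure ⟨_, rfl⟩, ?_⟩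
      change act φ _ (act φ _ x) = act φ ℓ x
      rw [← act_add]
      congr 1
      funext i
      simp only [Pi.add_apply, nsmul_eq_mul]
      exact Int.emod_add_mul_ediv _ _
    obtain ⟨r, hr⟩ := nonempty_interior_of_iUnion_of_closed
      (f := fun r : F => H r '' K x)
      (fun r => (H r).isClosedMap _ isClosed_closure)
      (by rw [← hun, Set.biUnion_eq_iUnion])
    rw [← (H r).image_interior] at hr
    exact hr.of_image
  -- The `N`-orbit of `y` enters the interior of its own closure; pulling that open set back by the
  -- group element makes `y` itself interior. So `K x` is clopen.
  have hopen : IsOpen (K x) := by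
    rw [← subset_interior_iff_isOpen]
    intro y hy
    obtain ⟨z, hz⟩ := hint y
    have hzK : z ∈ closure (Set.range fun ℓ => act φ (N • ℓ) y) := interior_subset hz
    obtain ⟨_, hw, ℓ, rfl⟩ := mem_closure_iff.1 hzK _ isOpen_interior hz
    refine interior_mono (hsub x y hy) ?_
    have hsub2 : act φ (N • ℓ) ⁻¹' interior (K y) ⊆ K y := by
      intro w hw
      have h1 : act φ (N • ℓ) w ∈ K y := interior_subset hw
      have h2 := hsub _ _ h1
      refine h2 (subset_closure ⟨-ℓ, ?_⟩)
      simp only [smul_neg]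
      exact hinv _ _
    exact interior_maximal hsub2 (isOpen_interior.preimage (hd.continuous_act _)) hw
  have huniv : K x = Set.univ :=
    IsClopen.eq_univ ⟨isClosed_closure, hopen⟩ ⟨x, subset_closure ⟨0, by simp [act_zero]⟩⟩
  exact dense_iff_closure_eq.2 huniv

theorem IsMinimal.of_agree {N : ℕ} (hN : 0 < N)
    (h : ∀ ℓ x, act φ (N • ℓ) x = act ψ (N • ℓ) x) (hφ : IsMinimal φ) : IsMinimal ψ := by
  intro x
  refine (hφ.dense_nsmul hN x).mono ?_
  rintro _ ⟨ℓ, rfl⟩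
  exact ⟨N • ℓ, (h ℓ x).symm⟩

end Agree

end TorusAction

/-! ### Integral matrices: norm bounds, annihilators, and Cramer bounds -/

namespace TorusAction

section Growth

open Polynomial

variable {q : ℕ}

theorem exists_norm_mulVec_le (B : Matrix (Fin q) (Fin q) ℤ) :
    ∃ β : ℝ, 1 ≤ β ∧ ∀ v, ‖B.mulVec v‖ ≤ β * ‖v‖ := by
  -- The summand `1` makes the powers of the bound increase with the exponent.
  refine ⟨1 + ∑ i, ∑ j, |(B i j : ℝ)|, ?_, fun v => ?_⟩
  · have : 0 ≤ ∑ i, ∑ j, |(B i j : ℝ)| := by positivity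
    linarith
  · refine (pi_norm_le_iff_of_nonneg (by positivity)).2 fun i => ?_
    rw [Int.norm_eq_abs]
    simp only [Matrix.mulVec, dotProduct]
    push_cast
    calc |∑ j, (B i j : ℝ) * v j| ≤ ∑ j, |(B i j : ℝ) * v j| := Finset.abs_sum_le_sum_abs _ _
      _ ≤ ∑ j, |(B i j : ℝ)| * ‖v‖ := by
          refine Finset.sum_le_sum fun j _ => ?_
          rw [abs_mul]
          refine mul_le_mul_of_nonneg_left ?_ (abs_nonneg _)
          rw [← Int.norm_eq_abs]
          exact norm_le_pi_norm v j
      _ = (∑ j, |(B i j : ℝ)|) * ‖v‖ := by rw [Finset.sum_mul]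
      _ ≤ (1 + ∑ i, ∑ j, |(B i j : ℝ)|) * ‖v‖ := by
          refine mul_le_mul_of_nonneg_right ?_ (norm_nonneg _)
          have := Finset.single_le_sum (f := fun i => ∑ j, |(B i j : ℝ)|)
            (fun i _ => by positivity) (Finset.mem_univ i)
          linarith

theorem norm_pow_mulVec_le {B : Matrix (Fin q) (Fin q) ℤ} {β : ℝ} (hβ0 : 0 ≤ β)
    (hβ : ∀ v, ‖B.mulVec v‖ ≤ β * ‖v‖) (n : ℕ) (v : Fin q → ℤ) :
    ‖(B ^ n).mulVec v‖ ≤ β ^ n * ‖v‖ := by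
  induction n with
  | zero => simp
  | succ n ih =>
    rw [pow_succ', ← Matrix.mulVec_mulVec, pow_succ', mul_assoc]
    exact (hβ _).trans (mul_le_mul_of_nonneg_left ih hβ0)

/-- The vector `m` seen over `ℚ`. -/
def ratVec (m : Fin q → ℤ) : Fin q → ℚ := fun i => (m i : ℚ)

/-- The matrix `B` seen over `ℚ`. -/
def ratMat (B : Matrix (Fin q) (Fin q) ℤ) : Matrix (Fin q) (Fin q) ℚ :=
  B.map (Int.castRingHom ℚ)

theorem ratMat_mulVec (B : Matrix (Fin q) (Fin q) ℤ) (m : Fin q → ℤ) :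
    (ratMat B).mulVec (ratVec m) = ratVec (B.mulVec m) := by
  funext i; simp [ratMat, ratVec, Matrix.mulVec, dotProduct]

theorem ratMat_pow_mulVec (B : Matrix (Fin q) (Fin q) ℤ) (m : Fin q → ℤ) (n : ℕ) :
    (ratMat B ^ n).mulVec (ratVec m) = ratVec ((B ^ n).mulVec m) := by
  have : ratMat B ^ n = ratMat (B ^ n) := ((Int.castRingHom ℚ).mapMatrix.map_pow B n).symm
  rw [this, ratMat_mulVec]

theorem ratVec_injective : Function.Injective (ratVec : (Fin q → ℤ) → Fin q → ℚ) := by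
  intro m n h
  funext i
  exact Int.cast_injective (congrFun h i)

/-- The annihilator of the vector `m` in `ℚ[X]`, where `X` acts as `B`, is principal. -/
theorem exists_annihilator (B : Matrix (Fin q) (Fin q) ℤ) (m : Fin q → ℤ) :
    ∃ g : ℚ[X], g ≠ 0 ∧ g ∣ (ratMat B).charpoly ∧
      ∀ f : ℚ[X], (aeval (ratMat B) f).mulVec (ratVec m) = 0 ↔ g ∣ f := by
  let I : Ideal ℚ[X] :=
    { carrier := {f | (aeval (ratMat B) f).mulVec (ratVec m) = 0}
      zero_mem' := by simp
      add_mem' := fun {f g} hf hg => by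
        simp only [Set.mem_ofPred_eq] at hf hg ⊢
        rw [map_add, Matrix.add_mulVec, hf, hg, add_zero]
      smul_mem' := fun c f hf => by
        simp only [Set.mem_ofPred_eq, smul_eq_mul] at hf ⊢
        rw [map_mul, ← Matrix.mulVec_mulVec, hf, Matrix.mulVec_zero] }
  have hI : ∀ f, f ∈ I ↔ Submodule.IsPrincipal.generator I ∣ f := fun f =>
    Submodule.IsPrincipal.mem_iff_generator_dvd I
  have hc : (ratMat B).charpoly ∈ I := by
    change (aeval (ratMat B) (ratMat B).charpoly).mulVec (ratVec m) = 0
    rw [Matrix.aeval_self_charpoly, Matrix.zero_mulVec]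
  refine ⟨Submodule.IsPrincipal.generator I, ?_, (hI _).1 hc, fun f => hI f⟩
  intro h0
  have := (hI _).1 hc
  rw [h0, zero_dvd_iff] at this
  exact (Matrix.charpoly_monic (ratMat B)).ne_zero this

theorem aeval_mulVec_eq_sum {R : Type*} [CommRing R] (M : Matrix (Fin q) (Fin q) R) (r : R[X])
    {d : ℕ} (hd : r.degree < d) (v : Fin q → R) :
    (aeval M r).mulVec v = ∑ i : Fin d, r.coeff i • (M ^ (i : ℕ)).mulVec v := by
  by_cases h0 : r = 0
  · simp [h0]
  · rw [aeval_eq_sum_range' (n := d), Finset.sum_range, Matrix.sum_mulVec]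
    · exact Finset.sum_congr rfl fun i _ => Matrix.smul_mulVec _ _ _
    · rwa [natDegree_lt_iff_degree_lt h0]

/-- Cramer's rule with the Gram determinant: coordinates of an integral vector with respect to
independent integral vectors are polynomially bounded. -/
theorem abs_coord_le {d : ℕ} (hdq : d ≤ q) (M : Matrix (Fin q) (Fin d) ℤ)
    (hM : ∀ c : Fin d → ℚ, (M.map (Int.castRingHom ℚ)).mulVec c = 0 → c = 0)
    {Y : ℝ} (hY : 1 ≤ Y) (hMY : ∀ i j, |(M i j : ℝ)| ≤ Y) {w : Fin q → ℤ} (hw : ‖w‖ ≤ Y)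
    {c : Fin d → ℚ} (hc : (M.map (Int.castRingHom ℚ)).mulVec c = ratVec w) (i : Fin d) :
    |(c i : ℝ)| ≤ q * (q.factorial * (q * Y ^ 2) ^ q) * (q * Y ^ 2) := by
  have hq : 1 ≤ q := le_trans (Nat.one_le_of_lt i.2) hdq
  have hqR : (1 : ℝ) ≤ q := by exact_mod_cast hq
  set G : Matrix (Fin d) (Fin d) ℤ := M.transpose * M with hG
  set MQ := M.map (Int.castRingHom ℚ) with hMQ
  have hGQ : G.map (Int.castRingHom ℚ) = MQ.transpose * MQ := by
    rw [hG, Matrix.map_mul, Matrix.transpose_map]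
  -- A kernel vector `v` of the Gram matrix satisfies `⟨M v, M v⟩ = 0`, so `M v = 0` over `ℚ`.
  have hdet : G.det ≠ 0 := by
    intro h0
    have h1 : (MQ.transpose * MQ).det = 0 := by
      rw [← hGQ]
      have := (Int.castRingHom ℚ).map_det G
      rw [RingHom.mapMatrix_apply] at this
      rw [← this, h0, map_zero]
    obtain ⟨v, hv, hv0⟩ := Matrix.exists_mulVec_eq_zero_iff.2 h1
    apply hv
    apply hM
    have h2 : dotProduct (MQ.mulVec v) (MQ.mulVec v) = 0 := by
      rw [Matrix.dotProduct_mulVec, ← Matrix.mulVec_transpose, Matrix.mulVec_mulVec, hv0,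
        zero_dotProduct]
    exact dotProduct_self_eq_zero.1 h2
  have hkey : G.det * c i = ((G.adjugate.mulVec (M.transpose.mulVec w) i : ℤ) : ℚ) := by
    have h1 : (G.adjugate.map (Int.castRingHom ℚ)).mulVec
        (MQ.transpose.mulVec (ratVec w)) = (G.det : ℚ) • c := by
      rw [← hc, Matrix.mulVec_mulVec, Matrix.mulVec_mulVec, Matrix.mul_assoc, ← hGQ,
        ← Matrix.map_mul,
        Matrix.adjugate_mul]
      have : (G.det • (1 : Matrix (Fin d) (Fin d) ℤ)).map (Int.castRingHom ℚ) =
          (G.det : ℚ) • (1 : Matrix (Fin d) (Fin d) ℚ) := by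
        ext a b
        rw [Matrix.map_apply, Matrix.smul_apply, Matrix.smul_apply, Matrix.one_apply,
          Matrix.one_apply]
        split_ifs <;> simp
      rw [this, Matrix.smul_mulVec, Matrix.one_mulVec]
    have h2 := congrFun h1 i
    rw [Pi.smul_apply, smul_eq_mul] at h2
    rw [← h2]
    simp [Matrix.mulVec, dotProduct, ratVec, hMQ]
  have hY2 : (1 : ℝ) ≤ q * Y ^ 2 := one_le_mul_of_one_le_of_one_le hqR (one_le_pow₀ hY)
  have hY0 : 0 ≤ Y := by linarith
  have hGb : ∀ a b, |(G a b : ℝ)| ≤ q * Y ^ 2 := by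
    intro a b
    simp only [hG, Matrix.mul_apply, Matrix.transpose_apply]
    push_cast
    calc |∑ k, (M k a : ℝ) * M k b| ≤ ∑ k, |(M k a : ℝ) * M k b| := Finset.abs_sum_le_sum_abs _ _
      _ ≤ ∑ _k : Fin q, Y ^ 2 := Finset.sum_le_sum fun k _ => by
          rw [abs_mul, sq]
          exact mul_le_mul (hMY _ _) (hMY _ _) (abs_nonneg _) hY0
      _ = q * Y ^ 2 := by simp
  have hadj : ∀ a b, |(G.adjugate a b : ℝ)| ≤ q.factorial * (q * Y ^ 2) ^ q := by
    intro a b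
    rw [Matrix.adjugate_apply]
    have h1 := Matrix.det_le (A := (G.updateRow b (Pi.single a 1)).map (Int.castRingHom ℝ))
      (abv := AbsoluteValue.abs) (x := q * Y ^ 2) (by
        intro k l
        rw [Matrix.map_apply, Matrix.updateRow_apply]
        split_ifs
        · rw [Pi.single_apply]
          split_ifs
          · simpa using hY2
          · simpa using (zero_le_one.trans hY2)
        · simpa using hGb k l)
    have h2 : ((G.updateRow b (Pi.single a 1)).det : ℝ) =
        ((G.updateRow b (Pi.single a 1)).map (Int.castRingHom ℝ)).det :=
      (Int.castRingHom ℝ).map_det _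
    rw [h2]
    refine le_trans h1 ?_
    rw [nsmul_eq_mul, Fintype.card_fin]
    refine mul_le_mul ?_ (pow_le_pow_right₀ hY2 hdq) (by positivity) (by positivity)
    exact_mod_cast Nat.factorial_le hdq
  have hMw : ∀ b, |(M.transpose.mulVec w b : ℝ)| ≤ q * Y ^ 2 := by
    intro b
    simp only [Matrix.mulVec, dotProduct, Matrix.transpose_apply]
    push_cast
    calc |∑ k, (M k b : ℝ) * w k| ≤ ∑ k, |(M k b : ℝ) * w k| := Finset.abs_sum_le_sum_abs _ _
      _ ≤ ∑ _k : Fin q, Y ^ 2 := Finset.sum_le_sum fun k _ => by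
          rw [abs_mul, sq]
          refine mul_le_mul (hMY _ _) ?_ (abs_nonneg _) hY0
          rw [← Int.norm_eq_abs]
          exact (norm_le_pi_norm w k).trans hw
      _ = q * Y ^ 2 := by simp
  -- Integrality enters here: a nonzero integral determinant has absolute value at least `1` and can
  -- be dropped.
  have h1 : |(c i : ℝ)| ≤ |((G.adjugate.mulVec (M.transpose.mulVec w) i : ℤ) : ℝ)| := by
    have e : ((G.adjugate.mulVec (M.transpose.mulVec w) i : ℤ) : ℝ) = (G.det : ℝ) * (c i : ℝ) := by
      have := congrArg (Rat.cast : ℚ → ℝ) hkey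
      rw [Rat.cast_mul, Rat.cast_intCast, Rat.cast_intCast] at this
      exact this.symm
    rw [e, abs_mul]
    refine le_mul_of_one_le_left (abs_nonneg _) ?_
    exact_mod_cast Int.one_le_abs hdet
  refine h1.trans ?_
  simp only [Matrix.mulVec, dotProduct] at hMw ⊢
  push_cast at hMw ⊢
  calc |∑ b, (G.adjugate i b : ℝ) * ∑ k, (M.transpose b k : ℝ) * w k|
      ≤ ∑ b, |(G.adjugate i b : ℝ) * ∑ k, (M.transpose b k : ℝ) * w k| :=
        Finset.abs_sum_le_sum_abs _ _
    _ ≤ ∑ _b : Fin d, (q.factorial * (q * Y ^ 2) ^ q) * (q * Y ^ 2) :=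
        Finset.sum_le_sum fun b _ => by
          rw [abs_mul]
          exact mul_le_mul (hadj _ _) (hMw _) (abs_nonneg _) (by positivity)
    _ = d * ((q.factorial * (q * Y ^ 2) ^ q) * (q * Y ^ 2)) := by simp
    _ ≤ q * ((q.factorial * (q * Y ^ 2) ^ q) * (q * Y ^ 2)) :=
        mul_le_mul_of_nonneg_right (by exact_mod_cast hdq) (by positivity)
    _ = _ := by ring

end Growth

end TorusAction

/-! ### Remainders modulo the annihilator, and Kronecker's theorem -/

namespace TorusAction

section Growth

open Polynomial

variable {q : ℕ}

/-- A multiple of the annihilator of `m` which is monomial up to a remainder with polynomially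
bounded coefficients. -/
theorem exists_remainder_bound (B : Matrix (Fin q) (Fin q) ℤ) :
    ∃ C : ℝ, 1 ≤ C ∧ ∃ Q : ℕ, ∀ (m : Fin q → ℤ) (K : ℕ) (X : ℝ), 1 ≤ X → ‖m‖ ≤ X →
      ‖(B ^ K).mulVec m‖ ≤ X → ∀ g : ℚ[X], g ≠ 0 → g.natDegree ≤ q →
      (∀ f : ℚ[X], (aeval (ratMat B) f).mulVec (ratVec m) = 0 ↔ g ∣ f) →
      ∃ c : Fin g.natDegree → ℚ, g ∣ Polynomial.X ^ K - ∑ i, Polynomial.C (c i) * Polynomial.X ^ (i : ℕ) ∧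
        ∀ i, |(c i : ℝ)| ≤ C * X ^ Q := by
  obtain ⟨β, hβ1, hβ⟩ := exists_norm_mulVec_le B
  have hβ0 : 0 ≤ β := by linarith
  set D : ℝ := q * (q.factorial * (q * (β ^ q) ^ 2) ^ q) * (q * (β ^ q) ^ 2) with hD
  refine ⟨1 + D, by have : 0 ≤ D := by positivity
                    linarith, 2 * q + 2, ?_⟩
  intro m K X hX hm hK g hg0 hgq hg
  -- The coefficients of this remainder are the coordinates of `B ^ K m` in `m, B m, …, B ^ (d - 1)
  -- m`, where `d = deg g`; these vectors are independent because nothing nonzero of degree below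
  -- `d` annihilates `m`.
  set r := (Polynomial.X : ℚ[X]) ^ K % g with hr
  have hrdeg : r.degree < (g.natDegree : ℕ) := by
    rw [← degree_eq_natDegree hg0]
    exact EuclideanDomain.mod_lt _ hg0
  have hdvd : g ∣ Polynomial.X ^ K - r :=
    ⟨Polynomial.X ^ K / g, by rw [hr, EuclideanDomain.mod_eq_sub_mul_div]; ring⟩
  have hrsum : r = ∑ i : Fin g.natDegree, Polynomial.C (r.coeff i) * Polynomial.X ^ (i : ℕ) := by
    by_cases h0 : r = 0
    · simp [h0]
    · conv_lhs => rw [r.as_sum_range' _ ((natDegree_lt_iff_degree_lt h0).2 hrdeg)]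
      rw [Finset.sum_range]
      exact Finset.sum_congr rfl fun i _ => (C_mul_X_pow_eq_monomial).symm
  refine ⟨fun i => r.coeff i, ?_, ?_⟩
  · rw [← hrsum]; exact hdvd
  set M : Matrix (Fin q) (Fin g.natDegree) ℤ := fun a i => (B ^ (i : ℕ)).mulVec m a with hM
  have hMv : ∀ c : Fin g.natDegree → ℚ, (M.map (Int.castRingHom ℚ)).mulVec c =
      ∑ i, c i • ((ratMat B) ^ (i : ℕ)).mulVec (ratVec m) := by
    intro c
    funext a
    simp only [ratMat_pow_mulVec, Finset.sum_apply, Pi.smul_apply, smul_eq_mul]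
    simp only [Matrix.mulVec, dotProduct, hM, ratVec]
    exact Finset.sum_congr rfl fun i _ => mul_comm _ _
  intro i
  have hβq : 1 ≤ β ^ q := one_le_pow₀ hβ1
  have key := abs_coord_le hgq M ?_ (Y := β ^ q * X)
    (one_le_mul_of_one_le_of_one_le hβq hX) ?_ (w := (B ^ K).mulVec m) ?_
    (c := fun i => r.coeff i) ?_ i
  · refine key.trans ?_
    have e : (q : ℝ) * (q.factorial * (q * (β ^ q * X) ^ 2) ^ q) * (q * (β ^ q * X) ^ 2) =
        D * X ^ (2 * q + 2) := by
      rw [hD]; ring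
    rw [e]
    exact mul_le_mul_of_nonneg_right (by linarith) (by positivity)
  · intro c hc
    rw [hMv] at hc
    set f : ℚ[X] := ∑ i : Fin g.natDegree, Polynomial.C (c i) * Polynomial.X ^ (i : ℕ) with hf
    have hfdeg : f.degree < g.natDegree := by
      refine (degree_sum_le _ _).trans_lt ?_
      rw [Finset.sup_lt_iff (by exact WithBot.bot_lt_coe _)]
      intro i _
      exact (degree_C_mul_X_pow_le _ _).trans_lt (by exact_mod_cast i.2)
    have hfc : ∀ i : Fin g.natDegree, f.coeff i = c i := by
      intro i
      simp [hf, coeff_X_pow, Fin.val_inj]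
    have h1 : (aeval (ratMat B) f).mulVec (ratVec m) = 0 := by
      rw [aeval_mulVec_eq_sum _ _ hfdeg, ← hc]
      exact Finset.sum_congr rfl fun i _ => by rw [hfc]
    have h2 : f = 0 := by
      by_contra h0
      have := degree_le_of_dvd ((hg f).1 h1) h0
      rw [degree_eq_natDegree hg0] at this
      exact absurd hfdeg (not_lt.2 this)
    funext i
    rw [← hfc, h2]; simp
  · intro a i
    rw [← Int.norm_eq_abs]
    refine (norm_le_pi_norm ((B ^ (i : ℕ)).mulVec m) a).trans
      ((norm_pow_mulVec_le hβ0 hβ i m).trans ?_)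
    exact mul_le_mul (pow_le_pow_right₀ hβ1 (i.2.le.trans hgq)) hm (norm_nonneg _) (by positivity)
  · exact hK.trans (le_mul_of_one_le_left (by linarith) hβq)
  · rw [hMv, ← ratMat_pow_mulVec, ← aeval_mulVec_eq_sum _ _ hrdeg, ← sub_eq_zero]
    have h3 := (hg _).2 hdvd
    rw [map_sub, Matrix.sub_mulVec, map_pow, aeval_X] at h3
    rw [← neg_eq_zero, neg_sub]
    exact h3

/-- Kronecker's theorem for the roots of a factor of an integral characteristic polynomial. -/
theorem exists_pow_eq_one {B : Matrix (Fin q) (Fin q) ℤ} (hB : IsUnit B.det) {g : ℚ[X]}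
    (hg : g ∣ (ratMat B).charpoly) (hroots : ∀ z : ℂ, aeval z g = 0 → ‖z‖ ≤ 1) {z : ℂ}
    (hz : aeval z g = 0) : ∃ n : ℕ, 0 < n ∧ z ^ n = 1 := by
  have hchar : (ratMat B).charpoly = B.charpoly.map (Int.castRingHom ℚ) :=
    Matrix.charpoly_map _ _
  have hzc : aeval z B.charpoly = 0 := by
    obtain ⟨h, hh⟩ := hg
    have : aeval z (ratMat B).charpoly = 0 := by rw [hh, map_mul, hz, zero_mul]
    rw [hchar] at this
    rwa [← algebraMap_int_eq, aeval_map_algebraMap] at this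
  have hzint : IsIntegral ℤ z := ⟨B.charpoly, Matrix.charpoly_monic B, hzc⟩
  -- The constant coefficient of the characteristic polynomial is `± det B`, a unit.
  have hz0 : z ≠ 0 := by
    rintro rfl
    have h1 : ((B.charpoly.coeff 0 : ℤ) : ℂ) = 0 := by
      simpa [aeval_def, eval₂_at_zero] using hzc
    have h2 : B.charpoly.coeff 0 = 0 := by exact_mod_cast h1
    rw [Matrix.det_eq_sign_charpoly_coeff, h2, mul_zero] at hB
    exact not_isUnit_zero hB
  let K := IntermediateField.adjoin ℚ {z}
  let : NumberField K := {
    to_charZero := K.charZero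
    to_finiteDimensional := IntermediateField.adjoin.finiteDimensional hzint.tower_top }
  let y : K := ⟨z, IntermediateField.mem_adjoin_simple_self ℚ z⟩
  suffices ∃ (n : ℕ) (_ : 0 < n), y ^ n = 1 by
    obtain ⟨n, hn₀, hn₁⟩ := this
    exact ⟨n, hn₀, congrArg (algebraMap K ℂ) hn₁⟩
  refine NumberField.Embeddings.pow_eq_one_of_norm_le_one (x := y) K ℂ
    (Subtype.coe_ne_coe.mp hz0) (IntermediateField.coe_isIntegral_iff.mp hzint) fun φ => ?_
  apply hroots
  -- `g` is rational, so every conjugate of `z` is again a root of `g` and `hroots` bounds it.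
  have hy : aeval y g = 0 := by
    apply (algebraMap K ℂ).injective
    rw [map_zero, ← aeval_algebraMap_apply]
    exact hz
  have := congrArg φ.toRatAlgHom hy
  rw [map_zero, ← aeval_algHom_apply] at this
  exact this

end Growth

end TorusAction

/-! ### Polynomial bounds along orbits of one integral matrix -/

namespace TorusAction

section Growth

open Polynomial

variable {q : ℕ}

/-- Used with `S` the roots of the characteristic polynomial: annihilators vary with `m`, but all
divide it, so `ρ` depends on `B` alone. `exists_common_order` serves the same purpose for the roots
of unity. -/
theorem exists_root_gap (S : Finset ℂ) :
    ∃ ρ : ℝ, 1 < ρ ∧ ∀ z ∈ S, 1 < ‖z‖ → ρ ≤ ‖z‖ := by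
  classical
  induction S using Finset.induction_on with
  | empty => exact ⟨2, by norm_num, by simp⟩
  | insert a S _ ih =>
    obtain ⟨ρ, h1, h2⟩ := ih
    by_cases ha : 1 < ‖a‖
    · refine ⟨min ρ ‖a‖, lt_min h1 ha, fun z hz hz1 => ?_⟩
      rcases Finset.mem_insert.1 hz with rfl | hz
      · exact min_le_right _ _
      · exact (min_le_left _ _).trans (h2 z hz hz1)
    · refine ⟨ρ, h1, fun z hz hz1 => ?_⟩
      rcases Finset.mem_insert.1 hz with rfl | hz
      · exact absurd hz1 ha
      · exact h2 z hz hz1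

theorem exists_common_order (S : Finset ℂ) :
    ∃ N : ℕ, 0 < N ∧ ∀ z ∈ S, (∃ n : ℕ, 0 < n ∧ z ^ n = 1) → z ^ N = 1 := by
  classical
  induction S using Finset.induction_on with
  | empty => exact ⟨1, one_pos, by simp⟩
  | insert a S _ ih =>
    obtain ⟨N, h1, h2⟩ := ih
    by_cases ha : ∃ n : ℕ, 0 < n ∧ a ^ n = 1
    · obtain ⟨n, hn, han⟩ := ha
      refine ⟨N * n, Nat.mul_pos h1 hn, fun z hz hz1 => ?_⟩
      rcases Finset.mem_insert.1 hz with rfl | hz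
      · rw [mul_comm, pow_mul, han, one_pow]
      · rw [pow_mul, h2 z hz hz1, one_pow]
    · refine ⟨N, h1, fun z hz hz1 => ?_⟩
      rcases Finset.mem_insert.1 hz with rfl | hz
      · exact absurd hz1 ha
      · exact h2 z hz hz1

/-- If `(B ^ N - 1) ^ q` kills `m`, the orbit of `m` grows polynomially. -/
theorem exists_polynomial_growth (B : Matrix (Fin q) (Fin q) ℤ) {N : ℕ} (hN : 0 < N) :
    ∃ C : ℝ, 1 ≤ C ∧ ∀ m : Fin q → ℤ, ((B ^ N - 1) ^ q).mulVec m = 0 →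
      ∀ j : ℕ, ‖(B ^ j).mulVec m‖ ≤ C * (1 + j) ^ q * ‖m‖ := by
  obtain ⟨β, hβ1, hβ⟩ := exists_norm_mulVec_le B
  obtain ⟨η, hη1, hη⟩ := exists_norm_mulVec_le (B ^ N - 1)
  have hβ0 : 0 ≤ β := by linarith
  have hη0 : 0 ≤ η := by linarith
  refine ⟨1 + β ^ N * (q * η ^ q), ?_, fun m hm j => ?_⟩
  · have : 0 ≤ β ^ N * (q * η ^ q) := by positivity
    linarith
  have hj : j = j % N + N * (j / N) := (Nat.mod_add_div j N).symm
  set k := j / N with hk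
  have hkj : k ≤ j := Nat.div_le_self _ _
  -- Applied to `m`, only the terms with `i < q` survive, and their binomial coefficients are
  -- polynomial in `k`.
  have hexp : (B ^ N) ^ k = ∑ i ∈ Finset.range (k + 1), (k.choose i : ℤ) • (B ^ N - 1) ^ i := by
    have := (Commute.one_right (B ^ N - 1)).add_pow k
    rw [sub_add_cancel] at this
    rw [this]
    refine Finset.sum_congr rfl fun i _ => ?_
    rw [one_pow, mul_one, ← nsmul_eq_mul', natCast_zsmul]
  have hzero : ∀ i, q ≤ i → ((B ^ N - 1) ^ i).mulVec m = 0 := by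
    intro i hi
    obtain ⟨e, rfl⟩ := Nat.exists_eq_add_of_le hi
    rw [add_comm, pow_add, ← Matrix.mulVec_mulVec, hm, Matrix.mulVec_zero]
  have hterm : ∀ i, ‖((k.choose i : ℤ) • (B ^ N - 1) ^ i).mulVec m‖ ≤
      if i < q then (1 + (j : ℝ)) ^ q * (η ^ q * ‖m‖) else 0 := by
    intro i
    rw [Matrix.smul_mulVec]
    split_ifs with hi
    · refine (norm_smul_le _ _).trans ?_
      refine mul_le_mul ?_ ?_ (norm_nonneg _) (by positivity)
      · rw [Int.norm_natCast]
        have h1 : k.choose i ≤ k ^ i := Nat.choose_le_pow _ _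
        have h2 : (k.choose i : ℝ) ≤ (k : ℝ) ^ i := by exact_mod_cast h1
        refine h2.trans ((pow_le_pow_left₀ (by positivity) ?_ i).trans
          (pow_le_pow_right₀ ?_ hi.le))
        · have : (k : ℝ) ≤ j := by exact_mod_cast hkj
          linarith
        · have : (0 : ℝ) ≤ j := by positivity
          linarith
      · refine (norm_pow_mulVec_le hη0 hη i m).trans ?_
        exact mul_le_mul_of_nonneg_right (pow_le_pow_right₀ hη1 hi.le) (norm_nonneg _)
    · rw [hzero i (not_lt.1 hi), smul_zero, norm_zero]
  have hsum : ‖((B ^ N) ^ k).mulVec m‖ ≤ q * ((1 + (j : ℝ)) ^ q * (η ^ q * ‖m‖)) := by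
    rw [hexp, Matrix.sum_mulVec]
    refine (norm_sum_le _ _).trans ((Finset.sum_le_sum fun i _ => hterm i).trans ?_)
    rw [← Finset.sum_filter, Finset.sum_const, nsmul_eq_mul]
    refine mul_le_mul_of_nonneg_right ?_ (by positivity)
    have : (Finset.filter (fun i => i < q) (Finset.range (k + 1))).card ≤ q := by
      refine (Finset.card_le_card (t := Finset.range q) fun i hi => ?_).trans (by simp)
      simpa using (Finset.mem_filter.1 hi).2
    exact_mod_cast this
  calc ‖(B ^ j).mulVec m‖ = ‖(B ^ (j % N)).mulVec (((B ^ N) ^ k).mulVec m)‖ := by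
        rw [Matrix.mulVec_mulVec, ← pow_mul, ← pow_add, ← hj]
    _ ≤ β ^ (j % N) * ‖((B ^ N) ^ k).mulVec m‖ := norm_pow_mulVec_le hβ0 hβ _ _
    _ ≤ β ^ N * (q * ((1 + (j : ℝ)) ^ q * (η ^ q * ‖m‖))) :=
        mul_le_mul (pow_le_pow_right₀ hβ1 (Nat.mod_lt _ hN).le) hsum (norm_nonneg _)
          (by positivity)
    _ = (β ^ N * (q * η ^ q)) * ((1 + (j : ℝ)) ^ q * ‖m‖) := by ring
    _ ≤ (1 + β ^ N * (q * η ^ q)) * ((1 + (j : ℝ)) ^ q * ‖m‖) :=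
        mul_le_mul_of_nonneg_right (by linarith) (by positivity)
    _ = _ := by ring

/-- Along an infinite orbit of an integral automorphism, intermediate points are polynomially
bounded in terms of the end points. -/
theorem exists_intermediate_bound {B : Matrix (Fin q) (Fin q) ℤ} (hB : IsUnit B.det) :
    ∃ C : ℝ, 1 ≤ C ∧ ∃ Q : ℕ, ∀ m : Fin q → ℤ, (∀ n : ℕ, 0 < n → (B ^ n).mulVec m ≠ m) →
      ∀ (j K : ℕ) (X : ℝ), j ≤ K → 1 ≤ X → ‖m‖ ≤ X → ‖(B ^ K).mulVec m‖ ≤ X →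
      ‖(B ^ j).mulVec m‖ ≤ C * X ^ Q := by
  obtain ⟨β, hβ1, hβ⟩ := exists_norm_mulVec_le B
  have hβ0 : 0 ≤ β := by linarith
  obtain ⟨C1, hC1, Q1, hrem⟩ := exists_remainder_bound B
  set S : Finset ℂ := ((ratMat B).charpoly.aroots ℂ).toFinset with hS
  have hmemS : ∀ g : ℚ[X], g ∣ (ratMat B).charpoly → ∀ z : ℂ, aeval z g = 0 → z ∈ S := by
    rintro g ⟨h, hh⟩ z hz
    rw [hS, Multiset.mem_toFinset, mem_aroots]
    exact ⟨(Matrix.charpoly_monic _).ne_zero, by rw [hh, map_mul, hz, zero_mul]⟩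
  obtain ⟨ρ, hρ1, hρ⟩ := exists_root_gap S
  obtain ⟨N, hN, hNS⟩ := exists_common_order S
  obtain ⟨C2, hC2, hpoly⟩ := exists_polynomial_growth B hN
  set Λ : ℝ := 1 + ∑ z ∈ S, ‖z‖ with hΛ
  have hΛ1 : 1 ≤ Λ := by
    have : 0 ≤ ∑ z ∈ S, ‖z‖ := by positivity
    linarith
  have hΛS : ∀ z ∈ S, ‖z‖ ≤ Λ := fun z hz => by
    have := Finset.single_le_sum (f := fun z : ℂ => ‖z‖) (fun z _ => norm_nonneg z) hz
    linarith
  -- Allows the trivial growth bound `β ^ j` to be replaced by `(ρ ^ K) ^ t`.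
  obtain ⟨t, ht⟩ := pow_unbounded_of_one_lt β hρ1
  set E1 : ℝ := (q * (C1 * Λ ^ q)) ^ t with hE1
  set E2 : ℝ := C2 * (1 + q * (q * C1)) ^ q with hE2
  have hE1' : 0 ≤ E1 := by positivity
  have hE2' : 0 ≤ E2 := by positivity
  refine ⟨1 + E1 + E2, by linarith, Q1 * t + 1 + Q1 * q, ?_⟩
  intro m hm j K X hjK hX hmX hKX
  obtain ⟨g, hg0, hgc, hg⟩ := exists_annihilator B m
  have hgq : g.natDegree ≤ q := by
    have := natDegree_le_of_dvd hgc (Matrix.charpoly_monic _).ne_zero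
    rwa [Matrix.charpoly_natDegree_eq_dim, Fintype.card_fin] at this
  have hqgR : (g.natDegree : ℝ) ≤ q := by exact_mod_cast hgq
  obtain ⟨c, hc, hcb⟩ := hrem m K X hX hmX hKX g hg0 hgq hg
  set r : ℚ[X] := ∑ i, Polynomial.C (c i) * Polynomial.X ^ (i : ℕ) with hr
  have hX0 : (0 : ℝ) ≤ X := by linarith
  have hcb' : ∀ i, ‖(algebraMap ℚ ℂ) (c i)‖ ≤ C1 * X ^ Q1 := by
    intro i
    have : (algebraMap ℚ ℂ) (c i) = (((c i : ℚ) : ℝ) : ℂ) := by simp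
    rw [this, Complex.norm_real]
    exact hcb i
  -- A root outside the unit disc gives `z ^ K = r(z)`, whose right side is polynomial in `X`. So
  -- `K` is at most logarithmic in `X`, and exponential growth in `j ≤ K` is harmless.
  by_cases hbig : ∃ z : ℂ, aeval z g = 0 ∧ 1 < ‖z‖
  · obtain ⟨z, hz, hz1⟩ := hbig
    have hzS := hmemS g hgc z hz
    have h1 : z ^ K = ∑ i, algebraMap ℚ ℂ (c i) * z ^ (i : ℕ) := by
      have : aeval z ((Polynomial.X : ℚ[X]) ^ K - r) = 0 := by
        obtain ⟨h, hh⟩ := hc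
        rw [hh, map_mul, hz, zero_mul]
      rw [map_sub, map_pow, aeval_X, sub_eq_zero, hr, map_sum] at this
      rw [this]
      simp
    have h2 : ρ ^ K ≤ q * (C1 * Λ ^ q) * X ^ Q1 := by
      calc ρ ^ K ≤ ‖z‖ ^ K := pow_le_pow_left₀ (by linarith) (hρ z hzS hz1) _
        _ = ‖∑ i, algebraMap ℚ ℂ (c i) * z ^ (i : ℕ)‖ := by rw [← norm_pow, h1]
        _ ≤ ∑ i, ‖algebraMap ℚ ℂ (c i) * z ^ (i : ℕ)‖ := norm_sum_le _ _
        _ ≤ ∑ _i : Fin g.natDegree, (C1 * X ^ Q1) * Λ ^ q := Finset.sum_le_sum fun i _ => by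
            rw [norm_mul, norm_pow]
            refine mul_le_mul (hcb' i) ?_ (by positivity) (by positivity)
            exact (pow_le_pow_left₀ (norm_nonneg _) (hΛS z hzS) _).trans
              (pow_le_pow_right₀ hΛ1 (i.2.le.trans hgq))
        _ = g.natDegree * ((C1 * X ^ Q1) * Λ ^ q) := by simp
        _ ≤ q * ((C1 * X ^ Q1) * Λ ^ q) := mul_le_mul_of_nonneg_right hqgR (by positivity)
        _ = _ := by ring
    calc ‖(B ^ j).mulVec m‖ ≤ β ^ j * ‖m‖ := norm_pow_mulVec_le hβ0 hβ _ _
      _ ≤ (ρ ^ t) ^ K * X := by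
          refine mul_le_mul ?_ hmX (norm_nonneg _) (by positivity)
          exact (pow_le_pow_right₀ hβ1 hjK).trans (pow_le_pow_left₀ hβ0 ht.le _)
      _ = (ρ ^ K) ^ t * X := by rw [← pow_mul, ← pow_mul, mul_comm t K]
      _ ≤ (q * (C1 * Λ ^ q) * X ^ Q1) ^ t * X :=
          mul_le_mul_of_nonneg_right (pow_le_pow_left₀ (by positivity) h2 _) hX0
      _ = E1 * X ^ (Q1 * t + 1) := by rw [mul_pow, ← pow_mul, hE1]; ring
      _ ≤ (1 + E1 + E2) * X ^ (Q1 * t + 1 + Q1 * q) :=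
          mul_le_mul (by linarith) (pow_le_pow_right₀ hX (by omega)) (by positivity)
            (by positivity)
  · push Not at hbig
    -- Now all roots are roots of unity, by Kronecker. The orbit grows polynomially in `j`, and what
    -- is missing is a polynomial bound of `K` by `X`.
    have hunit : ∀ z : ℂ, aeval z g = 0 → z ^ N = 1 := fun z hz =>
      hNS z (hmemS g hgc z hz) (exists_pow_eq_one hB hgc hbig hz)
    set gC : ℂ[X] := g.map (algebraMap ℚ ℂ) with hgC
    have hgC0 : gC ≠ 0 := (Polynomial.map_ne_zero_iff (algebraMap ℚ ℂ).injective).2 hg0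
    have hroot : ∀ z, z ∈ gC.roots → aeval z g = 0 := by
      intro z hz
      rw [mem_roots hgC0, IsRoot.def, hgC, eval_map_algebraMap] at hz
      exact hz
    have hXN0 : (Polynomial.X : ℂ[X]) ^ N - 1 ≠ 0 := (monic_X_pow_sub_C 1 hN.ne').ne_zero
    have hfac : ∀ z, aeval z g = 0 → z ∈ ((Polynomial.X : ℂ[X]) ^ N - 1).roots := by
      intro z hz
      rw [mem_roots hXN0, IsRoot.def]
      simp [hunit z hz]
    have hdescend : ∀ f : ℚ[X], gC ∣ f.map (algebraMap ℚ ℂ) → g ∣ f := fun f hf =>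
      (Polynomial.map_dvd_map' (algebraMap ℚ ℂ)).1 hf
    -- a multiple root bounds the return time
    have hdouble : ∃ z : ℂ, (Polynomial.X - Polynomial.C z) ^ 2 ∣ gC := by
      by_contra hno
      push Not at hno
      have hnodup : gC.roots.Nodup := by
        rw [Multiset.nodup_iff_count_le_one]
        intro z
        rw [count_roots]
        by_contra hlt
        exact hno z ((pow_dvd_pow _ (by omega)).trans (pow_rootMultiplicity_dvd gC z))
      -- Without multiple roots `g` divides `X ^ N - 1`, which makes `m` periodic.
      have h1 : gC ∣ (Polynomial.X : ℂ[X]) ^ N - 1 := by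
        rw [IsAlgClosed.dvd_iff_roots_le_roots hgC0 hXN0, Multiset.le_iff_subset hnodup]
        exact fun z hz => hfac z (hroot z hz)
      have h2 : g ∣ (Polynomial.X : ℚ[X]) ^ N - 1 := hdescend _ (by simpa using h1)
      have h3 := (hg _).2 h2
      rw [map_sub, map_pow, aeval_X, map_one, Matrix.sub_mulVec, Matrix.one_mulVec,
        ratMat_pow_mulVec, sub_eq_zero] at h3
      exact hm N hN (ratVec_injective h3)
    -- At a double root `z` the derivative of `X ^ K - r` vanishes too: `K z ^ (K - 1) = r'(z)` with
    -- `‖z‖ = 1`.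
    have hK : (K : ℝ) ≤ q * (q * C1) * X ^ Q1 := by
      obtain ⟨z, hz⟩ := hdouble
      have hzg : aeval z g = 0 := by
        have : Polynomial.X - Polynomial.C z ∣ gC := (dvd_pow_self _ two_ne_zero).trans hz
        rw [dvd_iff_isRoot, IsRoot.def, hgC, eval_map_algebraMap] at this
        exact this
      have hz1 : ‖z‖ = 1 := by
        have := congrArg norm (hunit z hzg)
        rw [norm_pow, norm_one] at this
        exact (pow_eq_one_iff_of_nonneg (norm_nonneg _) hN.ne').1 this
      have h1 : (Polynomial.X - Polynomial.C z) ^ 2 ∣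
          ((Polynomial.X : ℚ[X]) ^ K - r).map (algebraMap ℚ ℂ) :=
        hz.trans (Polynomial.map_dvd _ hc)
      obtain ⟨h, hh⟩ := h1
      have h2 : eval z (derivative (((Polynomial.X : ℚ[X]) ^ K - r).map (algebraMap ℚ ℂ))) = 0 := by
        rw [hh, derivative_mul, derivative_pow]
        simp
      simp only [hr, Polynomial.map_sub, Polynomial.map_sum, Polynomial.map_pow, map_X,
        Polynomial.map_mul, map_C, derivative_sub, derivative_sum, derivative_X_pow,
        derivative_C_mul, eval_sub, eval_finsetSum, eval_mul, eval_C, eval_pow, eval_X,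
        sub_eq_zero] at h2
      have h3 := congrArg norm h2
      rw [norm_mul, norm_pow, hz1, one_pow, mul_one, Complex.norm_natCast] at h3
      rw [h3]
      calc ‖∑ i : Fin g.natDegree, algebraMap ℚ ℂ (c i) * (((i : ℕ) : ℂ) * z ^ ((i : ℕ) - 1))‖
          ≤ ∑ i : Fin g.natDegree,
            ‖algebraMap ℚ ℂ (c i) * (((i : ℕ) : ℂ) * z ^ ((i : ℕ) - 1))‖ := norm_sum_le _ _
        _ ≤ ∑ _i : Fin g.natDegree, (C1 * X ^ Q1) * q := Finset.sum_le_sum fun i _ => by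
            rw [norm_mul, norm_mul, norm_pow, hz1, one_pow, mul_one, Complex.norm_natCast]
            refine mul_le_mul (hcb' i) ?_ (by positivity) (by positivity)
            exact_mod_cast i.2.le.trans hgq
        _ = g.natDegree * ((C1 * X ^ Q1) * q) := by simp
        _ ≤ q * ((C1 * X ^ Q1) * q) := mul_le_mul_of_nonneg_right hqgR (by positivity)
        _ = _ := by ring
    -- Each root of `g` is an `N`-th root of unity of multiplicity at most `q`, so `g` divides `(X ^
    -- N - 1) ^ q`.
    have hunip : ((B ^ N - 1) ^ q).mulVec m = 0 := by
      have h1 : gC ∣ ((Polynomial.X : ℂ[X]) ^ N - 1) ^ q := by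
        classical
        rw [IsAlgClosed.dvd_iff_roots_le_roots hgC0 (pow_ne_zero _ hXN0), roots_pow,
          Multiset.le_iff_count]
        intro z
        rw [Multiset.count_nsmul]
        by_cases hz : z ∈ gC.roots
        · have h1 : 1 ≤ Multiset.count z ((Polynomial.X : ℂ[X]) ^ N - 1).roots :=
            Multiset.one_le_count_iff_mem.2 (hfac z (hroot z hz))
          have h2 : Multiset.count z gC.roots ≤ q := by
            refine (Multiset.count_le_card _ _).trans ((card_roots' gC).trans ?_)
            rw [hgC, natDegree_map]
            exact hgq
          exact h2.trans (Nat.le_mul_of_pos_right _ h1)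
        · rw [Multiset.count_eq_zero_of_notMem hz]
          exact Nat.zero_le _
      have h2 : g ∣ ((Polynomial.X : ℚ[X]) ^ N - 1) ^ q := hdescend _ (by simpa using h1)
      have h3 := (hg _).2 h2
      have h4 : aeval (ratMat B) (((Polynomial.X : ℚ[X]) ^ N - 1) ^ q) =
          ratMat ((B ^ N - 1) ^ q) := by
        change _ = (Int.castRingHom ℚ).mapMatrix ((B ^ N - 1) ^ q)
        simp only [map_pow, map_sub, aeval_X, map_one]
        rfl
      rw [h4, ratMat_mulVec] at h3
      refine ratVec_injective (h3.trans ?_)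
      funext i; simp [ratVec]
    have hXQ : 1 ≤ X ^ Q1 := one_le_pow₀ hX
    calc ‖(B ^ j).mulVec m‖ ≤ C2 * (1 + j) ^ q * ‖m‖ := hpoly m hunip j
      _ ≤ C2 * ((1 + q * (q * C1)) * X ^ Q1) ^ q * X := by
          refine mul_le_mul ?_ hmX (norm_nonneg _) (by positivity)
          refine mul_le_mul_of_nonneg_left (pow_le_pow_left₀ (by positivity) ?_ _) (by linarith)
          have : (j : ℝ) ≤ K := by exact_mod_cast hjK
          nlinarith
      _ = E2 * X ^ (Q1 * q + 1) := by rw [mul_pow, ← pow_mul, hE2]; ring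
      _ ≤ (1 + E1 + E2) * X ^ (Q1 * t + 1 + Q1 * q) :=
          mul_le_mul (by linarith) (pow_le_pow_right₀ hX (by omega)) (by positivity)
            (by positivity)

end Growth

end TorusAction

/-! ### Lattice actions, phases, and rapidly decreasing cocycles -/

namespace TorusAction

section Abstract

variable {p q : ℕ}

/-- Rapidly decreasing functions on the lattice `ℤ^q`. -/
def RapidDecay (a : (Fin q → ℤ) → ℂ) : Prop :=
  ∀ M : ℕ, ∃ C : ℝ, ∀ n, (1 + ‖n‖) ^ M * ‖a n‖ ≤ C

/-- A linear action of `ℤ^p` on the lattice `ℤ^q`. -/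
structure LatticeAction (p q : ℕ) where
  mat : (Fin p → ℤ) → Matrix (Fin q) (Fin q) ℤ
  mat_zero : mat 0 = 1
  mat_add : ∀ ℓ ℓ', mat (ℓ + ℓ') = mat ℓ * mat ℓ'

namespace LatticeAction

/-- The action on lattice points. -/
def act (L : LatticeAction p q) (ℓ : Fin p → ℤ) (m : Fin q → ℤ) : Fin q → ℤ := (L.mat ℓ).mulVec m

variable (L : LatticeAction p q)

theorem act_zero (m : Fin q → ℤ) : L.act 0 m = m := by
  rw [act, L.mat_zero, Matrix.one_mulVec]

theorem act_add (ℓ ℓ' : Fin p → ℤ) (m : Fin q → ℤ) :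
    L.act (ℓ + ℓ') m = L.act ℓ (L.act ℓ' m) := by
  rw [act, L.mat_add, act, act, Matrix.mulVec_mulVec]

theorem act_comm (ℓ ℓ' : Fin p → ℤ) (m : Fin q → ℤ) :
    L.act ℓ (L.act ℓ' m) = L.act ℓ' (L.act ℓ m) := by
  rw [← act_add, add_comm, act_add]

theorem act_neg_act (ℓ : Fin p → ℤ) (m : Fin q → ℤ) : L.act (-ℓ) (L.act ℓ m) = m := by
  rw [← act_add, neg_add_cancel, act_zero]

theorem act_injective (ℓ : Fin p → ℤ) : Function.Injective (L.act ℓ) :=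
  Function.LeftInverse.injective (L.act_neg_act ℓ)

theorem act_map_zero (ℓ : Fin p → ℤ) : L.act ℓ 0 = 0 := Matrix.mulVec_zero _

theorem act_ne_zero {ℓ : Fin p → ℤ} {m : Fin q → ℤ} (hm : m ≠ 0) : L.act ℓ m ≠ 0 := fun h =>
  hm (L.act_injective ℓ (h.trans (L.act_map_zero ℓ).symm))

theorem act_nsmul (ℓ : Fin p → ℤ) (k : ℕ) (m : Fin q → ℤ) : L.act ℓ (k • m) = k • L.act ℓ m :=
  Matrix.mulVec_smul _ _ _

theorem act_lattice_add (ℓ : Fin p → ℤ) (m n : Fin q → ℤ) :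
    L.act ℓ (m + n) = L.act ℓ m + L.act ℓ n := Matrix.mulVec_add _ _ _

theorem isUnit_det (ℓ : Fin p → ℤ) : IsUnit (L.mat ℓ).det := by
  have h : L.mat ℓ * L.mat (-ℓ) = 1 := by rw [← L.mat_add, add_neg_cancel, L.mat_zero]
  exact (Matrix.isUnit_iff_isUnit_det _).1 (IsUnit.of_mul_eq_one _ h)

theorem mat_nsmul (k : ℕ) (ℓ : Fin p → ℤ) : L.mat (k • ℓ) = L.mat ℓ ^ k := by
  induction k with
  | zero => rw [zero_smul, L.mat_zero, pow_zero]
  | succ k ih => rw [succ_nsmul, L.mat_add, ih, pow_succ]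

/-- The stabilizer of a lattice point. -/
def stab (m : Fin q → ℤ) : AddSubgroup (Fin p → ℤ) where
  carrier := {ℓ | L.act ℓ m = m}
  zero_mem' := L.act_zero m
  add_mem' := fun {a b} ha hb => by
    change L.act (a + b) m = m
    rw [act_add, hb, ha]
  neg_mem' := fun {a} ha => by
    change L.act (-a) m = m
    conv_lhs => rw [← show L.act a m = m from ha]
    exact L.act_neg_act a m

theorem mem_stab {m : Fin q → ℤ} {ℓ : Fin p → ℤ} : ℓ ∈ L.stab m ↔ L.act ℓ m = m := Iff.rfl

/-- The acting group is abelian. -/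
theorem stab_act (ℓ : Fin p → ℤ) (m : Fin q → ℤ) : L.stab (L.act ℓ m) = L.stab m := by
  ext g
  rw [mem_stab, mem_stab, act_comm]
  exact (L.act_injective ℓ).eq_iff

theorem stab_le_stab_nsmul (k : ℕ) (m : Fin q → ℤ) : L.stab m ≤ L.stab (k • m) := fun g hg => by
  rw [mem_stab] at hg ⊢
  rw [act_nsmul, hg]

/-- Lattice points with finite orbit. -/
def FiniteOrbit (m : Fin q → ℤ) : Prop := ∃ N : ℕ, 0 < N ∧ ∀ ℓ, N • ℓ ∈ L.stab m

theorem eq_sum_single (ℓ : Fin p → ℤ) : ℓ = ∑ j, ℓ j • (Pi.single j 1 : Fin p → ℤ) := by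
  funext i
  simp [Finset.sum_apply, Pi.single_apply]

/-- The points fixed by `k! • ℤ^p` form a chain of subgroups of `ℤ^q`, increasing because `k!`
divides `k'!` for `k ≤ k'`. The chain stabilizes by Noetherianity. -/
theorem exists_uniform_period :
    ∃ N : ℕ, 0 < N ∧ ∀ m, L.FiniteOrbit m → ∀ ℓ, N • ℓ ∈ L.stab m := by
  let W : ℕ →o Submodule ℤ (Fin q → ℤ) :=
    { toFun := fun k =>
        AddSubgroup.toIntSubmodule
          { carrier := {m | ∀ ℓ, L.act (k.factorial • ℓ) m = m}
            zero_mem' := fun ℓ => L.act_map_zero _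
            add_mem' := fun {a b} ha hb ℓ => by rw [act_lattice_add, ha, hb]
            neg_mem' := fun {a} ha ℓ => by
              have := Matrix.mulVec_neg a (L.mat (k.factorial • ℓ))
              exact this.trans (congrArg _ (ha ℓ)) }
      monotone' := by
        intro k k' hk m hm ℓ
        obtain ⟨c, hc⟩ := Nat.factorial_dvd_factorial hk
        rw [hc, mul_smul]
        exact hm (c • ℓ) }
  obtain ⟨n, hn⟩ := monotone_stabilizes_iff_noetherian.2 (inferInstance : IsNoetherian ℤ _) W
  refine ⟨n.factorial, Nat.factorial_pos _, fun m hm ℓ => ?_⟩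
  obtain ⟨N, hN, h⟩ := hm
  have h1 : m ∈ W (max n N) := by
    intro ℓ
    obtain ⟨c, hc⟩ := Nat.dvd_factorial hN (le_max_right n N)
    rw [hc, mul_smul]
    exact h (c • ℓ)
  rw [← hn _ (le_max_left n N)] at h1
  exact h1 ℓ

/-- If every coordinate direction had a period at `m`, the product of these periods would be a
period of the whole group. -/
theorem exists_infinite_direction {m : Fin q → ℤ} (h : ¬ L.FiniteOrbit m) :
    ∃ i : Fin p, ∀ n : ℕ, 0 < n → L.act (n • Pi.single i 1) m ≠ m := by
  by_contra hcon
  push Not at hcon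
  choose k hk hkm using hcon
  refine h ⟨∏ i, k i, Finset.prod_pos fun i _ => hk i, fun ℓ => ?_⟩
  rw [eq_sum_single ℓ, Finset.smul_sum]
  refine AddSubgroup.sum_mem _ fun i _ => ?_
  rw [smul_comm]
  refine AddSubgroup.zsmul_mem _ ?_ _
  obtain ⟨c, hc⟩ := Finset.dvd_prod_of_mem k (Finset.mem_univ i)
  rw [hc, mul_comm, mul_smul]
  exact AddSubgroup.nsmul_mem _ (hkm i) _

theorem injective_of_infinite_direction {m : Fin q → ℤ} {g : Fin p → ℤ}
    (h : ∀ n : ℕ, 0 < n → L.act (n • g) m ≠ m) :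
    Function.Injective fun k : ℤ => L.act (k • g) m := by
  have key : ∀ a b : ℤ, a < b → L.act (a • g) m ≠ L.act (b • g) m := by
    intro a b hab he
    obtain ⟨n, hn⟩ := Int.eq_ofNat_of_zero_le (sub_nonneg.2 hab.le)
    refine h n (by omega) ?_
    have : b • g = a • g + n • g := by
      rw [← natCast_zsmul, ← add_smul]
      congr 1
      omega
    rw [this, act_add] at he
    exact (L.act_injective _ he).symm
  intro a b hab
  rcases lt_trichotomy a b with h1 | h1 | h1
  · exact absurd hab (key a b h1)
  · exact h1
  · exact absurd hab.symm (key b a h1)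

end LatticeAction

/-- Unitary phases over a lattice action; together they form a monomial representation of `ℤ^p`
on functions on `ℤ^q`. -/
structure Phase (L : LatticeAction p q) where
  val : (Fin p → ℤ) → (Fin q → ℤ) → ℂ
  norm_val : ∀ ℓ m, ‖val ℓ m‖ = 1
  val_add : ∀ ℓ ℓ' m, val (ℓ + ℓ') m = val ℓ m * val ℓ' (L.act ℓ m)
  val_nsmul : ∀ ℓ (k : ℕ) m, val ℓ (k • m) = val ℓ m ^ k

namespace Phase

variable {L : LatticeAction p q} (ρ : Phase L)

/-- Rapidly decreasing cocycles of the monomial representation. -/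
def IsCocycle (d : (Fin p → ℤ) → (Fin q → ℤ) → ℂ) : Prop :=
  (∀ ℓ, RapidDecay (d ℓ)) ∧
    ∀ ℓ ℓ' m, d (ℓ + ℓ') m = ρ.val ℓ' m * d ℓ (L.act ℓ' m) + d ℓ' m

/-- Every rapidly decreasing cocycle is a coboundary away from the zero mode. -/
def Rigid : Prop :=
  ∀ d, ρ.IsCocycle d → ∃ u, RapidDecay u ∧ ∀ ℓ m, m ≠ 0 →
    d ℓ m = ρ.val ℓ m * u (L.act ℓ m) - u m

theorem val_ne_zero (ℓ : Fin p → ℤ) (m : Fin q → ℤ) : ρ.val ℓ m ≠ 0 := by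
  rw [← norm_ne_zero_iff, ρ.norm_val]; exact one_ne_zero

theorem val_zero (m : Fin q → ℤ) : ρ.val 0 m = 1 := by
  have := ρ.val_add 0 0 m
  rw [add_zero, L.act_zero] at this
  exact (mul_eq_left₀ (ρ.val_ne_zero 0 m)).1 this.symm

theorem val_add_of_stab {g : Fin p → ℤ} {m : Fin q → ℤ} (hg : g ∈ L.stab m) (ℓ : Fin p → ℤ) :
    ρ.val (g + ℓ) m = ρ.val g m * ρ.val ℓ m := by
  rw [ρ.val_add, L.mem_stab.1 hg]

/-- Expand the phase of `g + ℓ = ℓ + g` in both orders. On the stabilizer the phase is thus a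
character depending only on the orbit. -/
theorem val_act_of_stab {g : Fin p → ℤ} {m : Fin q → ℤ} (hg : g ∈ L.stab m) (ℓ : Fin p → ℤ) :
    ρ.val g (L.act ℓ m) = ρ.val g m := by
  have h1 := ρ.val_add_of_stab hg ℓ
  rw [add_comm, ρ.val_add, mul_comm (ρ.val g m)] at h1
  exact mul_left_cancel₀ (ρ.val_ne_zero ℓ m) h1

theorem val_nsmul_of_stab {g : Fin p → ℤ} {m : Fin q → ℤ} (hg : g ∈ L.stab m) (n : ℕ) :
    ρ.val (n • g) m = ρ.val g m ^ n := by
  induction n with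
  | zero => rw [zero_smul, ρ.val_zero, pow_zero]
  | succ n ih => rw [succ_nsmul', ρ.val_add_of_stab hg, ih, pow_succ']

variable {ρ}

/-- Commutativity again: the values in one direction control those in all others. -/
theorem IsCocycle.swap {d : (Fin p → ℤ) → (Fin q → ℤ) → ℂ} (hd : ρ.IsCocycle d)
    (ℓ ℓ' : Fin p → ℤ) (m : Fin q → ℤ) :
    ρ.val ℓ' m * d ℓ (L.act ℓ' m) - d ℓ m = ρ.val ℓ m * d ℓ' (L.act ℓ m) - d ℓ' m := by
  have h1 := hd.2 ℓ ℓ' m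
  have h2 := hd.2 ℓ' ℓ m
  rw [add_comm, h2] at h1
  linear_combination -h1

/-- A rigid representation has no invariant vectors away from the zero mode. -/
theorem Rigid.eq_zero_of_invariant (hρ : ρ.Rigid) (i : Fin p) {v : (Fin q → ℤ) → ℂ}
    (hv : RapidDecay v) (hinv : ∀ ℓ m, ρ.val ℓ m * v (L.act ℓ m) = v m) {m : Fin q → ℤ}
    (hm : m ≠ 0) : v m = 0 := by
  -- For invariant `v` this is a cocycle growing linearly in `ℓ i`, while a coboundary stays
  -- bounded.
  obtain ⟨u, hu, hd⟩ := hρ (fun ℓ m => (ℓ i : ℂ) * v m) ⟨fun ℓ M => by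
      obtain ⟨C, hC⟩ := hv M
      refine ⟨‖(ℓ i : ℂ)‖ * C, fun n => ?_⟩
      rw [norm_mul, mul_left_comm]
      exact mul_le_mul_of_nonneg_left (hC n) (norm_nonneg _), fun ℓ ℓ' m => by
      simp only [Pi.add_apply, Int.cast_add]
      linear_combination -(ℓ i : ℂ) * hinv ℓ' m⟩
  obtain ⟨C, hC⟩ := hu 0
  simp only [pow_zero, one_mul] at hC
  have hbound : ∀ k : ℕ, k * ‖v m‖ ≤ 2 * C := by
    intro k
    have h1 := hd (k • Pi.single i 1) m hm
    have h0 : (((k • Pi.single i 1 : Fin p → ℤ) i : ℤ) : ℂ) = k := by simp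
    rw [h0] at h1
    have h2 := congrArg norm h1
    rw [norm_mul, Complex.norm_natCast] at h2
    rw [h2]
    refine (norm_sub_le _ _).trans ?_
    rw [norm_mul, ρ.norm_val, one_mul]
    linarith [hC (L.act (k • Pi.single i 1) m), hC m]
  by_contra hne
  have hpos : 0 < ‖v m‖ := norm_pos_iff.2 hne
  obtain ⟨k, hk⟩ := exists_nat_gt (2 * C / ‖v m‖)
  rw [div_lt_iff₀ hpos] at hk
  exact absurd (hbound k) (not_le.2 hk)

/-- A formal vector whose coboundary is rapidly decreasing differs from a rapidly decreasing one
by an invariant vector. -/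
theorem Rigid.exists_correction (hρ : ρ.Rigid) {v : (Fin q → ℤ) → ℂ}
    (hv : ∀ ℓ, RapidDecay fun m => ρ.val ℓ m * v (L.act ℓ m) - v m) :
    ∃ u, RapidDecay u ∧ ∀ ℓ m, m ≠ 0 →
      u m - v m = ρ.val ℓ m * (u (L.act ℓ m) - v (L.act ℓ m)) := by
  obtain ⟨u, hu, hd⟩ := hρ (fun ℓ m => ρ.val ℓ m * v (L.act ℓ m) - v m) ⟨hv, fun ℓ ℓ' m => by
    have h1 := ρ.val_add ℓ' ℓ m
    rw [add_comm ℓ' ℓ] at h1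
    simp only [h1, L.act_add]; ring⟩
  refine ⟨u, hu, fun ℓ m hm => ?_⟩
  have := hd ℓ m hm
  linear_combination this

end Phase

theorem RapidDecay.of_finite_support {v : (Fin q → ℤ) → ℂ} (h : (Function.support v).Finite) :
    RapidDecay v := by
  intro M
  refine ⟨∑ n ∈ h.toFinset, (1 + ‖n‖) ^ M * ‖v n‖, fun n => ?_⟩
  by_cases hn : v n = 0
  · rw [hn, norm_zero, mul_zero]
    exact Finset.sum_nonneg fun _ _ => by positivity
  · exact Finset.single_le_sum (f := fun n => (1 + ‖n‖) ^ M * ‖v n‖)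
      (fun _ _ => by positivity) (h.mem_toFinset.2 hn)

theorem finite_norm_le (C : ℝ) : {n : Fin q → ℤ | ‖n‖ ≤ C}.Finite := by
  refine (Set.finite_Icc (fun _ => -⌈C⌉ : Fin q → ℤ) (fun _ => ⌈C⌉)).subset fun n hn => ?_
  have h : ∀ i, |n i| ≤ ⌈C⌉ := fun i => by
    have h1 : ((|n i| : ℤ) : ℝ) ≤ C := by
      have := (norm_le_pi_norm n i).trans hn
      rwa [Int.norm_eq_abs, ← Int.cast_abs] at this
    have h2 := h1.trans (Int.le_ceil C)
    exact_mod_cast h2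
  exact ⟨fun i => (abs_le.1 (h i)).1, fun i => (abs_le.1 (h i)).2⟩

theorem RapidDecay.tendsto_cofinite {v : (Fin q → ℤ) → ℂ} (hv : RapidDecay v) :
    Filter.Tendsto v Filter.cofinite (nhds 0) := by
  rw [tendsto_zero_iff_norm_tendsto_zero, Metric.tendsto_nhds]
  intro ε hε
  obtain ⟨C, hC⟩ := hv 1
  rw [Filter.eventually_cofinite]
  refine (finite_norm_le (C / ε)).subset fun n hn => ?_
  have h1 : ε ≤ ‖v n‖ := by
    have h2 : ¬ dist ‖v n‖ 0 < ε := hn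
    rw [Real.dist_eq, sub_zero, abs_norm] at h2
    exact not_lt.1 h2
  have h2 := hC n
  rw [pow_one] at h2
  change ‖n‖ ≤ C / ε
  rw [le_div_iff₀ hε]
  nlinarith [norm_nonneg n, norm_nonneg (v n)]

theorem summable_lattice : ∃ M : ℕ, Summable fun n : Fin q → ℤ => ((1 + ‖n‖) ^ M)⁻¹ := by
  let b := Pi.basisFun ℝ (Fin q)
  let W := Submodule.span ℤ (Set.range b)
  have hmem : ∀ n : Fin q → ℤ, toReal n ∈ W := fun n =>
    (b.mem_span_iff_repr_mem ℤ _).2 fun i => ⟨n i, by simp [b, toReal]⟩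
  set M := Module.finrank ℤ W + 1 with hM
  have h1 := ZLattice.summable_norm_pow_inv W M (by omega)
  have hinj : Function.Injective fun n : Fin q → ℤ => (⟨toReal n, hmem n⟩ : W) := by
    intro m n h
    funext i
    exact Int.cast_injective (congrFun (congrArg Subtype.val h) i)
  have h2 := h1.comp_injective hinj
  have hnorm : ∀ n : Fin q → ℤ, ‖(⟨toReal n, hmem n⟩ : W)‖ = ‖n‖ := fun n => by
    change ‖toReal n‖ = ‖n‖
    simp only [Pi.norm_def]
    congr 1
  -- The indicator of `0` is added because the comparison series has the value `0` at the origin,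
  -- where `1` is needed.
  refine ⟨M, Summable.of_nonneg_of_le (fun _ => by positivity) (fun n => ?_)
    (h2.add (summable_of_hasFiniteSupport (f := fun n : Fin q → ℤ => if n = 0 then (1 : ℝ) else 0)
      ((Set.finite_singleton 0).subset fun n hn => ?_)))⟩
  · simp only [Function.comp_apply, hnorm]
    by_cases hn : n = 0
    · simp [hn, hM]
    · rw [if_neg hn, add_zero, ← inv_pow]
      refine pow_le_pow_left₀ (by positivity) ?_ _
      exact inv_anti₀ (norm_pos_iff.2 hn) (by linarith)
  · by_contra h0
    exact hn (if_neg h0)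

theorem RapidDecay.summable {v : (Fin q → ℤ) → ℂ} (hv : RapidDecay v) :
    Summable fun n => ‖v n‖ := by
  obtain ⟨M, hM⟩ := summable_lattice (q := q)
  obtain ⟨C, hC⟩ := hv M
  refine Summable.of_nonneg_of_le (fun _ => norm_nonneg _) (fun n => ?_) (hM.mul_left C)
  rw [← div_eq_mul_inv, le_div_iff₀ (by positivity), mul_comm]
  exact hC n

end Abstract

end TorusAction

/-! ### Vanishing of invariant sums on infinite orbits -/

namespace TorusAction

section Obstruction

variable {p q : ℕ} {L : LatticeAction p q} {σ τ : Phase L} {s : ℕ}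

theorem nsmul_lattice_injective {k : ℕ} (hk : 0 < k) :
    Function.Injective fun m : Fin q → ℤ => k • m := by
  intro m n h
  funext i
  have := congrFun h i
  simp only [Pi.smul_apply, nsmul_eq_mul] at this
  exact mul_left_cancel₀ (by exact_mod_cast hk.ne') this

/-- If an orbit is covered by finitely many cosets of an infinite cyclic direction, it carries no
nonzero invariant function. -/
theorem Phase.Rigid.eq_zero_of_finite_cosets (hσ : σ.Rigid) (hs : 0 < s)
    (hst : ∀ ℓ m, σ.val ℓ m ^ s = τ.val ℓ m ^ s) {g : Fin p → ℤ} {m : Fin q → ℤ} (hm : m ≠ 0)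
    (hg : Function.Injective fun k : ℤ => L.act (k • g) m) {F : Set (Fin p → ℤ)} (hF : F.Finite)
    (hcov : ∀ ℓ, ∃ k : ℤ, ∃ r ∈ F, L.act ℓ m = L.act (k • g + r) m)
    {D : (Fin q → ℤ) → ℂ} (hD : ∀ ℓ ℓ', D (L.act ℓ' m) = τ.val ℓ (L.act ℓ' m) *
      D (L.act ℓ (L.act ℓ' m))) : D m = 0 := by
  classical
  by_contra hDm
  -- The positive half of the orbit: finitely many rays in direction `g`.
  set P : Set (Fin q → ℤ) := {x | ∃ k : ℕ, ∃ r ∈ F, x = L.act ((k : ℤ) • g + r) m} with hP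
  have hPorb : ∀ x ∈ P, ∃ ℓ, x = L.act ℓ m := by
    rintro x ⟨k, r, -, rfl⟩; exact ⟨_, rfl⟩
  -- almost invariance of the half orbit
  have hexit : ∀ ℓ, {x | x ∈ P ∧ L.act ℓ x ∉ P}.Finite := by
    intro ℓ
    choose κ r' hr' hκ using fun r : Fin p → ℤ => hcov (r + ℓ)
    refine Set.Finite.subset (hF.biUnion fun r _ =>
      (Set.finite_lt_nat (κ r).natAbs).image fun k : ℕ => L.act ((k : ℤ) • g + r) m) ?_
    rintro x ⟨⟨k, r, hr, rfl⟩, hx⟩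
    simp only [Set.mem_iUnion]
    refine ⟨r, hr, k, ?_, rfl⟩
    by_contra hk
    have hk' : (κ r).natAbs ≤ k := not_lt.1 hk
    apply hx
    obtain ⟨n, hn⟩ := Int.eq_ofNat_of_zero_le (show 0 ≤ (k : ℤ) + κ r by omega)
    refine ⟨n, r' r, hr' r, ?_⟩
    rw [← L.act_add, ← hn, add_comm, add_assoc, L.act_add, hκ, ← L.act_add, ← add_assoc,
      ← add_smul]
  have hPdesc : ∀ ℓ, {x | (∃ ℓ', x = L.act ℓ' m) ∧ (x ∈ P ↔ ¬ L.act ℓ x ∈ P)}.Finite := by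
    intro ℓ
    refine ((hexit ℓ).union ((hexit (-ℓ)).image (L.act (-ℓ)))).subset ?_
    rintro x ⟨-, hx⟩
    by_cases hxP : x ∈ P
    · exact Or.inl ⟨hxP, hx.1 hxP⟩
    · refine Or.inr ⟨L.act ℓ x, ⟨?_, ?_⟩, L.act_neg_act ℓ x⟩
      · by_contra h; exact hxP (hx.2 h)
      · rwa [L.act_neg_act]
  -- `D ^ s`, transplanted to `s • P`, is `σ`-invariant wherever `P` is not crossed, since `σ ℓ (s •
  -- x) = τ ℓ x ^ s`.
  set v : (Fin q → ℤ) → ℂ := fun y => if h : ∃ x ∈ P, s • x = y then (D h.choose) ^ s else 0 with hv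
  have hv1 : ∀ x ∈ P, v (s • x) = D x ^ s := by
    intro x hx
    have h : ∃ x' ∈ P, s • x' = s • x := ⟨x, hx, rfl⟩
    rw [hv]
    simp only [dif_pos h]
    rw [nsmul_lattice_injective hs h.choose_spec.2]
  have hv0 : ∀ y, (¬ ∃ x ∈ P, s • x = y) → v y = 0 := fun y hy => by
    rw [hv]; simp only [dif_neg hy]
  have hv0' : ∀ x, x ∉ P → v (s • x) = 0 := fun x hx => hv0 _ fun ⟨x', hx', he⟩ =>
    hx (nsmul_lattice_injective hs he ▸ hx')
  have hrd : ∀ ℓ, RapidDecay fun y => σ.val ℓ y * v (L.act ℓ y) - v y := by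
    intro ℓ
    refine RapidDecay.of_finite_support (((hPdesc ℓ).image fun x => s • x).subset fun y hy => ?_)
    by_cases hys : ∃ ℓ', y = s • L.act ℓ' m
    · obtain ⟨ℓ', rfl⟩ := hys
      refine ⟨L.act ℓ' m, ⟨⟨ℓ', rfl⟩, ?_⟩, rfl⟩
      set x := L.act ℓ' m with hx
      have hDx : D x ^ s = σ.val ℓ (s • x) * D (L.act ℓ x) ^ s := by
        rw [hx, hD ℓ ℓ', mul_pow, σ.val_nsmul, hst]
      simp only [Function.mem_support, L.act_nsmul] at hy
      by_cases h1 : x ∈ P <;> by_cases h2 : L.act ℓ x ∈ P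
      · rw [hv1 _ h1, hv1 _ h2, hDx, sub_self] at hy
        exact absurd rfl hy
      · exact ⟨fun _ => h2, fun _ => h1⟩
      · exact ⟨fun h => absurd h h1, fun h => absurd h2 h⟩
      · rw [hv0' _ h1, hv0' _ h2, mul_zero, sub_self] at hy
        exact absurd rfl hy
    · exfalso
      apply hy
      have h1 : v y = 0 := hv0 _ fun ⟨x, hx, he⟩ => hys (by
        obtain ⟨ℓ', rfl⟩ := hPorb x hx
        exact ⟨ℓ', he.symm⟩)
      have h2 : v (L.act ℓ y) = 0 := hv0 _ fun ⟨x, hx, he⟩ => hys (by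
        obtain ⟨ℓ', rfl⟩ := hPorb x hx
        refine ⟨-ℓ + ℓ', ?_⟩
        rw [L.act_add, ← L.act_nsmul, he, L.act_neg_act])
      simp only [h1, h2, mul_zero, sub_self]
  obtain ⟨u, hu, hw⟩ := hσ.exists_correction hrd
  set y : ℤ → Fin q → ℤ := fun k => s • L.act (k • g) m with hy
  have hyinj : Function.Injective y := (nsmul_lattice_injective hs).comp hg
  have hutend : Filter.Tendsto (fun k => u (y k)) Filter.cofinite (nhds 0) :=
    hu.tendsto_cofinite.comp hyinj.tendsto_cofinite
  have hsm : s • m ≠ 0 := by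
    intro h
    exact hm (nsmul_lattice_injective hs (h.trans (smul_zero s).symm))
  -- The invariant vector `u - v` has constant modulus `W` on the line, and `u` tends to zero at
  -- both ends; so `‖v‖` has limit `W` at both ends.
  have hwconst : ∀ k, ‖u (y k) - v (y k)‖ = ‖u (s • m) - v (s • m)‖ := by
    intro k
    rw [hw (k • g) (s • m) hsm, norm_mul, σ.norm_val, one_mul, L.act_nsmul]
  set W := ‖u (s • m) - v (s • m)‖ with hW
  have hDn : ∀ ℓ, ‖D (L.act ℓ m)‖ = ‖D m‖ := by
    intro ℓ
    have := hD ℓ 0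
    rw [L.act_zero] at this
    rw [this, norm_mul, τ.norm_val, one_mul]
  -- on the far positive side `v` has constant modulus
  have hpos : W = ‖D m‖ ^ s := by
    obtain ⟨k0, r, hr, hk0⟩ := hcov 0
    rw [L.act_zero] at hk0
    have hin : ∀ n : ℕ, L.act (((n : ℤ) + k0.natAbs) • g) m ∈ P := by
      intro n
      obtain ⟨n', hn'⟩ := Int.eq_ofNat_of_zero_le (show 0 ≤ (n : ℤ) + k0.natAbs + k0 by omega)
      refine ⟨n', r, hr, ?_⟩
      conv_lhs => rw [hk0]
      rw [← L.act_add, ← hn', ← add_assoc, ← add_smul]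
    have hinj : Function.Injective fun n : ℕ => (n : ℤ) + k0.natAbs := fun a b h => by
      simpa using h
    have h1 : Filter.Tendsto (fun n : ℕ => u (y ((n : ℤ) + k0.natAbs))) Filter.atTop (nhds 0) := by
      rw [← Nat.cofinite_eq_atTop]
      exact hutend.comp hinj.tendsto_cofinite
    have h2 : ∀ n : ℕ, |W - ‖D m‖ ^ s| ≤ ‖u (y ((n : ℤ) + k0.natAbs))‖ := by
      intro n
      rw [← hwconst ((n : ℤ) + k0.natAbs), ← hDn (((n : ℤ) + k0.natAbs) • g), ← norm_pow,
        ← hv1 _ (hin n)]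
      have := abs_norm_sub_norm_le (u (y ((n : ℤ) + k0.natAbs)) - v (y ((n : ℤ) + k0.natAbs)))
        (-v (y ((n : ℤ) + k0.natAbs)))
      rw [norm_neg, sub_neg_eq_add, sub_add_cancel] at this
      exact this
    have h3 := ge_of_tendsto' h1.norm h2
    rw [norm_zero] at h3
    exact sub_eq_zero.1 (abs_eq_zero.1 (le_antisymm h3 (abs_nonneg _)))
  -- on the far negative side `v` vanishes
  have hneg : W = 0 := by
    have hfin : {κ : ℤ | ∃ r ∈ F, L.act (κ • g) m = L.act r m}.Finite := by
      refine Set.Finite.subset ((hF.image fun r => L.act r m).preimage hg.injOn) ?_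
      rintro κ ⟨r, hr, h⟩
      exact ⟨r, hr, h.symm⟩
    obtain ⟨b, hb⟩ := hfin.bddBelow
    have hout : ∀ n : ℕ, L.act ((b - 1 - (n : ℤ)) • g) m ∉ P := by
      rintro n ⟨k, r, hr, h⟩
      have h1 : L.act ((b - 1 - (n : ℤ) - k) • g) m = L.act r m := by
        apply L.act_injective ((k : ℤ) • g)
        rw [← L.act_add, ← L.act_add, ← h, ← add_smul]
        congr 2
        ring
      have := hb ⟨r, hr, h1⟩
      omega
    have hinj : Function.Injective fun n : ℕ => b - 1 - (n : ℤ) := fun a b h => by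
      simpa using h
    have h1 : Filter.Tendsto (fun n : ℕ => u (y (b - 1 - (n : ℤ)))) Filter.atTop (nhds 0) := by
      rw [← Nat.cofinite_eq_atTop]
      exact hutend.comp hinj.tendsto_cofinite
    have h2 : ∀ n : ℕ, W ≤ ‖u (y (b - 1 - (n : ℤ)))‖ := by
      intro n
      have := hwconst (b - 1 - (n : ℤ))
      rw [hv0' _ (hout n), sub_zero] at this
      exact this.ge
    have h3 := ge_of_tendsto' h1.norm h2
    rw [norm_zero] at h3
    exact le_antisymm h3 (norm_nonneg _)
  rw [hneg] at hpos
  exact hDm (norm_eq_zero.1 (pow_eq_zero_iff hs.ne' |>.1 hpos.symm))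

/-- Sums over infinite cyclic orbits of summable functions vanish as soon as they are invariant. -/
theorem Phase.Rigid.eq_zero_of_orbit_sum (hσ : σ.Rigid) (hs : 0 < s)
    (hst : ∀ ℓ m, σ.val ℓ m ^ s = τ.val ℓ m ^ s) {g : Fin p → ℤ} {m : Fin q → ℤ} (hm : m ≠ 0)
    (hg : Function.Injective fun k : ℤ => L.act (k • g) m) {c : (Fin q → ℤ) → ℂ}
    (hc : Summable fun x => ‖c x‖) {D : (Fin q → ℤ) → ℂ}
    (hDc : ∀ ℓ, D (L.act ℓ m) = ∑' k : ℤ, τ.val (k • g) (L.act ℓ m) *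
      c (L.act (k • g) (L.act ℓ m)))
    (hD : ∀ ℓ ℓ', D (L.act ℓ' m) = τ.val ℓ (L.act ℓ' m) * D (L.act ℓ (L.act ℓ' m))) :
    D m = 0 := by
  classical
  by_contra hDm
  have hDn : ∀ ℓ, ‖D (L.act ℓ m)‖ = ‖D m‖ := by
    intro ℓ
    have := hD ℓ 0
    rw [L.act_zero] at this
    rw [this, norm_mul, τ.norm_val, one_mul]
  -- A line in direction `g` missing `E` would have a sum of modulus at most `‖D m‖ / 2`. So all
  -- lines of the orbit meet `E`, and finitely many cosets suffice.
  obtain ⟨E, hE⟩ := (summable_iff_vanishing_norm.1 hc) (‖D m‖ / 2)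
    (half_pos (norm_pos_iff.2 hDm))
  choose! r hr using fun (x : Fin q → ℤ) (h : ∃ ℓ, L.act ℓ m = x) => h
  refine hDm (hσ.eq_zero_of_finite_cosets hs hst hm hg (F := r '' (E : Set _))
    (E.finite_toSet.image r) (fun ℓ => ?_) hD)
  by_contra hno
  push Not at hno
  have hinj : Function.Injective fun k : ℤ => L.act (k • g) (L.act ℓ m) := by
    intro a b hab
    apply hg
    apply L.act_injective ℓ
    simp only at hab ⊢
    rw [L.act_comm ℓ, hab, L.act_comm ℓ]
  have hmiss : ∀ k : ℤ, L.act (k • g) (L.act ℓ m) ∉ E := by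
    intro k hk
    refine hno (-k) _ ⟨_, hk, rfl⟩ ?_
    rw [L.act_add, hr _ ⟨k • g + ℓ, L.act_add _ _ _⟩, ← L.act_add, ← add_smul, neg_add_cancel,
      zero_smul, L.act_zero]
  have hsumm : Summable fun k : ℤ => ‖c (L.act (k • g) (L.act ℓ m))‖ := hc.comp_injective hinj
  have hsmall : ∑' k : ℤ, ‖c (L.act (k • g) (L.act ℓ m))‖ ≤ ‖D m‖ / 2 := by
    refine hsumm.tsum_le_of_sum_le fun t => ?_
    have h1 := hE (t.image fun k : ℤ => L.act (k • g) (L.act ℓ m)) (by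
      rw [Finset.disjoint_left]
      intro x hx
      obtain ⟨k, -, rfl⟩ := Finset.mem_image.1 hx
      exact hmiss k)
    rw [Finset.sum_image hinj.injOn] at h1
    exact (le_abs_self _).trans h1.le
  have hbig : ‖D m‖ ≤ ∑' k : ℤ, ‖c (L.act (k • g) (L.act ℓ m))‖ := by
    rw [← hDn ℓ, hDc ℓ]
    have hsn : Summable fun k : ℤ =>
        ‖τ.val (k • g) (L.act ℓ m) * c (L.act (k • g) (L.act ℓ m))‖ := by
      simpa only [norm_mul, τ.norm_val, one_mul] using hsumm
    refine (norm_tsum_le_tsum_norm hsn).trans (le_of_eq ?_)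
    simp only [norm_mul, τ.norm_val, one_mul]
  have hpos := norm_pos_iff.2 hDm
  linarith

end Obstruction

end TorusAction

/-! ### Small divisors on finite orbits -/

namespace TorusAction

section Diophantine

variable {p q : ℕ} {L : LatticeAction p q} {σ τ : Phase L} {s N : ℕ}

theorem norm_pow_sub_one_le {w : ℂ} (hw : ‖w‖ = 1) (n : ℕ) : ‖w ^ n - 1‖ ≤ n * ‖w - 1‖ := by
  induction n with
  | zero => simp
  | succ n ih =>
    have : w ^ (n + 1) - 1 = w ^ n * (w - 1) + (w ^ n - 1) := by ring
    rw [this]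
    refine (norm_add_le _ _).trans ?_
    rw [norm_mul, norm_pow, hw, one_pow, one_mul]
    push_cast
    linarith

/-- The distance to resonance of a lattice point with finite orbit, all orbits having periods
dividing `N`. -/
noncomputable def Phase.defect (τ : Phase L) (N : ℕ) (m : Fin q → ℤ) : ℝ :=
  ∑ i : Fin p, ‖τ.val (N • Pi.single i 1) m - 1‖

theorem Phase.defect_nonneg (m : Fin q → ℤ) : 0 ≤ τ.defect N m :=
  Finset.sum_nonneg fun _ _ => norm_nonneg _

theorem Phase.defect_act {m : Fin q → ℤ} (hm : ∀ ℓ, N • ℓ ∈ L.stab m) (ℓ : Fin p → ℤ) :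
    τ.defect N (L.act ℓ m) = τ.defect N m :=
  Finset.sum_congr rfl fun i _ => by rw [τ.val_act_of_stab (hm _)]

/-- The phase is a character on the stabilizer, so the `ℓ` admitting such a bound form a subgroup;
it contains the basis vectors by the definition of the defect. The constant does not depend on `m`.
-/
theorem Phase.norm_val_sub_one_le (τ : Phase L) (N : ℕ) (ℓ : Fin p → ℤ) :
    ∃ C : ℝ, 0 ≤ C ∧ ∀ m, (∀ ℓ, N • ℓ ∈ L.stab m) → ‖τ.val (N • ℓ) m - 1‖ ≤ C * τ.defect N m := by
  let G : AddSubgroup (Fin p → ℤ) :=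
    { carrier := {ℓ | ∃ C : ℝ, 0 ≤ C ∧ ∀ m, (∀ ℓ, N • ℓ ∈ L.stab m) →
        ‖τ.val (N • ℓ) m - 1‖ ≤ C * τ.defect N m}
      zero_mem' := ⟨0, le_rfl, fun m _ => by rw [smul_zero, τ.val_zero]; simp⟩
      add_mem' := by
        rintro a b ⟨C, hC0, hC⟩ ⟨C', hC0', hC'⟩
        refine ⟨C + C', by linarith, fun m hm => ?_⟩
        rw [smul_add, τ.val_add_of_stab (hm a)]
        have : τ.val (N • a) m * τ.val (N • b) m - 1 =
            τ.val (N • a) m * (τ.val (N • b) m - 1) + (τ.val (N • a) m - 1) := by ring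
        rw [this]
        refine (norm_add_le _ _).trans ?_
        rw [norm_mul, τ.norm_val, one_mul]
        linarith [hC m hm, hC' m hm]
      neg_mem' := by
        rintro a ⟨C, hC0, hC⟩
        refine ⟨C, hC0, fun m hm => ?_⟩
        have h1 := τ.val_add_of_stab (hm a) (N • (-a))
        rw [← smul_add, add_neg_cancel, smul_zero, τ.val_zero] at h1
        have h2 : τ.val (N • (-a)) m - 1 = -(τ.val (N • (-a)) m * (τ.val (N • a) m - 1)) := by
          linear_combination -h1
        rw [h2, norm_neg, norm_mul, τ.norm_val, one_mul]
        exact hC m hm }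
  have : ℓ ∈ G := by
    rw [LatticeAction.eq_sum_single ℓ]
    refine G.sum_mem fun i _ => G.zsmul_mem ⟨1, zero_le_one, fun m _ => ?_⟩ _
    rw [one_mul]
    exact Finset.single_le_sum (f := fun i : Fin p => ‖τ.val (N • Pi.single i 1) m - 1‖)
      (fun _ _ => norm_nonneg _) (Finset.mem_univ i)
  exact this

/-- Representatives of `ℤ^p` modulo `N`. -/
def box (p N : ℕ) : Set (Fin p → ℤ) := Set.Icc 0 fun _ => (N : ℤ)

theorem finite_box : (box p N).Finite := Set.finite_Icc _ _

theorem exists_mem_box (hN : 0 < N) {m : Fin q → ℤ} (hm : ∀ ℓ, N • ℓ ∈ L.stab m)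
    (ℓ : Fin p → ℤ) : ∃ b ∈ box p N, L.act b m = L.act ℓ m := by
  have hN' : (0 : ℤ) < N := by exact_mod_cast hN
  refine ⟨fun i => ℓ i % N, ⟨fun i => Int.emod_nonneg _ hN'.ne',
    fun i => (Int.emod_lt_of_pos _ hN').le⟩, ?_⟩
  have h : ℓ = (fun i => ℓ i % N) + N • fun i => ℓ i / N := by
    funext i
    simp only [Pi.add_apply, nsmul_eq_mul]
    exact (Int.emod_add_mul_ediv _ _).symm
  conv_rhs => rw [h, L.act_add, L.mem_stab.1 (hm _)]

theorem exists_base (L : LatticeAction p q) : ∃ base : (Fin q → ℤ) → Fin q → ℤ,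
    (∀ ℓ x, base (L.act ℓ x) = base x) ∧ ∀ x, ∃ ℓ, L.act ℓ x = base x := by
  let S : Setoid (Fin q → ℤ) :=
    { r := fun x y => ∃ ℓ, L.act ℓ x = y
      iseqv := ⟨fun x => ⟨0, L.act_zero x⟩, fun {x y} ⟨ℓ, h⟩ => ⟨-ℓ, by rw [← h, L.act_neg_act]⟩,
        fun {x y z} ⟨ℓ, h⟩ ⟨ℓ', h'⟩ => ⟨ℓ' + ℓ, by rw [L.act_add, h, h']⟩⟩ }
  refine ⟨fun x => (Quotient.mk S x).out, fun ℓ x => ?_, fun x => ?_⟩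
  · have : Quotient.mk S (L.act ℓ x) = Quotient.mk S x :=
      Quotient.sound ⟨-ℓ, L.act_neg_act ℓ x⟩
    simp only [this]
  · exact Setoid.symm (Quotient.exact (Quotient.out_eq (Quotient.mk S x)))

/-- On orbits close to resonance for `τ`, there are almost invariant unimodular functions for
`σ` on a multiple of the orbits. -/
theorem exists_almost_invariant (hN : 0 < N) (hs : 0 < s)
    (hst : ∀ ℓ m, σ.val ℓ m ^ s = τ.val ℓ m ^ s) {Y : Set (Fin q → ℤ)}
    (hY : ∀ x ∈ Y, ∀ ℓ, N • ℓ ∈ L.stab x) (hYinv : ∀ x ∈ Y, ∀ ℓ, L.act ℓ x ∈ Y) :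
    ∃ v : (Fin q → ℤ) → ℂ, (∀ x ∈ Y, ‖v ((N * s) • x)‖ = 1) ∧
      (∀ y, (¬ ∃ x ∈ Y, (N * s) • x = y) → v y = 0) ∧
      (∀ ℓ y, (¬ ∃ x ∈ Y, (N * s) • x = y) → σ.val ℓ y * v (L.act ℓ y) - v y = 0) ∧
      ∀ ℓ, ∃ C : ℝ, 0 ≤ C ∧ ∀ x ∈ Y,
        ‖σ.val ℓ ((N * s) • x) * v (L.act ℓ ((N * s) • x)) - v ((N * s) • x)‖ ≤
          C * τ.defect N x := by
  classical
  have hNs : 0 < N * s := Nat.mul_pos hN hs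
  obtain ⟨base, hbase, hbase'⟩ := exists_base L
  have hb : ∀ x ∈ Y, ∃ b ∈ box p N, L.act b x = base x := fun x hx => by
    obtain ⟨ℓ, hℓ⟩ := hbase' x
    obtain ⟨b, hb, h⟩ := exists_mem_box hN (hY x hx) ℓ
    exact ⟨b, hb, h.trans hℓ⟩
  choose! b hbbox hb using hb
  -- Transport the value `1` from the base point of each orbit by the phase of `b x`, which carries
  -- `x` to the base point. The failure of invariance is then the phase of a stabilizer element `g`,
  -- minus `1`.
  set v : (Fin q → ℤ) → ℂ := fun y =>
    if h : ∃ x ∈ Y, (N * s) • x = y then σ.val (b h.choose) y else 0 with hv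
  have hv1 : ∀ x ∈ Y, v ((N * s) • x) = σ.val (b x) ((N * s) • x) := by
    intro x hx
    have h : ∃ x' ∈ Y, (N * s) • x' = (N * s) • x := ⟨x, hx, rfl⟩
    rw [hv]
    simp only [dif_pos h]
    rw [nsmul_lattice_injective hNs h.choose_spec.2]
  have hv0 : ∀ y, (¬ ∃ x ∈ Y, (N * s) • x = y) → v y = 0 := fun y hy => by
    rw [hv]; simp only [dif_neg hy]
  refine ⟨v, fun x hx => by rw [hv1 x hx, σ.norm_val], hv0, fun ℓ y hy => ?_, fun ℓ => ?_⟩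
  · rw [hv0 y hy, hv0 (L.act ℓ y), mul_zero, sub_zero]
    rintro ⟨x, hx, h⟩
    refine hy ⟨L.act (-ℓ) x, hYinv x hx _, ?_⟩
    rw [← L.act_nsmul, h, L.act_neg_act]
  · choose C hC0 hC using τ.norm_val_sub_one_le N
    -- The possible `g` for a given `ℓ`: finitely many, whatever `x` is, which makes the constant
    -- uniform.
    set T : Finset (Fin p → ℤ) :=
      ((finite_box (p := p) (N := N)).toFinset ×ˢ (finite_box (p := p) (N := N)).toFinset).image
        (fun z => ℓ + z.1 - z.2) with hT
    refine ⟨s * ∑ g ∈ T, C g, mul_nonneg (Nat.cast_nonneg _)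
      (Finset.sum_nonneg fun g _ => hC0 g), fun x hx => ?_⟩
    set y := (N * s) • x with hy
    set g := ℓ + b (L.act ℓ x) - b x with hg
    have hℓx := hYinv x hx ℓ
    have hgT : g ∈ T := by
      refine Finset.mem_image.2 ⟨(b (L.act ℓ x), b x), ?_, rfl⟩
      simp only [Finset.mem_product, Set.Finite.mem_toFinset]
      exact ⟨hbbox _ hℓx, hbbox _ hx⟩
    have hgx : g ∈ L.stab x := by
      rw [L.mem_stab]
      apply L.act_injective (b x)
      rw [← L.act_add, hg, add_sub_cancel, add_comm, L.act_add, hb _ hℓx, hbase, hb _ hx]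
    have h1 : σ.val ℓ y * v (L.act ℓ y) - v y = (σ.val g y - 1) * σ.val (b x) y := by
      rw [hy, L.act_nsmul, hv1 _ hℓx, hv1 _ hx, ← L.act_nsmul, ← σ.val_add, sub_mul, one_mul,
        ← σ.val_add_of_stab (L.stab_le_stab_nsmul _ _ hgx), hg, sub_add_cancel]
    -- The factor `s` in `y` exchanges `σ` for `τ`; the factor `N` moves `g` into `N • ℤ^p`, where
    -- the defect gives control.
    have h2 : σ.val g y = τ.val (N • g) x ^ s := by
      rw [hy, σ.val_nsmul, mul_comm, pow_mul, hst, τ.val_nsmul_of_stab hgx, ← pow_mul, ← pow_mul,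
        mul_comm]
    rw [h1, norm_mul, σ.norm_val, mul_one, h2]
    refine (norm_pow_sub_one_le (τ.norm_val _ _) s).trans ?_
    rw [mul_assoc]
    refine mul_le_mul_of_nonneg_left ((hC g x (hY x hx)).trans ?_) (Nat.cast_nonneg _)
    exact mul_le_mul_of_nonneg_right (Finset.single_le_sum (fun g _ => hC0 g) hgT)
      (τ.defect_nonneg x)

theorem finite_orbit_set (hN : 0 < N) {m : Fin q → ℤ} (hm : ∀ ℓ, N • ℓ ∈ L.stab m) :
    (Set.range fun ℓ => L.act ℓ m).Finite := by
  refine ((finite_box (p := p) (N := N)).image fun ℓ => L.act ℓ m).subset ?_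
  rintro _ ⟨ℓ, rfl⟩
  obtain ⟨b, hb, h⟩ := exists_mem_box hN hm ℓ
  exact ⟨b, hb, h⟩

/-- There are no exact resonances on finite orbits. -/
theorem Phase.Rigid.defect_ne_zero (hσ : σ.Rigid) (i : Fin p) (hN : 0 < N) (hs : 0 < s)
    (hst : ∀ ℓ m, σ.val ℓ m ^ s = τ.val ℓ m ^ s) {m : Fin q → ℤ} (hm0 : m ≠ 0)
    (hm : ∀ ℓ, N • ℓ ∈ L.stab m) : τ.defect N m ≠ 0 := by
  intro h0
  have hNs : 0 < N * s := Nat.mul_pos hN hs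
  set Y : Set (Fin q → ℤ) := Set.range fun ℓ => L.act ℓ m with hYdef
  obtain ⟨v, hv1, hv0, hd0, hd⟩ := exists_almost_invariant (Y := Y) hN hs hst
    (by rintro _ ⟨ℓ, rfl⟩ ℓ'; rw [L.stab_act]; exact hm ℓ')
    (by rintro _ ⟨ℓ, rfl⟩ ℓ'; exact ⟨ℓ' + ℓ, L.act_add _ _ _⟩)
  have hmY : m ∈ Y := ⟨0, L.act_zero m⟩
  have hrd : RapidDecay v := by
    refine RapidDecay.of_finite_support
      (((finite_orbit_set hN hm).image fun x => (N * s) • x).subset fun y hy => ?_)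
    by_contra hno
    exact hy (hv0 y fun ⟨x, hx, h⟩ => hno ⟨x, hx, h⟩)
  have hinv : ∀ ℓ y, σ.val ℓ y * v (L.act ℓ y) = v y := by
    intro ℓ y
    by_cases hy : ∃ x ∈ Y, (N * s) • x = y
    · obtain ⟨x, hx, rfl⟩ := hy
      obtain ⟨C, -, hC⟩ := hd ℓ
      have h1 := hC x hx
      obtain ⟨ℓ', rfl⟩ := hx
      simp only [τ.defect_act hm, h0, mul_zero] at h1
      exact sub_eq_zero.1 (norm_le_zero_iff.1 h1)
    · exact sub_eq_zero.1 (hd0 ℓ y hy)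
  have hne : (N * s) • m ≠ 0 := fun h =>
    hm0 (nsmul_lattice_injective hNs (h.trans (smul_zero _).symm))
  have := hσ.eq_zero_of_invariant i hrd hinv hne
  have h1 := hv1 m hmY
  rw [this, norm_zero] at h1
  exact zero_ne_one h1

/-- The Diophantine property of finite orbits. -/
theorem Phase.Rigid.diophantine (hσ : σ.Rigid) (i : Fin p) (hN : 0 < N) (hs : 0 < s)
    (hst : ∀ ℓ m, σ.val ℓ m ^ s = τ.val ℓ m ^ s) :
    ∃ K : ℕ, {m : Fin q → ℤ | (∀ ℓ, N • ℓ ∈ L.stab m) ∧ m ≠ 0 ∧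
      τ.defect N m < ((1 + ‖m‖) ^ K)⁻¹}.Finite := by
  by_contra hcon
  push Not at hcon
  have hNs : 0 < N * s := Nat.mul_pos hN hs
  -- Balls in the lattice are finite, so an infinite exceptional set has points of norm above `K`.
  have hex : ∀ K : ℕ, ∃ m : Fin q → ℤ, ((∀ ℓ, N • ℓ ∈ L.stab m) ∧ m ≠ 0 ∧
      τ.defect N m < ((1 + ‖m‖) ^ K)⁻¹) ∧ (K : ℝ) < ‖m‖ := by
    intro K
    by_contra hno
    push Not at hno
    exact hcon K ((finite_norm_le (K : ℝ)).subset fun m hm => hno m hm)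
  choose y hy hyK using hex
  set Y : Set (Fin q → ℤ) := {x | ∃ K ℓ, x = L.act ℓ (y K)} with hYdef
  have hYper : ∀ x ∈ Y, ∀ ℓ, N • ℓ ∈ L.stab x := by
    rintro _ ⟨K, ℓ, rfl⟩ ℓ'
    rw [L.stab_act]
    exact (hy K).1 ℓ'
  obtain ⟨v, hv1, hv0, hd0, hd⟩ := exists_almost_invariant (Y := Y) hN hs hst hYper
    (by rintro _ ⟨K, ℓ, rfl⟩ ℓ'; exact ⟨K, ℓ' + ℓ, (L.act_add _ _ _).symm⟩)
  -- the defect is rapidly decreasing on `Y`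
  obtain ⟨B, hB1, hB⟩ : ∃ B : ℝ, 1 ≤ B ∧ ∀ K ℓ, ‖L.act ℓ (y K)‖ ≤ B * ‖y K‖ := by
    choose β hβ1 hβ using fun ℓ => exists_norm_mulVec_le (L.mat ℓ)
    refine ⟨1 + ∑ b ∈ (finite_box (p := p) (N := N)).toFinset, β b, ?_, fun K ℓ => ?_⟩
    · have : 0 ≤ ∑ b ∈ (finite_box (p := p) (N := N)).toFinset, β b :=
        Finset.sum_nonneg fun b _ => by linarith [hβ1 b]
      linarith
    · obtain ⟨b, hb, h⟩ := exists_mem_box hN (hy K).1 ℓ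
      rw [← h]
      refine (hβ b _).trans (mul_le_mul_of_nonneg_right ?_ (norm_nonneg _))
      have := Finset.single_le_sum (f := β) (fun b _ => by linarith [hβ1 b])
        ((finite_box (p := p) (N := N)).mem_toFinset.2 hb)
      linarith
  have hrapid : ∀ M : ℕ, ∃ C : ℝ, 0 ≤ C ∧ ∀ x ∈ Y, (1 + ‖x‖) ^ M * τ.defect N x ≤ C := by
    intro M
    set C1 := ∑ K ∈ Finset.range M, (1 + ‖y K‖) ^ M * τ.defect N (y K) with hC1
    have hC1' : 0 ≤ C1 := Finset.sum_nonneg fun K _ =>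
      mul_nonneg (by positivity) (τ.defect_nonneg _)
    refine ⟨B ^ M * (1 + C1), by positivity, ?_⟩
    rintro _ ⟨K, ℓ, rfl⟩
    rw [τ.defect_act (hy K).1]
    have h1 : (1 + ‖L.act ℓ (y K)‖) ^ M ≤ B ^ M * (1 + ‖y K‖) ^ M := by
      rw [← mul_pow]
      refine pow_le_pow_left₀ (by positivity) ?_ _
      nlinarith [hB K ℓ, norm_nonneg (y K)]
    have h2 : (1 + ‖y K‖) ^ M * τ.defect N (y K) ≤ 1 + C1 := by
      by_cases hKM : K < M
      · have := Finset.single_le_sum (f := fun K => (1 + ‖y K‖) ^ M * τ.defect N (y K))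
          (fun K _ => mul_nonneg (by positivity) (τ.defect_nonneg _)) (Finset.mem_range.2 hKM)
        linarith
      · have h3 : (1 + ‖y K‖) ^ M ≤ (1 + ‖y K‖) ^ K :=
          pow_le_pow_right₀ (by linarith [norm_nonneg (y K)]) (not_lt.1 hKM)
        have h4 : (1 + ‖y K‖) ^ M * τ.defect N (y K) ≤
            (1 + ‖y K‖) ^ K * ((1 + ‖y K‖) ^ K)⁻¹ :=
          mul_le_mul h3 (hy K).2.2.le (τ.defect_nonneg _) (by positivity)
        rw [mul_inv_cancel₀ (by positivity)] at h4
        linarith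
    calc (1 + ‖L.act ℓ (y K)‖) ^ M * τ.defect N (y K)
        ≤ (B ^ M * (1 + ‖y K‖) ^ M) * τ.defect N (y K) :=
          mul_le_mul_of_nonneg_right h1 (τ.defect_nonneg _)
      _ = B ^ M * ((1 + ‖y K‖) ^ M * τ.defect N (y K)) := by ring
      _ ≤ B ^ M * (1 + C1) := mul_le_mul_of_nonneg_left h2 (by positivity)
  have hNsR : (1 : ℝ) ≤ (N * s : ℕ) := by exact_mod_cast hNs
  have hnormNs : ∀ x : Fin q → ℤ, ‖(N * s) • x‖ = (N * s : ℕ) * ‖x‖ := fun x => by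
    rw [← natCast_zsmul, norm_smul, Int.norm_natCast]
  have hrd : ∀ ℓ, RapidDecay fun m => σ.val ℓ m * v (L.act ℓ m) - v m := by
    intro ℓ M
    obtain ⟨C, hC0, hC⟩ := hd ℓ
    obtain ⟨C', hC0', hC'⟩ := hrapid M
    refine ⟨((N * s : ℕ) : ℝ) ^ M * (C * C'), fun z => ?_⟩
    by_cases hz : ∃ x ∈ Y, (N * s) • x = z
    · obtain ⟨x, hx, rfl⟩ := hz
      have h1 : (1 + ‖(N * s) • x‖) ^ M ≤ ((N * s : ℕ) : ℝ) ^ M * (1 + ‖x‖) ^ M := by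
        rw [← mul_pow]
        refine pow_le_pow_left₀ (by positivity) ?_ _
        rw [hnormNs]
        nlinarith [norm_nonneg x]
      refine (mul_le_mul h1 (hC x hx) (norm_nonneg _) (by positivity)).trans ?_
      calc ((N * s : ℕ) : ℝ) ^ M * (1 + ‖x‖) ^ M * (C * τ.defect N x)
          = ((N * s : ℕ) : ℝ) ^ M * (C * ((1 + ‖x‖) ^ M * τ.defect N x)) := by ring
        _ ≤ _ := mul_le_mul_of_nonneg_left (mul_le_mul_of_nonneg_left (hC' x hx) hC0)
            (by positivity)
    · simp only [hd0 ℓ z hz, norm_zero, mul_zero]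
      positivity
  obtain ⟨u, hu, hw⟩ := hσ.exists_correction hrd
  -- The invariant vector `u - v` vanishes at this point, because some stabilizer element acts there
  -- with phase `≠ 1`. So `u = v` has modulus one at points of unbounded norm.
  have huv : ∀ K, ‖u ((N * s) • y K)‖ = 1 := by
    intro K
    have hy0 : (N * s) • y K ≠ 0 := fun h =>
      (hy K).2.1 (nsmul_lattice_injective hNs (h.trans (smul_zero _).symm))
    have hper : ∀ ℓ, N • ℓ ∈ L.stab ((N * s) • y K) := fun ℓ =>
      L.stab_le_stab_nsmul _ _ ((hy K).1 ℓ)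
    have hdef : ∃ j : Fin p, τ.val (N • Pi.single j 1) ((N * s) • y K) ≠ 1 := by
      by_contra hall
      push Not at hall
      refine hσ.defect_ne_zero i hN hs hst hy0 hper ?_
      exact Finset.sum_eq_zero fun j _ => by rw [hall j, sub_self, norm_zero]
    obtain ⟨j, hj⟩ := hdef
    have h1 := hw (N • Pi.single j 1) _ hy0
    rw [L.mem_stab.1 (hper _)] at h1
    have h2 : σ.val (N • Pi.single j 1) ((N * s) • y K) =
        τ.val (N • Pi.single j 1) ((N * s) • y K) := by
      rw [σ.val_nsmul, τ.val_nsmul, mul_comm, pow_mul, pow_mul, hst]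
    rw [h2] at h1
    have h3 : (τ.val (N • Pi.single j 1) ((N * s) • y K) - 1) *
        (u ((N * s) • y K) - v ((N * s) • y K)) = 0 := by linear_combination -h1
    have h4 := (mul_eq_zero.1 h3).resolve_left (sub_ne_zero.2 hj)
    rw [sub_eq_zero.1 h4]
    exact hv1 _ ⟨K, 0, (L.act_zero _).symm⟩
  obtain ⟨C, hC⟩ := hu 1
  obtain ⟨K, hK⟩ := exists_nat_gt C
  have h1 := hC ((N * s) • y K)
  rw [huv, pow_one, mul_one, hnormNs] at h1
  have h2 := hyK K
  nlinarith [norm_nonneg (y K)]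

end Diophantine

end TorusAction

/-! ### Sums along an infinite cyclic direction -/

namespace TorusAction

section Solution

variable {p q : ℕ} {L : LatticeAction p q} {σ τ : Phase L} {s : ℕ}

theorem RapidDecay.weight {f : (Fin q → ℤ) → ℂ} (hf : RapidDecay f) (M : ℕ) :
    Summable fun x => (1 + ‖x‖) ^ M * ‖f x‖ := by
  have h : RapidDecay fun x => (((1 + ‖x‖) ^ M : ℝ) : ℂ) * f x := by
    intro K
    obtain ⟨C, hC⟩ := hf (K + M)
    refine ⟨C, fun n => ?_⟩
    rw [norm_mul, Complex.norm_real, Real.norm_of_nonneg (by positivity), ← mul_assoc, ← pow_add]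
    exact hC n
  refine h.summable.congr fun x => ?_
  rw [norm_mul, Complex.norm_real, Real.norm_of_nonneg (by positivity)]

/-- When all `x n` are polynomially large in terms of `m`, the weight at `m` is absorbed by a higher
weight on `f`. -/
theorem RapidDecay.tsum_le {f : (Fin q → ℤ) → ℂ} (hf : RapidDecay f) {x : ℕ → Fin q → ℤ}
    (hx : Function.Injective x) {m : Fin q → ℤ} {C : ℝ} {Q : ℕ}
    (h : ∀ n, 1 + ‖m‖ ≤ C * (1 + ‖x n‖) ^ Q) (M : ℕ) :
    (1 + ‖m‖) ^ M * ∑' n, ‖f (x n)‖ ≤ C ^ M * ∑' y, (1 + ‖y‖) ^ (Q * M) * ‖f y‖ := by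
  have hw := hf.weight (Q * M)
  have hC : 0 ≤ C := by
    by_contra hneg
    have h1 : C * (1 + ‖x 0‖) ^ Q ≤ 0 :=
      mul_nonpos_of_nonpos_of_nonneg (not_le.1 hneg).le (by positivity)
    linarith [h 0, norm_nonneg m]
  have hs1 : Summable fun n => ‖f (x n)‖ := hf.summable.comp_injective hx
  have hs2 : Summable fun n => (1 + ‖x n‖) ^ (Q * M) * ‖f (x n)‖ := hw.comp_injective hx
  rw [← tsum_mul_left]
  calc ∑' n, (1 + ‖m‖) ^ M * ‖f (x n)‖
      ≤ ∑' n, C ^ M * ((1 + ‖x n‖) ^ (Q * M) * ‖f (x n)‖) := by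
        refine Summable.tsum_le_tsum (fun n => ?_) (hs1.mul_left _) (hs2.mul_left _)
        rw [← mul_assoc, pow_mul, ← mul_pow]
        exact mul_le_mul_of_nonneg_right (pow_le_pow_left₀ (by positivity) (h n) _) (norm_nonneg _)
    _ = C ^ M * ∑' n, (1 + ‖x n‖) ^ (Q * M) * ‖f (x n)‖ := tsum_mul_left
    _ ≤ _ := mul_le_mul_of_nonneg_left
        (tsum_comp_le_tsum_of_inj hw (fun y => by positivity) hx) (by positivity)

/-- The terms of the formal solution along a cyclic direction. -/
noncomputable def Phase.term (τ : Phase L) (f : (Fin q → ℤ) → ℂ) (g : Fin p → ℤ) (m : Fin q → ℤ)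
    (k : ℤ) : ℂ := τ.val (k • g) m * f (L.act (k • g) m)

theorem Phase.norm_term (f : (Fin q → ℤ) → ℂ) (g : Fin p → ℤ) (m : Fin q → ℤ) (k : ℤ) :
    ‖τ.term f g m k‖ = ‖f (L.act (k • g) m)‖ := by
  rw [Phase.term, norm_mul, τ.norm_val, one_mul]

theorem Phase.summable_term {f : (Fin q → ℤ) → ℂ} (hf : RapidDecay f) {g : Fin p → ℤ}
    {m : Fin q → ℤ} (hg : Function.Injective fun k : ℤ => L.act (k • g) m) :
    Summable (τ.term f g m) := by
  refine Summable.of_norm ?_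
  simp only [Phase.norm_term]
  exact hf.summable.comp_injective hg

theorem injective_act_of_injective {g : Fin p → ℤ} {m : Fin q → ℤ}
    (hg : Function.Injective fun k : ℤ => L.act (k • g) m) (ℓ : Fin p → ℤ) :
    Function.Injective fun k : ℤ => L.act (k • g) (L.act ℓ m) := by
  intro a b hab
  apply hg
  apply L.act_injective ℓ
  simp only at hab ⊢
  rw [L.act_comm ℓ, hab, L.act_comm ℓ]

/-- `IsCocycle.swap` at the `k`-th point of the line. The right side telescopes: sums over `ℤ`
become invariant, and sums over `ℕ` leave the boundary term `d ℓ m`. -/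
theorem Phase.term_coboundary {d : (Fin p → ℤ) → (Fin q → ℤ) → ℂ} (hd : τ.IsCocycle d)
    (g ℓ : Fin p → ℤ) (m : Fin q → ℤ) (k : ℤ) :
    τ.val ℓ m * τ.term (d g) g (L.act ℓ m) k - τ.term (d g) g m k =
      τ.term (d ℓ) g m (k + 1) - τ.term (d ℓ) g m k := by
  simp only [Phase.term]
  have h1 : τ.val ℓ m * τ.val (k • g) (L.act ℓ m) =
      τ.val (k • g) m * τ.val ℓ (L.act (k • g) m) := by
    rw [← τ.val_add, ← τ.val_add, add_comm]
  have h2 : τ.val ((k + 1) • g) m = τ.val (k • g) m * τ.val g (L.act (k • g) m) := by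
    rw [add_smul, one_smul, τ.val_add]
  have h3 : L.act ((k + 1) • g) m = L.act g (L.act (k • g) m) := by
    rw [add_smul, one_smul, add_comm, L.act_add]
  rw [← mul_assoc, h1, h2, h3, L.act_comm (k • g) ℓ]
  linear_combination τ.val (k • g) m * hd.swap g ℓ (L.act (k • g) m)

/-- The two-sided sums along an infinite cyclic direction vanish. -/
theorem Phase.Rigid.tsum_term_eq_zero (hσ : σ.Rigid) (hs : 0 < s)
    (hst : ∀ ℓ m, σ.val ℓ m ^ s = τ.val ℓ m ^ s) {d : (Fin p → ℤ) → (Fin q → ℤ) → ℂ}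
    (hd : τ.IsCocycle d) {g : Fin p → ℤ} {m : Fin q → ℤ} (hm : m ≠ 0)
    (hg : Function.Injective fun k : ℤ => L.act (k • g) m) :
    ∑' k : ℤ, τ.term (d g) g m k = 0 := by
  refine hσ.eq_zero_of_orbit_sum hs hst hm hg (c := d g) (hd.1 g).summable
    (D := fun x => ∑' k : ℤ, τ.term (d g) g x k) (fun ℓ => rfl) fun ℓ ℓ' => ?_
  set x := L.act ℓ' m with hx
  have hgx : Function.Injective fun k : ℤ => L.act (k • g) x := injective_act_of_injective hg ℓ'
  have h1 := Phase.summable_term (τ := τ) (hd.1 g) hgx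
  have h2 := Phase.summable_term (τ := τ) (hd.1 g) (injective_act_of_injective hgx ℓ)
  have h3 := Phase.summable_term (τ := τ) (hd.1 ℓ) hgx
  have h3' : Summable fun k : ℤ => τ.term (d ℓ) g x (k + 1) :=
    (Equiv.addRight (1 : ℤ)).summable_iff.2 h3
  have h4 : τ.val ℓ x * (∑' k : ℤ, τ.term (d g) g (L.act ℓ x) k) - ∑' k : ℤ, τ.term (d g) g x k =
      (∑' k : ℤ, τ.term (d ℓ) g x (k + 1)) - ∑' k : ℤ, τ.term (d ℓ) g x k := by
    rw [← tsum_mul_left, ← (h2.mul_left _).tsum_sub h1, ← h3'.tsum_sub h3]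
    exact tsum_congr fun k => Phase.term_coboundary hd g ℓ x k
  have h5 : ∑' k : ℤ, τ.term (d ℓ) g x (k + 1) = ∑' k : ℤ, τ.term (d ℓ) g x k :=
    (Equiv.addRight (1 : ℤ)).tsum_eq (τ.term (d ℓ) g x)
  rw [h5, sub_self] at h4
  exact (sub_eq_zero.1 h4).symm

/-- Along one half of an infinite cyclic orbit, all points are polynomially large. -/
theorem exists_half_orbit_bound (L : LatticeAction p q) (g : Fin p → ℤ) :
    ∃ C : ℝ, 1 ≤ C ∧ ∃ Q : ℕ, ∀ m : Fin q → ℤ,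
      (∀ n : ℕ, 0 < n → L.act (n • g) m ≠ m) →
      (∀ n : ℕ, 1 + ‖m‖ ≤ C * (1 + ‖L.act ((n : ℤ) • g) m‖) ^ Q) ∨
      (∀ n : ℕ, 1 + ‖m‖ ≤ C * (1 + ‖L.act ((-((n : ℤ) + 1)) • g) m‖) ^ Q) := by
  obtain ⟨C, hC1, Q, h⟩ := exists_intermediate_bound (L.isUnit_det g)
  have hpow : ∀ (n : ℕ) m, (L.mat g ^ n).mulVec m = L.act (n • g) m := fun n m => by
    rw [← L.mat_nsmul]; rfl
  refine ⟨1 + C, by linarith, Q, fun m hm => ?_⟩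
  by_contra hcon
  push Not at hcon
  obtain ⟨⟨k, hk⟩, n, hn⟩ := hcon
  set a := L.act ((k : ℤ) • g) m with ha
  set b := L.act ((-((n : ℤ) + 1)) • g) m with hb
  -- If both halves contained a small point, `m` would lie between `b` and `a` on one forward orbit,
  -- and the intermediate bound would make `m` small as well.
  set X := max (1 + ‖a‖) (1 + ‖b‖) with hX
  have hX1 : 1 ≤ X := le_trans (by linarith [norm_nonneg a]) (le_max_left _ _)
  have hbm : (L.mat g ^ (n + 1)).mulVec b = m := by
    rw [hpow, hb, ← L.act_add, ← natCast_zsmul, ← add_smul]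
    push_cast
    rw [add_neg_cancel, zero_smul, L.act_zero]
  have hba : (L.mat g ^ (n + 1 + k)).mulVec b = a := by
    rw [add_comm, pow_add, ← Matrix.mulVec_mulVec, hbm, hpow, ← natCast_zsmul]
  have hbinf : ∀ j : ℕ, 0 < j → (L.mat g ^ j).mulVec b ≠ b := by
    intro j hj he
    rw [hpow, hb, L.act_comm] at he
    exact hm j hj (L.act_injective _ he)
  have h1 := h b hbinf (n + 1) (n + 1 + k) X (by omega) hX1
    ((by linarith : ‖b‖ ≤ 1 + ‖b‖).trans (le_max_right _ _))
    (by rw [hba]; exact (by linarith : ‖a‖ ≤ 1 + ‖a‖).trans (le_max_left _ _))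
  rw [hbm] at h1
  have h2 : (1 + C) * X ^ Q < 1 + ‖m‖ := by
    rcases max_choice (1 + ‖a‖) (1 + ‖b‖) with hc | hc
    · rw [hX, hc]; exact hk
    · rw [hX, hc]; exact hn
  have h3 : 1 ≤ X ^ Q := one_le_pow₀ hX1
  nlinarith

end Solution

end TorusAction

/-! ### Solving the cohomological equation for the second phase -/

namespace TorusAction

section Solution

variable {p q : ℕ} {L : LatticeAction p q} {σ τ : Phase L} {s : ℕ}

open ComplexConjugate

/-- The solution on finite orbits. -/
noncomputable def Phase.finiteSolution (τ : Phase L) (N : ℕ)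
    (d : (Fin p → ℤ) → (Fin q → ℤ) → ℂ) (m : Fin q → ℤ) : ℂ :=
  (∑ i : Fin p, conj (τ.val (N • Pi.single i 1) m - 1) * d (N • Pi.single i 1) m) /
    ((∑ i : Fin p, ‖τ.val (N • Pi.single i 1) m - 1‖ ^ 2 : ℝ) : ℂ)

theorem Phase.defect_sq_le (N : ℕ) (m : Fin q → ℤ) :
    τ.defect N m ^ 2 ≤ p * ∑ i : Fin p, ‖τ.val (N • Pi.single i 1) m - 1‖ ^ 2 := by
  have := sq_sum_le_card_mul_sum_sq (s := Finset.univ)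
    (f := fun i : Fin p => ‖τ.val (N • Pi.single i 1) m - 1‖)
  simpa [Phase.defect] using this

/-- For each `i`, `IsCocycle.swap` with `N • e_i` expresses `(τ_i - 1) * d ℓ m` as the coboundary of
`d (N • e_i)`. The least-squares combination of these equations avoids choosing a nonresonant `i`
for each orbit. -/
theorem Phase.finiteSolution_spec {N : ℕ} {d : (Fin p → ℤ) → (Fin q → ℤ) → ℂ}
    (hd : τ.IsCocycle d) {m : Fin q → ℤ} (hm : ∀ ℓ, N • ℓ ∈ L.stab m) (h0 : τ.defect N m ≠ 0)
    (ℓ : Fin p → ℤ) :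
    d ℓ m = τ.val ℓ m * τ.finiteSolution N d (L.act ℓ m) - τ.finiteSolution N d m := by
  set S : ℝ := ∑ i : Fin p, ‖τ.val (N • Pi.single i 1) m - 1‖ ^ 2 with hS
  have hS0 : (S : ℂ) ≠ 0 := by
    intro h
    have h1 : S = 0 := by exact_mod_cast h
    have h2 := τ.defect_sq_le N m
    rw [← hS, h1, mul_zero] at h2
    exact h0 (pow_eq_zero_iff two_ne_zero |>.1 (le_antisymm h2 (sq_nonneg _)))
  have hval : ∀ i : Fin p, τ.val (N • Pi.single i 1) (L.act ℓ m) = τ.val (N • Pi.single i 1) m :=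
    fun i => τ.val_act_of_stab (hm _) ℓ
  simp only [Phase.finiteSolution, hval, ← hS]
  rw [mul_div_assoc', ← sub_div, eq_div_iff hS0, Finset.mul_sum, ← Finset.sum_sub_distrib, hS]
  push_cast
  rw [Finset.mul_sum]
  refine Finset.sum_congr rfl fun i _ => ?_
  have h1 := hd.swap (N • Pi.single i 1) ℓ m
  rw [L.mem_stab.1 (hm _)] at h1
  rw [← Complex.conj_mul']
  linear_combination -conj (τ.val (N • Pi.single i 1) m - 1) * h1

theorem Phase.norm_finiteSolution_le {N : ℕ} {d : (Fin p → ℤ) → (Fin q → ℤ) → ℂ} {m : Fin q → ℤ}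
    {K : ℕ} (h : ((1 + ‖m‖) ^ K)⁻¹ ≤ τ.defect N m) :
    ‖τ.finiteSolution N d m‖ ≤
      2 * p * (1 + ‖m‖) ^ (2 * K) * ∑ i : Fin p, ‖d (N • Pi.single i 1) m‖ := by
  set S : ℝ := ∑ i : Fin p, ‖τ.val (N • Pi.single i 1) m - 1‖ ^ 2 with hS
  have hS0 : 0 ≤ S := Finset.sum_nonneg fun _ _ => by positivity
  have hpos : 0 < ((1 + ‖m‖) ^ K)⁻¹ := by positivity
  have h1 : (((1 + ‖m‖) ^ K)⁻¹) ^ 2 ≤ p * S :=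
    (pow_le_pow_left₀ hpos.le h 2).trans (τ.defect_sq_le N m)
  have hSpos : 0 < S := by
    rcases hS0.lt_or_eq with h2 | h2
    · exact h2
    · rw [← h2, mul_zero] at h1
      exact absurd h1 (not_le.2 (by positivity))
  have h2 : 1 ≤ p * (1 + ‖m‖) ^ (2 * K) * S := by
    have h3 : (1 + ‖m‖) ^ (2 * K) * ((((1 + ‖m‖) ^ K)⁻¹) ^ 2) = 1 := by
      rw [mul_comm 2 K, pow_mul, ← mul_pow, mul_inv_cancel₀ (by positivity), one_pow]
    calc (1 : ℝ) = (1 + ‖m‖) ^ (2 * K) * ((((1 + ‖m‖) ^ K)⁻¹) ^ 2) := h3.symm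
      _ ≤ (1 + ‖m‖) ^ (2 * K) * (p * S) := mul_le_mul_of_nonneg_left h1 (by positivity)
      _ = _ := by ring
  rw [Phase.finiteSolution, norm_div, Complex.norm_real, Real.norm_of_nonneg hS0,
    div_le_iff₀ hSpos]
  have h4 : ‖∑ i : Fin p, conj (τ.val (N • Pi.single i 1) m - 1) * d (N • Pi.single i 1) m‖ ≤
      2 * ∑ i : Fin p, ‖d (N • Pi.single i 1) m‖ := by
    rw [Finset.mul_sum]
    refine (norm_sum_le _ _).trans (Finset.sum_le_sum fun i _ => ?_)
    rw [norm_mul, RCLike.norm_conj]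
    refine mul_le_mul_of_nonneg_right ((norm_sub_le _ _).trans ?_) (norm_nonneg _)
    rw [τ.norm_val, norm_one]; norm_num
  have h5 : 0 ≤ ∑ i : Fin p, ‖d (N • Pi.single i 1) m‖ := Finset.sum_nonneg fun _ _ => norm_nonneg _
  calc _ ≤ 2 * ∑ i : Fin p, ‖d (N • Pi.single i 1) m‖ := h4
    _ ≤ (2 * ∑ i : Fin p, ‖d (N • Pi.single i 1) m‖) * (p * (1 + ‖m‖) ^ (2 * K) * S) :=
        le_mul_of_one_le_right (by positivity) h2
    _ = _ := by ring

/-- The solution along an infinite cyclic direction. -/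
noncomputable def Phase.infiniteSolution (τ : Phase L) (d : (Fin p → ℤ) → (Fin q → ℤ) → ℂ)
    (g : Fin p → ℤ) (m : Fin q → ℤ) : ℂ :=
  -∑' n : ℕ, τ.term (d g) g m n

theorem Phase.infiniteSolution_spec {d : (Fin p → ℤ) → (Fin q → ℤ) → ℂ}
    (hd : τ.IsCocycle d) {g : Fin p → ℤ} {m : Fin q → ℤ}
    (hg : Function.Injective fun k : ℤ => L.act (k • g) m) (ℓ : Fin p → ℤ) :
    d ℓ m = τ.val ℓ m * τ.infiniteSolution d g (L.act ℓ m) - τ.infiniteSolution d g m := by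
  have hcast : Function.Injective (fun n : ℕ => (n : ℤ)) := Nat.cast_injective
  have h1 : Summable fun n : ℕ => τ.term (d g) g m n :=
    (Phase.summable_term (τ := τ) (hd.1 g) hg).comp_injective hcast
  have h2 : Summable fun n : ℕ => τ.term (d g) g (L.act ℓ m) n :=
    (Phase.summable_term (τ := τ) (hd.1 g) (injective_act_of_injective hg ℓ)).comp_injective hcast
  have h3 : Summable fun n : ℕ => τ.term (d ℓ) g m n :=
    (Phase.summable_term (τ := τ) (hd.1 ℓ) hg).comp_injective hcast
  have h3' : Summable fun n : ℕ => τ.term (d ℓ) g m ((n : ℤ) + 1) := by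
    have := (summable_nat_add_iff 1).2 h3
    simpa using this
  have h4 : τ.val ℓ m * (∑' n : ℕ, τ.term (d g) g (L.act ℓ m) n) - ∑' n : ℕ, τ.term (d g) g m n =
      (∑' n : ℕ, τ.term (d ℓ) g m ((n : ℤ) + 1)) - ∑' n : ℕ, τ.term (d ℓ) g m n := by
    rw [← tsum_mul_left, ← (h2.mul_left _).tsum_sub h1, ← h3'.tsum_sub h3]
    exact tsum_congr fun k => Phase.term_coboundary hd g ℓ m k
  have h5 := h3.tsum_eq_zero_add
  have h6 : τ.term (d ℓ) g m ((0 : ℕ) : ℤ) = d ℓ m := by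
    simp [Phase.term, τ.val_zero, L.act_zero]
  rw [h6] at h5
  push_cast at h5
  rw [Phase.infiniteSolution, Phase.infiniteSolution]
  linear_combination h4 - h5

/-- The two-sided sum being zero, the solution is also the sum over the opposite half orbit; use the
half that stays polynomially large. -/
theorem Phase.Rigid.exists_infiniteSolution_bound (hσ : σ.Rigid) (hs : 0 < s)
    (hst : ∀ ℓ m, σ.val ℓ m ^ s = τ.val ℓ m ^ s) {d : (Fin p → ℤ) → (Fin q → ℤ) → ℂ}
    (hd : τ.IsCocycle d) (g : Fin p → ℤ) (M : ℕ) :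
    ∃ B : ℝ, 0 ≤ B ∧ ∀ m, m ≠ 0 → (∀ n : ℕ, 0 < n → L.act (n • g) m ≠ m) →
      (1 + ‖m‖) ^ M * ‖τ.infiniteSolution d g m‖ ≤ B := by
  obtain ⟨C, hC1, Q, h⟩ := exists_half_orbit_bound L g
  refine ⟨C ^ M * ∑' y, (1 + ‖y‖) ^ (Q * M) * ‖d g y‖,
    mul_nonneg (by positivity) (tsum_nonneg fun _ => by positivity), fun m hm0 hm => ?_⟩
  have hg := L.injective_of_infinite_direction hm
  have hinj1 : Function.Injective fun n : ℕ => L.act ((n : ℤ) • g) m := fun a b hab => by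
    have := hg hab
    exact_mod_cast this
  have hinj2 : Function.Injective fun n : ℕ => L.act ((-((n : ℤ) + 1)) • g) m := fun a b hab => by
    have := hg hab
    simpa using this
  have hs1 : Summable fun n : ℕ => τ.term (d g) g m n := by
    refine Summable.of_norm ?_
    simp only [Phase.norm_term]
    exact (hd.1 g).summable.comp_injective hinj1
  have hs2 : Summable fun n : ℕ => τ.term (d g) g m (-((n : ℤ) + 1)) := by
    refine Summable.of_norm ?_
    simp only [Phase.norm_term]
    exact (hd.1 g).summable.comp_injective hinj2
  have hzero := hσ.tsum_term_eq_zero hs hst hd hm0 hg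
  rw [tsum_of_nat_of_neg_add_one hs1 hs2] at hzero
  rcases h m hm with h1 | h1
  · refine le_trans (mul_le_mul_of_nonneg_left ?_ (by positivity)) ((hd.1 g).tsum_le hinj1 h1 M)
    rw [Phase.infiniteSolution, norm_neg]
    refine (norm_tsum_le_tsum_norm hs1.norm).trans (le_of_eq ?_)
    simp only [Phase.norm_term]
  · refine le_trans (mul_le_mul_of_nonneg_left ?_ (by positivity)) ((hd.1 g).tsum_le hinj2 h1 M)
    rw [Phase.infiniteSolution, neg_eq_of_add_eq_zero_right hzero]
    refine (norm_tsum_le_tsum_norm hs2.norm).trans (le_of_eq ?_)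
    simp only [Phase.norm_term]

/-- Rigidity is inherited by a phase with the same `s`-th power. -/
theorem Phase.Rigid.of_pow_eq [Nonempty (Fin p)] (hσ : σ.Rigid) (hs : 0 < s)
    (hst : ∀ ℓ m, σ.val ℓ m ^ s = τ.val ℓ m ^ s) : τ.Rigid := by
  classical
  intro d hd
  have i0 : Fin p := Classical.arbitrary _
  obtain ⟨N, hN, hper⟩ := L.exists_uniform_period
  obtain ⟨K, hK⟩ := hσ.diophantine i0 hN hs hst
  -- The choice depends only on a predicate that is the same along the orbit, so the direction is
  -- constant on orbits.
  set dir : (Fin q → ℤ) → Fin p := fun m =>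
    Classical.epsilon fun i : Fin p => ∀ n : ℕ, 0 < n → L.act (n • Pi.single i 1) m ≠ m with hdir
  have hdir_spec : ∀ m, ¬ L.FiniteOrbit m →
      ∀ n : ℕ, 0 < n → L.act (n • Pi.single (dir m) 1) m ≠ m := fun m hm =>
    Classical.epsilon_spec (L.exists_infinite_direction hm)
  have hdir_act : ∀ ℓ m, dir (L.act ℓ m) = dir m := by
    intro ℓ m
    have : (fun i : Fin p => ∀ n : ℕ, 0 < n →
        L.act (n • Pi.single i 1) (L.act ℓ m) ≠ L.act ℓ m) =
        fun i : Fin p => ∀ n : ℕ, 0 < n → L.act (n • Pi.single i 1) m ≠ m := by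
      funext i
      refine forall_congr fun n => forall_congr fun _ => ?_
      rw [L.act_comm, Ne, (L.act_injective ℓ).eq_iff]
    simp only [hdir, this]
  have hfin_act : ∀ ℓ m, L.FiniteOrbit (L.act ℓ m) ↔ L.FiniteOrbit m := fun ℓ m => by
    simp only [LatticeAction.FiniteOrbit, L.stab_act]
  set u : (Fin q → ℤ) → ℂ := fun m => if m = 0 then 0 else
    if L.FiniteOrbit m then τ.finiteSolution N d m
    else τ.infiniteSolution d (Pi.single (dir m) 1) m with hu
  refine ⟨u, fun M => ?_, fun ℓ m hm => ?_⟩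
  · choose B hB0 hB using fun i : Fin p =>
      hσ.exists_infiniteSolution_bound hs hst hd (Pi.single i 1) M
    choose D hD using fun i : Fin p => hd.1 (N • Pi.single i 1) (M + 2 * K)
    have hD0 : ∀ i, 0 ≤ D i := fun i =>
      le_trans (by positivity) (hD i 0)
    -- `E1` takes care of the finitely many exceptions to the Diophantine bound, `E2` of the other
    -- finite orbits, `E3` of the infinite ones.
    set E1 := ∑ m ∈ hK.toFinset, (1 + ‖m‖) ^ M * ‖u m‖ with hE1
    set E2 := 2 * p * ∑ i, D i with hE2
    set E3 := ∑ i, B i with hE3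
    have hE1' : 0 ≤ E1 := Finset.sum_nonneg fun _ _ => by positivity
    have hE2' : 0 ≤ E2 := mul_nonneg (by positivity) (Finset.sum_nonneg fun i _ => hD0 i)
    have hE3' : 0 ≤ E3 := Finset.sum_nonneg fun i _ => hB0 i
    refine ⟨E1 + E2 + E3, fun m => ?_⟩
    by_cases hm0 : m = 0
    · have : u m = 0 := by rw [hu]; simp only [if_pos hm0]
      rw [this, norm_zero, mul_zero]; linarith
    by_cases hmf : L.FiniteOrbit m
    · by_cases hmE : m ∈ hK.toFinset
      · have := Finset.single_le_sum (f := fun m => (1 + ‖m‖) ^ M * ‖u m‖)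
          (fun _ _ => by positivity) hmE
        linarith
      · have hdef : ((1 + ‖m‖) ^ K)⁻¹ ≤ τ.defect N m := by
          by_contra hlt
          exact hmE (hK.mem_toFinset.2 ⟨hper m hmf, hm0, not_le.1 hlt⟩)
        have hum : u m = τ.finiteSolution N d m := by
          rw [hu]; simp only [if_neg hm0, if_pos hmf]
        have h1 := mul_le_mul_of_nonneg_left (τ.norm_finiteSolution_le (d := d) hdef)
          (show 0 ≤ (1 + ‖m‖) ^ M by positivity)
        have h2 : (1 + ‖m‖) ^ M * (2 * p * (1 + ‖m‖) ^ (2 * K) *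
            ∑ i : Fin p, ‖d (N • Pi.single i 1) m‖) =
            2 * p * ∑ i : Fin p, (1 + ‖m‖) ^ (M + 2 * K) * ‖d (N • Pi.single i 1) m‖ := by
          rw [← Finset.mul_sum, pow_add]; ring
        rw [h2] at h1
        have h3 : 2 * p * ∑ i : Fin p, (1 + ‖m‖) ^ (M + 2 * K) * ‖d (N • Pi.single i 1) m‖ ≤ E2 :=
          mul_le_mul_of_nonneg_left (Finset.sum_le_sum fun i _ => hD i m) (by positivity)
        rw [hum]
        linarith
    · have hum : u m = τ.infiniteSolution d (Pi.single (dir m) 1) m := by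
        rw [hu]; simp only [if_neg hm0, if_neg hmf]
      have h1 := hB (dir m) m hm0 (hdir_spec m hmf)
      have h2 := Finset.single_le_sum (fun i _ => hB0 i) (Finset.mem_univ (dir m))
      rw [hum]
      linarith
  · have hm' : L.act ℓ m ≠ 0 := L.act_ne_zero hm
    by_cases hmf : L.FiniteOrbit m
    · have h1 : u m = τ.finiteSolution N d m := by
        rw [hu]; simp only [if_neg hm, if_pos hmf]
      have h2 : u (L.act ℓ m) = τ.finiteSolution N d (L.act ℓ m) := by
        rw [hu]; simp only [if_neg hm', if_pos ((hfin_act ℓ m).2 hmf)]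
      rw [h1, h2]
      exact Phase.finiteSolution_spec hd (hper m hmf)
        (hσ.defect_ne_zero i0 hN hs hst hm (hper m hmf)) ℓ
    · have h1 : u m = τ.infiniteSolution d (Pi.single (dir m) 1) m := by
        rw [hu]; simp only [if_neg hm, if_neg hmf]
      have h2 : u (L.act ℓ m) = τ.infiniteSolution d (Pi.single (dir m) 1) (L.act ℓ m) := by
        rw [hu]; simp only [if_neg hm', if_neg (fun h => hmf ((hfin_act ℓ m).1 h)), hdir_act]
      rw [h1, h2]
      exact Phase.infiniteSolution_spec hd
        (L.injective_of_infinite_direction (hdir_spec m hmf)) ℓ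

end Solution

end TorusAction

/-! ### Fourier coefficients of smooth functions -/

namespace TorusAction

section Fourier

open MeasureTheory UnitAddTorus

variable {q : ℕ}

/-- The normalized Haar measure on the torus. -/
noncomputable def torusMeasure (q : ℕ) : Measure (Torus q) :=
  Measure.pi fun _ => AddCircle.haarAddCircle

instance : Measure.IsAddHaarMeasure (torusMeasure q) := by
  unfold torusMeasure; infer_instance

instance : IsProbabilityMeasure (torusMeasure q) := by
  unfold torusMeasure; infer_instance

theorem mFourierCoeff_def (f : Torus q → ℂ) (n : Fin q → ℤ) :
    mFourierCoeff f n = ∫ x, mFourier (-n) x * f x ∂torusMeasure q := rfl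

theorem mFourier_eq_toCircle (n : Fin q → ℤ) (x : Torus q) :
    mFourier n x = ((AddCircle.toCircle (∑ i, n i • x i : UnitAddCircle) : Circle) : ℂ) := by
  have h : ∀ s : Finset (Fin q), ∏ i ∈ s, fourier (n i) (x i) =
      ((AddCircle.toCircle (∑ i ∈ s, n i • x i : UnitAddCircle) : Circle) : ℂ) := by
    intro s
    induction s using Finset.cons_induction with
    | empty => simp
    | cons a s ha ih =>
      rw [Finset.prod_cons, Finset.sum_cons, AddCircle.toCircle_add, Circle.coe_mul, ih,
        fourier_apply]
  exact h Finset.univ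

theorem mFourier_apply_add (n : Fin q → ℤ) (x y : Torus q) :
    mFourier n (x + y) = mFourier n x * mFourier n y := by
  simp only [mFourier_eq_toCircle, Pi.add_apply, smul_add, Finset.sum_add_distrib,
    AddCircle.toCircle_add, Circle.coe_mul]

theorem norm_mFourier_apply (n : Fin q → ℤ) (x : Torus q) : ‖mFourier n x‖ = 1 := by
  rw [mFourier_eq_toCircle, Circle.norm_coe]

theorem mFourier_toral (A : Matrix (Fin q) (Fin q) ℤ) (n : Fin q → ℤ) (x : Torus q) :
    mFourier n (toral A x) = mFourier (A.transpose.mulVec n) x := by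
  rw [mFourier_eq_toCircle, mFourier_eq_toCircle]
  congr 2
  simp only [toral, Matrix.mulVec, dotProduct, Finset.smul_sum, Finset.sum_smul,
    Matrix.transpose_apply]
  rw [Finset.sum_comm]
  refine Finset.sum_congr rfl fun j _ => Finset.sum_congr rfl fun i _ => ?_
  rw [smul_smul, mul_comm]

theorem mFourier_nsmul_left (n : Fin q → ℤ) (k : ℕ) (x : Torus q) :
    mFourier (k • n) x = mFourier n x ^ k := by
  rw [mFourier_eq_toCircle, mFourier_eq_toCircle, ← Circle.coe_pow, ← AddCircle.toCircle_nsmul,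
    Finset.smul_sum]
  congr 3
  exact funext fun i => by rw [Pi.smul_apply, smul_assoc]

theorem mFourier_nsmul_right (n : Fin q → ℤ) (k : ℕ) (x : Torus q) :
    mFourier n (k • x) = mFourier n x ^ k := by
  rw [mFourier_eq_toCircle, mFourier_eq_toCircle, ← Circle.coe_pow, ← AddCircle.toCircle_nsmul,
    Finset.smul_sum]
  congr 3
  exact funext fun i => by rw [Pi.smul_apply, smul_comm]

theorem mFourier_proj (n : Fin q → ℤ) (x : Fin q → ℝ) :
    mFourier n (proj x) = Complex.exp (((∑ i, (n i : ℝ) * x i : ℝ) : ℂ) * (2 * Real.pi * Complex.I)) := by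
  change ∏ i, fourier (n i) ((x i : ℝ) : UnitAddCircle) = _
  rw [Complex.ofReal_sum, Finset.sum_mul, Complex.exp_sum]
  refine Finset.prod_congr rfl fun i _ => ?_
  rw [fourier_coe_apply]
  congr 1
  push_cast
  ring

theorem isOpenQuotientMap_proj : IsOpenQuotientMap (proj : (Fin q → ℝ) → Torus q) :=
  IsOpenQuotientMap.piMap fun _ => QuotientAddGroup.isOpenQuotientMap_mk

/-- Complex valued smooth functions on the torus. -/
def IsSmoothC (f : Torus q → ℂ) : Prop := ContDiff ℝ ∞ fun x : Fin q → ℝ => f (proj x)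

theorem IsSmoothC.continuous {f : Torus q → ℂ} (hf : IsSmoothC f) : Continuous f :=
  isOpenQuotientMap_proj.isQuotientMap.continuous_iff.2 (ContDiff.continuous hf)

theorem integrable_of_continuous {f : Torus q → ℂ} (hf : Continuous f) :
    Integrable f (torusMeasure q) :=
  hf.integrable_of_hasCompactSupport (HasCompactSupport.of_compactSpace f)

theorem exists_bound_of_continuous {f : Torus q → ℂ} (hf : Continuous f) :
    ∃ C, ∀ x, ‖f x‖ ≤ C := by
  obtain ⟨C, hC⟩ := isCompact_univ.exists_bound_of_continuousOn hf.continuousOn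
  exact ⟨C, fun x => hC x (Set.mem_univ x)⟩

theorem norm_mFourierCoeff_le {f : Torus q → ℂ} {C : ℝ} (hC : ∀ x, ‖f x‖ ≤ C) (n : Fin q → ℤ) :
    ‖mFourierCoeff f n‖ ≤ C := by
  rw [mFourierCoeff_def]
  have := norm_integral_le_of_norm_le_const (μ := torusMeasure q) (C := C)
    (f := fun x => mFourier (-n) x * f x) (Filter.Eventually.of_forall fun x => by
      rw [norm_mul, norm_mFourier_apply, one_mul]; exact hC x)
  simpa using this

/-- The coefficients of a translate. -/
theorem mFourierCoeff_translate (f : Torus q → ℂ) (y : Torus q) (n : Fin q → ℤ) :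
    mFourierCoeff (fun x => f (x + y)) n = mFourier n y * mFourierCoeff f n := by
  rw [mFourierCoeff_def, mFourierCoeff_def, ← integral_const_mul,
    ← integral_add_right_eq_self (μ := torusMeasure q)
      (fun x => mFourier n y * (mFourier (-n) x * f x)) y]
  refine integral_congr_ae (Filter.Eventually.of_forall fun x => ?_)
  simp only
  have h1 : mFourier n y * mFourier (-n) y = 1 := by
    rw [← mFourier_add, add_neg_cancel, mFourier_zero]; rfl
  rw [mFourier_apply_add]
  linear_combination -(mFourier (-n) x * f (x + y)) * h1

/-- The coefficients of a partial derivative. -/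
theorem IsSmoothC.exists_deriv {f : Torus q → ℂ} (hf : IsSmoothC f) (i : Fin q) :
    ∃ g : Torus q → ℂ, IsSmoothC g ∧
      ∀ n, mFourierCoeff g n = (n i : ℂ) * (2 * Real.pi * Complex.I) * mFourierCoeff f n := by
  set e : Fin q → ℝ := Pi.single i 1 with he
  set F : (Fin q → ℝ) → ℂ := fun x => f (proj x) with hF
  -- The partial derivative is defined on the torus itself by translation, so no descent from `ℝ^q`
  -- is needed; its coefficients come from differentiating those of the translates at `t = 0`.
  set g : Torus q → ℂ := fun y => deriv (fun t : ℝ => f (y + proj (t • e))) 0 with hg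
  have hFd : Differentiable ℝ F := ContDiff.differentiable hf (by simp)
  have hline : ∀ x t, HasDerivAt (fun t : ℝ => F (x + t • e)) (fderiv ℝ F (x + t • e) e) t := by
    intro x t
    have h1 : HasDerivAt (fun t : ℝ => x + t • e) e t := by
      simpa using ((hasDerivAt_id t).smul_const e).const_add x
    exact (hFd (x + t • e)).hasFDerivAt.comp_hasDerivAt t h1
  have hgF : ∀ x, g (proj x) = fderiv ℝ F x e := by
    intro x
    have h1 := hline x 0
    rw [zero_smul, add_zero] at h1
    rw [← h1.deriv]
    simp only [hg, hF, proj_add]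
  have hgs : IsSmoothC g := by
    have h1 : (fun x : Fin q → ℝ => g (proj x)) = fun x => fderiv ℝ F x e := funext hgF
    rw [IsSmoothC, h1]
    exact (ContDiff.fderiv_right hf (m := ∞) (by simp)).clm_apply contDiff_const
  have hder : ∀ y t, HasDerivAt (fun t : ℝ => f (y + proj (t • e))) (g (y + proj (t • e))) t := by
    intro y t
    obtain ⟨x, rfl⟩ := proj_surjective y
    rw [← proj_add, hgF]
    have h1 := hline x t
    simpa only [hF, proj_add] using h1
  refine ⟨g, hgs, fun n => ?_⟩
  obtain ⟨C, hC⟩ := exists_bound_of_continuous hgs.continuous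
  have hcont : ∀ {k : Torus q → ℂ}, Continuous k → ∀ t : ℝ,
      Continuous fun y => mFourier (-n) y * k (y + proj (t • e)) := fun {k} hk t => by
    fun_prop
  have h1 := (hasDerivAt_integral_of_dominated_loc_of_deriv_le (μ := torusMeasure q)
    (F := fun (t : ℝ) (y : Torus q) => mFourier (-n) y * f (y + proj (t • e)))
    (F' := fun (t : ℝ) (y : Torus q) => mFourier (-n) y * g (y + proj (t • e)))
    (x₀ := 0) (s := Set.univ) (bound := fun _ => C) Filter.univ_mem
    (Filter.Eventually.of_forall fun t => (integrable_of_continuous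
      (hcont hf.continuous t)).aestronglyMeasurable)
    (integrable_of_continuous (hcont hf.continuous 0))
    (integrable_of_continuous (hcont hgs.continuous 0)).aestronglyMeasurable
    (Filter.Eventually.of_forall fun y t _ => by
      rw [norm_mul, norm_mFourier_apply, one_mul]; exact hC _)
    (integrable_const C)
    (Filter.Eventually.of_forall fun y t _ => (hder y t).const_mul _)).2
  have h2 : (fun t : ℝ => ∫ y, mFourier (-n) y * f (y + proj (t • e)) ∂torusMeasure q) =
      fun t : ℝ => Complex.exp ((t : ℂ) * ((n i : ℂ) * (2 * Real.pi * Complex.I))) *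
        mFourierCoeff f n := by
    funext t
    rw [← mFourierCoeff_def (fun y => f (y + proj (t • e))), mFourierCoeff_translate,
      mFourier_proj]
    congr 2
    have : ∑ j, (n j : ℝ) * (t • e) j = n i * t := by
      simp [he, Pi.single_apply]
    rw [this]
    push_cast
    ring
  rw [h2] at h1
  have h3 : HasDerivAt (fun t : ℝ => Complex.exp ((t : ℂ) * ((n i : ℂ) *
      (2 * Real.pi * Complex.I))) * mFourierCoeff f n)
      ((n i : ℂ) * (2 * Real.pi * Complex.I) * mFourierCoeff f n) 0 := by
    have h4 : HasDerivAt (fun t : ℝ => (t : ℂ) * ((n i : ℂ) * (2 * Real.pi * Complex.I)))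
        ((n i : ℂ) * (2 * Real.pi * Complex.I)) 0 := by
      simpa using (Complex.ofRealCLM.hasDerivAt (x := (0 : ℝ))).mul_const
        ((n i : ℂ) * (2 * Real.pi * Complex.I))
    have h5 := h4.cexp.mul_const (mFourierCoeff f n)
    simpa using h5
  have h6 := h1.unique h3
  rw [← h6, mFourierCoeff_def]
  simp [proj_zero]

theorem IsSmoothC.coeff_decay (i : Fin q) (M : ℕ) : ∀ {f : Torus q → ℂ}, IsSmoothC f →
    ∃ C, ∀ n : Fin q → ℤ, ‖n i‖ ^ M * ‖mFourierCoeff f n‖ ≤ C := by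
  induction M with
  | zero =>
    intro f hf
    obtain ⟨C, hC⟩ := exists_bound_of_continuous hf.continuous
    exact ⟨C, fun n => by rw [pow_zero, one_mul]; exact norm_mFourierCoeff_le hC n⟩
  | succ M ih =>
    intro f hf
    obtain ⟨g, hg, hgf⟩ := hf.exists_deriv i
    obtain ⟨C, hC⟩ := ih hg
    refine ⟨C, fun n => ?_⟩
    have h1 := hC n
    have h2 : ‖(n i : ℂ) * (2 * Real.pi * Complex.I)‖ = ‖n i‖ * (2 * Real.pi) := by
      rw [norm_mul, Complex.norm_intCast, Int.norm_eq_abs]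
      simp [abs_of_pos Real.pi_pos]
    rw [hgf, norm_mul, h2] at h1
    have h3 : 1 ≤ 2 * Real.pi := by linarith [Real.pi_gt_three]
    calc ‖n i‖ ^ (M + 1) * ‖mFourierCoeff f n‖
        ≤ (‖n i‖ ^ (M + 1) * ‖mFourierCoeff f n‖) * (2 * Real.pi) :=
          le_mul_of_one_le_right (by positivity) h3
      _ = ‖n i‖ ^ M * (‖n i‖ * (2 * Real.pi) * ‖mFourierCoeff f n‖) := by ring
      _ ≤ C := h1

/-- The Fourier coefficients of a smooth function decay rapidly. -/
theorem IsSmoothC.rapidDecay {f : Torus q → ℂ} (hf : IsSmoothC f) :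
    RapidDecay (mFourierCoeff f) := by
  intro M
  choose C hC using fun i : Fin q => hf.coeff_decay i M
  obtain ⟨C0, hC0⟩ := exists_bound_of_continuous hf.continuous
  have hCn : ∀ i, 0 ≤ C i := fun i => le_trans (by positivity) (hC i 0)
  have hS : 0 ≤ ∑ i, C i := Finset.sum_nonneg fun i _ => hCn i
  have hC00 : 0 ≤ C0 := le_trans (norm_nonneg _) (hC0 0)
  refine ⟨2 ^ (M - 1) * (C0 + (C0 + ∑ i, C i)), fun n => ?_⟩
  have h0 := norm_mFourierCoeff_le hC0 n
  have h1 : ‖n‖ ^ M * ‖mFourierCoeff f n‖ ≤ C0 + ∑ i, C i := by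
    rcases isEmpty_or_nonempty (Fin q) with he | he
    · rw [Subsingleton.elim n 0, norm_zero]
      rw [Subsingleton.elim n 0] at h0
      rcases Nat.eq_zero_or_pos M with rfl | hM
      · rw [pow_zero, one_mul]; linarith
      · rw [zero_pow hM.ne', zero_mul]; linarith
    · obtain ⟨i, hi⟩ := Finite.exists_max fun i => ‖n i‖
      have hle : ‖n‖ ≤ ‖n i‖ := (pi_norm_le_iff_of_nonneg (norm_nonneg _)).2 hi
      calc ‖n‖ ^ M * ‖mFourierCoeff f n‖ ≤ ‖n i‖ ^ M * ‖mFourierCoeff f n‖ := by gcongr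
        _ ≤ C i := hC i n
        _ ≤ ∑ i, C i := Finset.single_le_sum (fun i _ => hCn i) (Finset.mem_univ i)
        _ ≤ _ := by linarith
  have h2 : (1 + ‖n‖) ^ M ≤ 2 ^ (M - 1) * (1 + ‖n‖ ^ M) := by
    simpa using add_pow_le zero_le_one (norm_nonneg n) M
  calc (1 + ‖n‖) ^ M * ‖mFourierCoeff f n‖
      ≤ 2 ^ (M - 1) * (1 + ‖n‖ ^ M) * ‖mFourierCoeff f n‖ := by gcongr
    _ = 2 ^ (M - 1) * (‖mFourierCoeff f n‖ + ‖n‖ ^ M * ‖mFourierCoeff f n‖) := by ring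
    _ ≤ _ := by gcongr

end Fourier

end TorusAction

/-! ### Fourier series with rapidly decreasing coefficients -/

namespace TorusAction

section Series

open MeasureTheory UnitAddTorus

variable {p q : ℕ}

/-- The linear form `x ↦ n · x`. -/
noncomputable def pairing (n : Fin q → ℤ) : (Fin q → ℝ) →L[ℝ] ℝ :=
  ∑ i, (n i : ℝ) • ContinuousLinearMap.proj i

theorem pairing_apply (n : Fin q → ℤ) (x : Fin q → ℝ) : pairing n x = ∑ i, (n i : ℝ) * x i := by
  simp [pairing]

theorem norm_pairing_le (n : Fin q → ℤ) : ‖pairing n‖ ≤ q * ‖n‖ := by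
  refine ContinuousLinearMap.opNorm_le_bound _ (by positivity) fun x => ?_
  rw [pairing_apply]
  calc ‖∑ i, (n i : ℝ) * x i‖ ≤ ∑ i : Fin q, ‖n‖ * ‖x‖ := by
        refine norm_sum_le_of_le _ fun i _ => ?_
        rw [norm_mul, Int.norm_cast_real]
        exact mul_le_mul (norm_le_pi_norm n i) (norm_le_pi_norm x i) (norm_nonneg _)
          (norm_nonneg _)
    _ = q * ‖n‖ * ‖x‖ := by simp [mul_assoc]

theorem iteratedDeriv_cexp_mul (c : ℂ) (k : ℕ) :
    iteratedDeriv k (fun t : ℝ => Complex.exp (t * c)) =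
      fun t : ℝ => c ^ k * Complex.exp (t * c) := by
  induction k with
  | zero => simp
  | succ k ih =>
    rw [iteratedDeriv_succ, ih]
    funext t
    have h1 : HasDerivAt (fun t : ℝ => (t : ℂ) * c) c t := by
      simpa using (Complex.ofRealCLM.hasDerivAt (x := t)).mul_const c
    rw [(h1.cexp.const_mul (c ^ k)).deriv, pow_succ]
    ring

/-- On `ℝ^q`, a character is the exponential of a linear form. -/
theorem mFourier_proj_eq_comp (n : Fin q → ℤ) :
    (fun x : Fin q → ℝ => mFourier n (proj x)) =
      (fun t : ℝ => Complex.exp (t * (2 * Real.pi * Complex.I))) ∘ pairing n := by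
  funext x
  rw [mFourier_proj, Function.comp_apply, pairing_apply]

theorem contDiff_cexp_mul (c : ℂ) : ContDiff ℝ ∞ fun t : ℝ => Complex.exp (t * c) :=
  (Complex.ofRealCLM.contDiff.mul contDiff_const).cexp

theorem isSmoothC_mFourier (n : Fin q → ℤ) : IsSmoothC (mFourier n : Torus q → ℂ) := by
  rw [IsSmoothC, mFourier_proj_eq_comp]
  exact (contDiff_cexp_mul _).comp (pairing n).contDiff

theorem norm_iteratedFDeriv_mFourier_le (n : Fin q → ℤ) (k : ℕ) (x : Fin q → ℝ) :
    ‖iteratedFDeriv ℝ k (fun x : Fin q → ℝ => mFourier n (proj x)) x‖ ≤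
      (2 * Real.pi * q) ^ k * (1 + ‖n‖) ^ k := by
  rw [mFourier_proj_eq_comp, (pairing n).iteratedFDeriv_comp_right (contDiff_cexp_mul _) x
    (i := k) (by exact_mod_cast le_top)]
  refine (ContinuousMultilinearMap.norm_compContinuousLinearMap_le _ _).trans ?_
  rw [norm_iteratedFDeriv_eq_norm_iteratedDeriv, iteratedDeriv_cexp_mul, Finset.prod_const,
    Finset.card_univ, Fintype.card_fin, norm_mul, norm_pow]
  have h1 : ‖(2 * Real.pi * Complex.I : ℂ)‖ = 2 * Real.pi := by simp [abs_of_pos Real.pi_pos]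
  have h2 : ‖Complex.exp ((pairing n x : ℝ) * (2 * Real.pi * Complex.I))‖ = 1 := by
    rw [show ((pairing n x : ℝ) : ℂ) * (2 * Real.pi * Complex.I) =
      ((pairing n x * (2 * Real.pi) : ℝ) : ℂ) * Complex.I by push_cast; ring,
      Complex.norm_exp_ofReal_mul_I]
  rw [h1, h2, mul_one]
  have h3 : ‖pairing n‖ ≤ q * (1 + ‖n‖) :=
    (norm_pairing_le n).trans (by gcongr; linarith)
  calc (2 * Real.pi) ^ k * ‖pairing n‖ ^ k ≤ (2 * Real.pi) ^ k * (q * (1 + ‖n‖)) ^ k := by gcongr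
    _ = _ := by simp only [mul_pow]; ring

/-- The sum of a Fourier series with rapidly decreasing coefficients is smooth. -/
theorem RapidDecay.isSmoothC {a : (Fin q → ℤ) → ℂ} (ha : RapidDecay a) :
    IsSmoothC fun x => ∑' n, a n * mFourier n x := by
  refine contDiff_tsum (N := ⊤) (f := fun n (x : Fin q → ℝ) => a n * mFourier n (proj x))
    (v := fun k n => (2 * Real.pi * q) ^ k * ((1 + ‖n‖) ^ k * ‖a n‖))
    (fun n => contDiff_const.mul (isSmoothC_mFourier n)) (fun k _ => (ha.weight k).mul_left _) ?_
  intro k n x _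
  have h1 : (fun x : Fin q → ℝ => a n * mFourier n (proj x)) =
      a n • fun x : Fin q → ℝ => mFourier n (proj x) := rfl
  rw [h1, iteratedFDeriv_const_smul_apply
    ((ContDiff.contDiffAt (isSmoothC_mFourier n)).of_le (by exact_mod_cast le_top)), norm_smul]
  calc ‖a n‖ * _ ≤ ‖a n‖ * ((2 * Real.pi * q) ^ k * (1 + ‖n‖) ^ k) := by
        gcongr; exact norm_iteratedFDeriv_mFourier_le n k x
    _ = _ := by ring

/-- Translation by half a period of the character changes the sign of the coefficient but not the
constant function. -/
theorem mFourierCoeff_const (c : ℂ) {n : Fin q → ℤ} (hn : n ≠ 0) :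
    mFourierCoeff (fun _ : Torus q => c) n = 0 := by
  obtain ⟨i, hi⟩ := Function.ne_iff.1 hn
  have hi' : (n i : ℝ) ≠ 0 := by exact_mod_cast hi
  have h1 := mFourierCoeff_translate (fun _ : Torus q => c)
    (proj (Pi.single i (1 / (2 * (n i : ℝ))))) n
  have h2 : mFourier n (proj (Pi.single i (1 / (2 * (n i : ℝ))))) = -1 := by
    rw [mFourier_proj]
    have : ∑ j, (n j : ℝ) * (Pi.single i (1 / (2 * (n i : ℝ))) : Fin q → ℝ) j = 1 / 2 := by
      simp only [Pi.single_apply, mul_ite, mul_zero, Finset.sum_ite_eq', Finset.mem_univ, if_true]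
      field_simp
    rw [this, ← Complex.exp_pi_mul_I]
    congr 1
    push_cast
    ring
  rw [h2] at h1
  linear_combination (1 / 2 : ℂ) * h1

theorem mFourierCoeff_one_zero : mFourierCoeff (fun _ : Torus q => (1 : ℂ)) 0 = 1 := by
  rw [mFourierCoeff_def, neg_zero, mFourier_zero]
  simp

theorem integral_mFourier_neg_mul (m n : Fin q → ℤ) :
    ∫ x, mFourier (-m) x * mFourier n x ∂torusMeasure q = if n = m then 1 else 0 := by
  have h1 : ∀ x : Torus q, mFourier (-m) x * mFourier n x = mFourier (-(m - n)) x * 1 := by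
    intro x
    rw [← mFourier_add, mul_one, neg_sub, neg_add_eq_sub]
  simp only [h1]
  rw [← mFourierCoeff_def (fun _ => (1 : ℂ))]
  split_ifs with h
  · rw [h, sub_self, mFourierCoeff_one_zero]
  · exact mFourierCoeff_const 1 (sub_ne_zero.2 (Ne.symm h))

theorem RapidDecay.mFourierCoeff_series {a : (Fin q → ℤ) → ℂ} (ha : RapidDecay a)
    (m : Fin q → ℤ) : mFourierCoeff (fun x => ∑' n, a n * mFourier n x) m = a m := by
  rw [mFourierCoeff_def]
  have h1 : ∀ x : Torus q, mFourier (-m) x * ∑' n, a n * mFourier n x =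
      ∑' n, a n * (mFourier (-m) x * mFourier n x) := fun x => by
    rw [← tsum_mul_left]
    exact tsum_congr fun n => by ring
  simp only [h1]
  rw [← integral_tsum_of_summable_integral_norm
    (F := fun n (x : Torus q) => a n * (mFourier (-m) x * mFourier n x))
    (fun n => integrable_of_continuous (by fun_prop))]
  · simp only [integral_const_mul, integral_mFourier_neg_mul, mul_ite, mul_one, mul_zero]
    exact tsum_ite_eq m a
  · simpa [norm_mFourier_apply] using ha.summable

/-- Fourier inversion. -/
theorem IsSmoothC.hasSum {f : Torus q → ℂ} (hf : IsSmoothC f) (x : Torus q) :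
    HasSum (fun n => mFourierCoeff f n * mFourier n x) (f x) :=
  hasSum_mFourier_series_apply_of_summable (f := ⟨f, hf.continuous⟩)
    (Summable.of_norm hf.rapidDecay.summable) x

/-- A smooth function with no nonzero modes is constant. -/
theorem IsSmoothC.eq_coeff_zero {f : Torus q → ℂ} (hf : IsSmoothC f)
    (h : ∀ n, n ≠ 0 → mFourierCoeff f n = 0) (x : Torus q) : f x = mFourierCoeff f 0 := by
  have h1 := hf.hasSum x
  have h2 := hasSum_single (f := fun n => mFourierCoeff f n * mFourier n x) 0
    (fun n hn => by simp only [h n hn, zero_mul])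
  rw [mFourier_zero] at h2
  simpa using h1.unique h2

theorem IsSmoothC.ext {f g : Torus q → ℂ} (hf : IsSmoothC f) (hg : IsSmoothC g)
    (h : ∀ n, mFourierCoeff f n = mFourierCoeff g n) : f = g := by
  funext x
  have h1 := hf.hasSum x
  simp only [h] at h1
  exact h1.unique (hg.hasSum x)

theorem mFourierCoeff_add {f g : Torus q → ℂ} (hf : Continuous f) (hg : Continuous g)
    (n : Fin q → ℤ) :
    mFourierCoeff (fun x => f x + g x) n = mFourierCoeff f n + mFourierCoeff g n := by
  simp only [mFourierCoeff_def, mul_add]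
  exact integral_add (integrable_of_continuous (by fun_prop))
    (integrable_of_continuous (by fun_prop))

theorem mFourierCoeff_sub {f g : Torus q → ℂ} (hf : Continuous f) (hg : Continuous g)
    (n : Fin q → ℤ) :
    mFourierCoeff (fun x => f x - g x) n = mFourierCoeff f n - mFourierCoeff g n := by
  simp only [mFourierCoeff_def, mul_sub]
  exact integral_sub (integrable_of_continuous (by fun_prop))
    (integrable_of_continuous (by fun_prop))

/-- A continuous surjective endomorphism of a compact group preserves normalized Haar measure. -/
theorem measurePreserving_toral (A : GL (Fin q) ℤ) :
    MeasurePreserving (toral A.val) (torusMeasure q) (torusMeasure q) :=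
  AddMonoidHom.measurePreserving
    (f := ({ toFun := toral A.val, map_zero' := toral_zero _, map_add' := toral_add _ } :
      Torus q →+ Torus q)) (continuous_toral _)
    (fun x => ⟨toral (A⁻¹).val x, by
      change toral A.val (toral (A⁻¹).val x) = x
      rw [← toral_mul, Units.mul_inv, toral_one]⟩) rfl

/-- The coefficients of a composition with an automorphism. -/
theorem mFourierCoeff_toral {f : Torus q → ℂ} (hf : Continuous f) (A : GL (Fin q) ℤ)
    (n : Fin q → ℤ) : mFourierCoeff (fun x => f (toral A.val x)) n =
      mFourierCoeff f ((A⁻¹).val.transpose.mulVec n) := by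
  have hA : ∀ x, toral (A⁻¹).val (toral A.val x) = x := fun x => by
    rw [← toral_mul, Units.inv_mul, toral_one]
  set g : Torus q → ℂ := fun y => mFourier (-n) (toral (A⁻¹).val y) * f y with hg
  have hgc : Continuous g := by
    have := continuous_toral (A⁻¹).val
    fun_prop
  have h1 : ∫ x, g (toral A.val x) ∂torusMeasure q = ∫ y, g y ∂torusMeasure q := by
    rw [← (measurePreserving_toral A).map_eq, integral_map
      (continuous_toral _).measurable.aemeasurable hgc.aestronglyMeasurable,
      (measurePreserving_toral A).map_eq]
  simp only [hg, hA] at h1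
  rw [mFourierCoeff_def, h1, mFourierCoeff_def]
  simp only [mFourier_toral, Matrix.mulVec_neg]

theorem contDiff_realMap (A : Matrix (Fin q) (Fin q) ℤ) : ContDiff ℝ ∞ (realMap A) := by
  unfold realMap; fun_prop

theorem HasData.act_proj {φ : AffineAction p q} {A : (Fin p → ℤ) → GL (Fin q) ℤ}
    {a : (Fin p → ℤ) → Torus q} (h : HasData φ A a) (ℓ : Fin p → ℤ) :
    ∃ v, ∀ x, act φ ℓ (proj x) = proj (realMap (A ℓ).val x + v) := by
  obtain ⟨v, hv⟩ := proj_surjective (a ℓ)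
  exact ⟨v, fun x => by rw [h, proj_add, proj_realMap, hv]⟩

theorem IsSmoothC.comp_act {f : Torus q → ℂ} (hf : IsSmoothC f) (φ : AffineAction p q)
    (ℓ : Fin p → ℤ) : IsSmoothC fun x => f (act φ ℓ x) := by
  obtain ⟨A, a, h⟩ := exists_hasData φ
  obtain ⟨v, hv⟩ := h.act_proj ℓ
  simp only [IsSmoothC, hv]
  have hf' : ContDiff ℝ ∞ fun x : Fin q → ℝ => f (proj x) := hf
  exact hf'.comp ((contDiff_realMap _).add contDiff_const)

end Series

end TorusAction

/-! ### Cohomological rigidity in terms of phases -/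

namespace TorusAction

section Rigidity

open UnitAddTorus

variable {p q : ℕ} {φ ψ : AffineAction p q} {A : (Fin p → ℤ) → GL (Fin q) ℤ}
  {a : (Fin p → ℤ) → Torus q}

/-- The action on the dual lattice of the torus induced by the linear parts of an affine action. -/
def HasData.dual (h : HasData φ A a) : LatticeAction p q where
  mat ℓ := (A (-ℓ)).val.transpose
  mat_zero := by rw [neg_zero, h.linear_zero, Units.val_one, Matrix.transpose_one]
  mat_add ℓ ℓ' := by
    rw [neg_add_rev, h.linear_add, Units.val_mul, Matrix.transpose_mul]

theorem HasData.dual_act (h : HasData φ A a) (ℓ : Fin p → ℤ) (m : Fin q → ℤ) :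
    h.dual.act ℓ m = (A (-ℓ)).val.transpose.mulVec m := rfl

theorem HasData.inv_eq (h : HasData φ A a) (ℓ : Fin p → ℤ) : (A ℓ)⁻¹ = A (-ℓ) := by
  rw [inv_eq_iff_mul_eq_one, ← h.linear_add, add_neg_cancel, h.linear_zero]

theorem HasData.transpose_mulVec_dual_act (h : HasData φ A a) (ℓ : Fin p → ℤ) (m : Fin q → ℤ) :
    (A ℓ).val.transpose.mulVec (h.dual.act ℓ m) = m := by
  rw [h.dual_act, Matrix.mulVec_mulVec, ← Matrix.transpose_mul, ← Units.val_mul, ← h.linear_add,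
    neg_add_cancel, h.linear_zero, Units.val_one, Matrix.transpose_one, Matrix.one_mulVec]

/-- The phases by which an affine action acts on Fourier coefficients. -/
noncomputable def HasData.phase (h : HasData φ A a) : Phase h.dual where
  val ℓ m := mFourier (h.dual.act ℓ m) (a ℓ)
  norm_val _ _ := norm_mFourier_apply _ _
  val_add ℓ ℓ' m := by
    rw [add_comm ℓ ℓ', h.translation_add, mFourier_apply_add, mFourier_toral,
      h.dual.act_add, h.dual.act_comm, h.dual.act_comm, h.transpose_mulVec_dual_act]
  val_nsmul ℓ k m := by rw [h.dual.act_nsmul, mFourier_nsmul_left]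

theorem HasData.mFourierCoeff_comp_act (h : HasData φ A a) {f : Torus q → ℂ} (hf : Continuous f)
    (ℓ : Fin p → ℤ) (m : Fin q → ℤ) : mFourierCoeff (fun x => f (act φ ℓ x)) m =
      h.phase.val ℓ m * mFourierCoeff f (h.dual.act ℓ m) := by
  simp only [h ℓ]
  rw [mFourierCoeff_toral (f := fun x => f (x + a ℓ)) (by fun_prop), mFourierCoeff_translate,
    h.inv_eq]
  rfl

theorem IsSmoothC.re {f : Torus q → ℂ} (hf : IsSmoothC f) : IsSmooth fun x => (f x).re :=
  Complex.reCLM.contDiff.comp hf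

theorem IsSmoothC.im {f : Torus q → ℂ} (hf : IsSmoothC f) : IsSmooth fun x => (f x).im :=
  Complex.imCLM.contDiff.comp hf

theorem IsSmooth.ofReal {f : Torus q → ℝ} (hf : IsSmooth f) : IsSmoothC fun x => (f x : ℂ) :=
  Complex.ofRealCLM.contDiff.comp hf

theorem IsSmoothC.add {f g : Torus q → ℂ} (hf : IsSmoothC f) (hg : IsSmoothC g) :
    IsSmoothC fun x => f x + g x := ContDiff.add hf hg

theorem IsSmoothC.sub {f g : Torus q → ℂ} (hf : IsSmoothC f) (hg : IsSmoothC g) :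
    IsSmoothC fun x => f x - g x := ContDiff.sub hf hg

theorem IsSmoothC.const_mul {f : Torus q → ℂ} (hf : IsSmoothC f) (c : ℂ) :
    IsSmoothC fun x => c * f x := ContDiff.mul contDiff_const hf

/-- Sum the coefficients to a smooth complex cocycle and trivialize its real and imaginary parts
separately; the constants left over affect only the zero mode. -/
theorem HasData.rigid_phase (h : HasData φ A a) (hφ : IsCohomologicallyRigid φ) :
    h.phase.Rigid := by
  intro d hd
  set f : (Fin p → ℤ) → Torus q → ℂ := fun ℓ x => ∑' n, d ℓ n * mFourier n x with hf
  have hfs : ∀ ℓ, IsSmoothC (f ℓ) := fun ℓ => (hd.1 ℓ).isSmoothC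
  have hfd : ∀ ℓ m, mFourierCoeff (f ℓ) m = d ℓ m := fun ℓ => (hd.1 ℓ).mFourierCoeff_series
  have hfc : ∀ ℓ ℓ' x, f (ℓ + ℓ') x = f ℓ (act φ ℓ' x) + f ℓ' x := by
    intro ℓ ℓ'
    have h1 := (hfs ℓ).comp_act φ ℓ'
    refine congrFun (IsSmoothC.ext (hfs _) (h1.add (hfs ℓ')) fun n => ?_)
    rw [mFourierCoeff_add h1.continuous (hfs ℓ').continuous,
      h.mFourierCoeff_comp_act (hfs ℓ).continuous, hfd, hfd, hfd, hd.2]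
  obtain ⟨h₁, u₁, hu₁, e₁⟩ := hφ (fun ℓ x => (f ℓ x).re)
    ⟨fun ℓ => (hfs ℓ).re, fun ℓ ℓ' x => (congrArg Complex.re (hfc ℓ ℓ' x)).trans (Complex.add_re _ _)⟩
  obtain ⟨h₂, u₂, hu₂, e₂⟩ := hφ (fun ℓ x => (f ℓ x).im)
    ⟨fun ℓ => (hfs ℓ).im, fun ℓ ℓ' x => (congrArg Complex.im (hfc ℓ ℓ' x)).trans (Complex.add_im _ _)⟩
  set u : Torus q → ℂ := fun x => u₁ x + Complex.I * u₂ x with hu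
  have hus : IsSmoothC u := hu₁.ofReal.add (hu₂.ofReal.const_mul _)
  refine ⟨mFourierCoeff u, hus.rapidDecay, fun ℓ m hm => ?_⟩
  have e : f ℓ = fun x => (h₁ ℓ + Complex.I * h₂ ℓ) + (u (act φ ℓ x) - u x) := by
    funext x
    rw [← Complex.re_add_im (f ℓ x), e₁, e₂, hu]
    push_cast
    ring
  have h1 := hus.comp_act φ ℓ
  rw [← hfd, e, mFourierCoeff_add continuous_const (h1.sub hus).continuous,
    mFourierCoeff_const _ hm, mFourierCoeff_sub h1.continuous hus.continuous,
    h.mFourierCoeff_comp_act hus.continuous, zero_add]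

/-- After subtracting the coboundary found on coefficients, only the zero mode is left, so the
remainder is a constant `κ ℓ`. Real parts give the real transfer function and the homomorphism. -/
theorem HasData.isCohomologicallyRigid (h : HasData φ A a) (hρ : h.phase.Rigid) :
    IsCohomologicallyRigid φ := by
  intro c hc
  set f : (Fin p → ℤ) → Torus q → ℂ := fun ℓ x => (c ℓ x : ℂ) with hf
  have hfs : ∀ ℓ, IsSmoothC (f ℓ) := fun ℓ => (hc.1 ℓ).ofReal
  obtain ⟨w, hw, hwd⟩ := hρ (fun ℓ => mFourierCoeff (f ℓ)) ⟨fun ℓ => (hfs ℓ).rapidDecay, by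
    intro ℓ ℓ' m
    have h1 := (hfs ℓ).comp_act φ ℓ'
    have h2 : f (ℓ + ℓ') = fun x => f ℓ (act φ ℓ' x) + f ℓ' x := by
      funext x
      simp only [hf, hc.2]
      push_cast
      rfl
    beta_reduce
    rw [h2, mFourierCoeff_add h1.continuous (hfs ℓ').continuous,
      h.mFourierCoeff_comp_act (hfs ℓ).continuous]⟩
  set v : Torus q → ℂ := fun x => ∑' n, w n * mFourier n x with hv
  have hvs : IsSmoothC v := hw.isSmoothC
  have hvw : ∀ m, mFourierCoeff v m = w m := hw.mFourierCoeff_series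
  have hconst : ∀ ℓ, ∃ κ : ℂ, ∀ x, f ℓ x - (v (act φ ℓ x) - v x) = κ := by
    intro ℓ
    have h1 := hvs.comp_act φ ℓ
    refine ⟨_, IsSmoothC.eq_coeff_zero ((hfs ℓ).sub (h1.sub hvs)) fun m hm => ?_⟩
    rw [mFourierCoeff_sub (hfs ℓ).continuous (h1.sub hvs).continuous,
      mFourierCoeff_sub h1.continuous hvs.continuous, h.mFourierCoeff_comp_act hvs.continuous,
      hvw, hvw, hwd ℓ m hm, sub_self]
  choose κ hκ using hconst
  have hre : ∀ ℓ x, c ℓ x = (κ ℓ).re + ((v (act φ ℓ x)).re - (v x).re) := by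
    intro ℓ x
    rw [← hκ ℓ x]
    simp [hf]
  refine ⟨AddMonoidHom.mk' (fun ℓ => (κ ℓ).re) fun ℓ ℓ' => ?_, fun x => (v x).re, hvs.re, hre⟩
  have e1 := hc.2 ℓ ℓ' 0
  rw [hre (ℓ + ℓ'), hre ℓ, hre ℓ', act_add] at e1
  linarith

/-- Treated apart because the transfer argument tests rigidity with a cocycle built from a
coordinate of `ℤ^p`. -/
theorem isCohomologicallyRigid_of_isEmpty [IsEmpty (Fin p)] (φ : AffineAction p q) :
    IsCohomologicallyRigid φ := by
  intro c hc
  refine ⟨0, 0, contDiff_const, fun ℓ x => ?_⟩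
  rw [Subsingleton.elim ℓ 0]
  have := hc.2 0 0 x
  rw [add_zero, act_zero] at this
  simpa using this

/-- Rigidity passes between affine actions whose translation parts differ by torsion. -/
theorem IsCohomologicallyRigid.of_nsmul_eq {b : (Fin p → ℤ) → Torus q} {s : ℕ} (hs : 0 < s)
    (hφ : HasData φ A a) (hψ : HasData ψ A b) (hab : ∀ ℓ, s • a ℓ = s • b ℓ)
    (h : IsCohomologicallyRigid φ) : IsCohomologicallyRigid ψ := by
  rcases isEmpty_or_nonempty (Fin p) with he | he
  · exact isCohomologicallyRigid_of_isEmpty ψ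
  · refine hψ.isCohomologicallyRigid (Phase.Rigid.of_pow_eq (hφ.rigid_phase h) hs fun ℓ m => ?_)
    -- The two dual lattice actions coincide definitionally, since their matrices come from `A`
    -- alone.
    change mFourier (hφ.dual.act ℓ m) (a ℓ) ^ s = mFourier (hφ.dual.act ℓ m) (b ℓ) ^ s
    rw [← mFourier_nsmul_right, ← mFourier_nsmul_right, hab]

end Rigidity

end TorusAction

theorem mainTheorem10 (p q : ℕ) (φ : TorusAction.AffineAction p q) :
    (∃ ψ : TorusAction.AffineAction p q, TorusAction.IsPrincipal φ ψ) ∧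
    ∀ ψ : TorusAction.AffineAction p q, TorusAction.IsPrincipal φ ψ →
      TorusAction.Isotopic ψ (TorusAction.linearPart φ) ∧
      (TorusAction.IsFree φ → TorusAction.IsFree ψ) ∧
      (TorusAction.IsMinimal φ → TorusAction.IsMinimal ψ) ∧
      (TorusAction.IsCohomologicallyRigid φ → TorusAction.IsCohomologicallyRigid ψ) := by
  refine ⟨TorusAction.exists_principal φ, fun ψ hψ => ?_⟩
  obtain ⟨A, a, γ, s, hs, hA, hB, hγ, hab⟩ := hψ.exists_data
  obtain ⟨N, hN, hagree⟩ := hA.exists_agree hB hs hab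
  exact ⟨TorusAction.isotopic_of_lift hB (TorusAction.linearPart_hasData hA) hγ,
    TorusAction.IsFree.of_agree hN hagree, TorusAction.IsMinimal.of_agree hN hagree,
    TorusAction.IsCohomologicallyRigid.of_nsmul_eq hs hA hB hab⟩
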